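/- Let $d\ge 1$, $a,m_1,m_2,f\in\mathbb{R}$ with $m_1>0$, and put $s=\sqrt{1+a^2}$. Let $\mathbb{S}^d\subset\mathbb{R}^{d+1}$ be the unit sphere with the round metric, with coordinates $(x,y,z)\in\mathbb{R}^{d-1}\times\mathbb{R}\times\mathbb{R}$ on $\mathbb{R}^{d+1}$, and let $\mathbb{S}^d_{SH}=\{q\in\mathbb{S}^d: z<0\}$ be the lower hemisphere. Put $Z_1=(0,a,-1)/s$, $Z_2=(0,-a,-1)/s$, $Z_0=(0,0,-1)$, and let $\theta_i$ be the central angle between $q$ and $Z_i$. The hemispherical Lagrange problem is the natural mechanical system on $\mathbb{S}^d_{SH}$ with energy $$\tilde E_{sph}=E_{sKep}+\tilde V_{sph,2},\qquad E_{sKep}(q,v)=\tfrac12\|v\|^2-m_1 s\cot\theta_1,\qquad \tilde V_{sph,2}(q)=-m_2 s\cot\theta_2+f\tan^2\theta_0 .$$ Let $\mathcal{R}_s\subset T\mathbb{S}^d_{SH}$ be the set of all $(q,v)$ whose orbit under the spherical Kepler problem $E_{sKep}$ on $\mathbb{S}^d$ is non-singular (it exists for all times and avoids $\pm Z_1$),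 is contained in $\mathbb{S}^d_{SH}$, and does not pass through $Z_2$. These orbits are closed, and the partially-averaged system is defined on $\mathcal{R}_s$ by the Hamiltonian $$\tilde E_{sph,a}=E_{sKep}+\int_{S^1}\tilde V_{sph,2}\,ds,$$ where the integral is the average over the closed orbit of $E_{sKep}$ through the given point, parametrized by $S^1=\mathbb{R}/\mathbb{Z}$ proportionally to time. Let $(x,y)$, with $(x,y,-1)\in\mathbb{R}q$, be the central projection of $q\in\mathbb{S}^d_{SH}$ to $\mathbb{R}^d$, and let $\xi=x$, $\eta=(y-a)/s$, $P=(\xi,\eta)\in\mathbb{R}^d$. Let $(\dot\xi,\dot\eta)$ be $(1+\|x\|^2+y^2)^{-1}$ times the derivative of $(\xi,\eta)$ at $q$ in the direction $v$. Define the function $D$ on $T(\mathbb{S}^d_{SH}\setminus\{Z_1\})$ by $$D=C^2-\frac{2a}{s}A_1,\qquad C^2=\sum_{i<j}(P_i\dot P_j-P_j\dot P_i)^2,\qquad A_1=\sum_{i}(\xi_i\dot\eta-\eta\dot\xi_i)\dot\xi_i+\frac{m_1\eta}{\sqrt{\|\xi\|^2+\eta^2}} .$$ Let $\{\cdot,\cdot\}$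 be the Poisson bracket on $T\mathbb{S}^d$ transported from $T^*\mathbb{S}^d$ by the Legendre transformation of the round metric. Then $\tilde E_{sph,a}$ and $D$ are differentiable at every point of $\mathcal{R}_s$, and $D$ is a first integral of the partially-averaged system on $\mathcal{R}_s$: $$\{\tilde E_{sph,a},D\}=0 .$$ -/

import Mathlib

open scoped RealInnerProductSpace

noncomputable section

namespace HemisphericalLagrange

/-- The ambient space `ℝ^{d+1}` of the unit sphere `S^d`, where `d = n + 1`. A point is written
`(x₁, …, x_n, y, z)`; the `y`-coordinate has index `n` and the `z`-coordinate index `n + 1`. -/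
abbrev Ambient (n : ℕ) : Type := EuclideanSpace ℝ (Fin (n + 2))

/-- The space `ℝ^d`, `d = n + 1`, with coordinates `(x₁, …, x_n, y)`. -/
abbrev Chart (n : ℕ) : Type := EuclideanSpace ℝ (Fin (n + 1))

variable {n : ℕ}

/-! ### The sphere, its tangent bundle and its Poisson bracket -/

/-- The index of the coordinate `y` in the ambient space. -/
def yIdx (n : ℕ) : Fin (n + 2) := (Fin.last n).castSucc

/-- The index of the coordinate `z` in the ambient space. -/
def zIdx (n : ℕ) : Fin (n + 2) := Fin.last (n + 1)

/-- The contact point `(0, …, 0, -1)` of the sphere with the hyperplane `z = -1`. -/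
def southPole (n : ℕ) : Ambient n := -EuclideanSpace.single (zIdx n) 1

/-- The open lower hemisphere of the unit sphere. -/
def lowerHemisphere (n : ℕ) : Set (Ambient n) := {q | ‖q‖ = 1 ∧ q (zIdx n) < 0}

/-- Orthogonal projection of `w` to the tangent space `q^⊥` of the unit sphere at `q`. -/
def tangentialPart (q w : Ambient n) : Ambient n := w - ⟪q, w⟫ • q

/-- The projection `T^*(ℝ^{d+1} ∖ 0) → T^*S^d` given by polar coordinates: for `q = ρ u` with
`ρ = ‖q‖`, one has `p · dq = ⟪p, u⟫ dρ + ρ p^⊥ · du`, so that `(q, p)` has the spherical part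
`(u, ρ p^⊥)`. Covectors are identified with vectors through the round metric (the Legendre
transformation). The map is the identity on `TS^d = {‖q‖ = 1, ⟪q, p⟫ = 0}`. -/
def toTangentSphere (z : Ambient n × Ambient n) : Ambient n × Ambient n :=
  (‖z.1‖⁻¹ • z.1, ‖z.1‖ • tangentialPart (‖z.1‖⁻¹ • z.1) z.2)

/-- The canonical Poisson bracket `∑ᵢ (∂F/∂qᵢ ∂G/∂pᵢ - ∂F/∂pᵢ ∂G/∂qᵢ)` on
`T^*ℝ^{d+1} = ℝ^{d+1} × ℝ^{d+1}`. -/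
def canonicalBracket (F G : Ambient n × Ambient n → ℝ) (z : Ambient n × Ambient n) : ℝ :=
  ∑ i, (fderiv ℝ F z (EuclideanSpace.single i 1, 0) * fderiv ℝ G z (0, EuclideanSpace.single i 1)
    - fderiv ℝ F z (0, EuclideanSpace.single i 1) * fderiv ℝ G z (EuclideanSpace.single i 1, 0))

/-- The Poisson bracket on `TS^d`, transported from `T^*S^d` by the Legendre transformation of the
round metric. Only the values of `F` and `G` on `TS^d` matter: they are pulled back by the
projection `T^*(ℝ^{d+1} ∖ 0) = T^*S^d × T^*ℝ_{>0} → T^*S^d`, which is a Poisson map. -/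
def spherePoisson (F G : Ambient n × Ambient n → ℝ) (z : Ambient n × Ambient n) : ℝ :=
  canonicalBracket (F ∘ toTangentSphere) (G ∘ toTangentSphere) z

/-! ### The hemispherical Lagrange problem -/

/-- The first Kepler center `(0, …, 0, a, -1) / √(1 + a²)`. -/
def center₁ (n : ℕ) (a : ℝ) : Ambient n :=
  (√(1 + a ^ 2))⁻¹ • (EuclideanSpace.single (yIdx n) a + southPole n)

/-- The second Kepler center `(0, …, 0, -a, -1) / √(1 + a²)`. -/
def center₂ (n : ℕ) (a : ℝ) : Ambient n := center₁ n (-a)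

/-- The spherical Kepler potential `-m cot θ`, where `θ` is the central angle between `q` and the
center `Z`. -/
def keplerPotential (m : ℝ) (Z q : Ambient n) : ℝ :=
  -m * Real.cot (InnerProductGeometry.angle q Z)

/-- The spherical Hooke potential `f tan² θ`, where `θ` is the central angle between `q` and the
south pole. -/
def hookePotential (f : ℝ) (q : Ambient n) : ℝ :=
  f * Real.tan (InnerProductGeometry.angle q (southPole n)) ^ 2

/-- The potential of the first center, of spherical mass `m₁ √(1 + a²)`. -/
def firstPotential (a m₁ : ℝ) (q : Ambient n) : ℝ :=
  keplerPotential (m₁ * √(1 + a ^ 2)) (center₁ n a) q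

/-- The remaining part of the potential of the Lagrange problem: the second center, of spherical
mass `m₂ √(1 + a²)`, and the Hooke center. -/
def perturbingPotential (a m₂ f : ℝ) (q : Ambient n) : ℝ :=
  keplerPotential (m₂ * √(1 + a ^ 2)) (center₂ n a) q + hookePotential f q

/-- The energy of the spherical Kepler problem of the first center. -/
def keplerEnergy (a m₁ : ℝ) (z : Ambient n × Ambient n) : ℝ :=
  ‖z.2‖ ^ 2 / 2 + firstPotential a m₁ z.1

/-! ### Averaging along the orbits of the spherical Kepler problem -/

/-- `γ : ℝ → S^d` is a non-singular motion of the spherical Kepler problem of the first center,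
`∇_{γ'} γ' = -grad V`, with initial position and velocity `z`. -/
structure IsKeplerMotion (a m₁ : ℝ) (z : Ambient n × Ambient n) (γ : ℝ → Ambient n) : Prop where
  contDiff : ContDiff ℝ 2 γ
  norm_eq_one : ∀ t, ‖γ t‖ = 1
  ne_center : ∀ t, γ t ≠ center₁ n a
  ne_antipode : ∀ t, γ t ≠ -center₁ n a
  newton : ∀ t, tangentialPart (γ t) (deriv (deriv γ) t) =
    -tangentialPart (γ t) (gradient (firstPotential a m₁) (γ t))
  position : γ 0 = z.1
  velocity : deriv γ 0 = z.2

/-- The averaging region in `TS^d`: the Kepler orbit is non-singular, is contained in the lower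
hemisphere, and does not pass through the second center. -/
def averagingRegion (n : ℕ) (a m₁ : ℝ) : Set (Ambient n × Ambient n) :=
  {z | ∃ γ : ℝ → Ambient n, IsKeplerMotion a m₁ z γ ∧
    (∀ t, γ t ∈ lowerHemisphere n) ∧ ∀ t, γ t ≠ center₂ n a}

/-- `γ` is a closed Kepler motion through `z`, with period `T` (not necessarily the least one). -/
def IsClosedKeplerMotion (a m₁ : ℝ) (z : Ambient n × Ambient n) (γ : ℝ → Ambient n) (T : ℝ) :
    Prop :=
  IsKeplerMotion a m₁ z γ ∧ 0 < T ∧ Function.Periodic γ T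

open Classical in
/-- The average `∫_{S¹} U ds` of a function `U` of the position over the closed Kepler orbit
through `z`, parametrized by `S¹ = ℝ/ℤ` proportionally to time (and `0` if there is no such
orbit). The motion through `z` is unique, and the average is the same for all its periods. -/
def orbitAverage (a m₁ : ℝ) (U : Ambient n → ℝ) (z : Ambient n × Ambient n) : ℝ :=
  if h : ∃ p : (ℝ → Ambient n) × ℝ, IsClosedKeplerMotion a m₁ z p.1 p.2 then
    ∫ s in (0 : ℝ)..1, U (h.choose.1 (h.choose.2 * s))
  else 0

/-- The Hamiltonian of the partially-averaged hemispherical Lagrange problem. -/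
def averagedEnergy (a m₁ m₂ f : ℝ) (z : Ambient n × Ambient n) : ℝ :=
  keplerEnergy a m₁ z + orbitAverage a m₁ (perturbingPotential a m₂ f) z

/-! ### The function `D` -/

/-- The central projection `q ↦ (x, y)` with `(x, y, -1) ∈ ℝ q`. -/
def centralProjection (q : Ambient n) : Chart n :=
  WithLp.toLp 2 fun i => -q i.castSucc / q (zIdx n)

/-- The central projection in the affine coordinates `(ξ, η)`, `x = ξ`, `y = √(1 + a²) η + a`, in
which the norm `√(|x|² + y² / (1 + a²))` is the standard one and the first center is the origin. -/
def euclPosition (a : ℝ) (q : Ambient n) : Chart n :=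
  WithLp.toLp 2 fun i =>
    if i = Fin.last n then (centralProjection q i - a) / √(1 + a ^ 2) else centralProjection q i

/-- The velocity `(ξ', η')` that corresponds to the velocity `v` on the sphere at `q`. The projective
correspondence changes time by the factor `1 + |x|² + y²`: the derivative with respect to the
spherical time is `1 + |x|² + y²` times that with respect to the Euclidean time. -/
def euclVelocity (a : ℝ) (q v : Ambient n) : Chart n :=
  (1 + ‖centralProjection q‖ ^ 2)⁻¹ • fderiv ℝ (euclPosition a) q v

/-- The squared norm `∑_{i < j} (Pᵢ Wⱼ - Pⱼ Wᵢ)²` of the total angular momentum. -/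
def angularMomentumSq (P W : Chart n) : ℝ :=
  ∑ i, ∑ j ∈ Finset.Ioi i, (P i * W j - P j * W i) ^ 2

/-- The component along the axis of the centers of the Laplace-Runge-Lenz vector, with the sign for
which it equals `(ξ η' - η ξ') ξ' + m η / √(ξ² + η²)` in dimension two. -/
def laplaceRungeLenz (m : ℝ) (P W : Chart n) : ℝ :=
  ∑ i, (P i * W (Fin.last n) - P (Fin.last n) * W i) * W i + m * P (Fin.last n) / ‖P‖

/-- The function `D = C² - 2 h A₁`, where `h = a / √(1 + a²)` is half the distance between the two
centers in the coordinates `(ξ, η)`, as a function on the tangent bundle of the hemisphere. -/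
def functionD (a m₁ : ℝ) (z : Ambient n × Ambient n) : ℝ :=
  angularMomentumSq (euclPosition a z.1) (euclVelocity a z.1 z.2)
    - 2 * (a / √(1 + a ^ 2))
      * laplaceRungeLenz m₁ (euclPosition a z.1) (euclVelocity a z.1 z.2)

end HemisphericalLagrange

end

/-!
In homogeneous coordinates on `T^*ℝ^{d+1}`, the Kepler orbit through a point of angular momentum `ℓ`
about the axis of the first center spans a cone. The section `X` of this cone at distance one from
the axis is an ellipse, parametrized by the angle `φ` about the axis, and time is recovered from
`dt = dφ / (ℓ ‖X‖²)`. Hence the average of a potential `V` is the quotient of the orbit integrals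
`∮ V dt` and `∮ dt`, which are explicit smooth functions of the initial point.

The function `D` is invariant under the linear symplectic maps `(q, p) ↦ (c⁻¹ q, c p + d q)`, so the
bracket may be computed where `q` is at distance one from the axis and `p` orthogonal to it. There
the Hamiltonian flow of `D` preserves the Kepler energy and carries Kepler orbits to Kepler orbits,
up to a shift of the angle. Because `D + W` is, to first order in the perturbation, a first integral
of the Lagrange problem for a suitable function `W` on the configuration space, `{V, D} = dW/dt`
along Kepler orbits. The derivative of `∮ V dt` along the flow of `D` is therefore the integral of
an exact derivative over a closed orbit, and vanishes; so does that of the period, where `V = 1`.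
-/

open scoped RealInnerProductSpace

noncomputable section

namespace HemisphericalLagrange

/-! ### Cones over Kepler orbits -/

section Cone

variable {H : Type*} [NormedAddCommGroup H] [InnerProductSpace ℝ H]

/-- The inner product of the components of `q` and `p` orthogonal to the unit vector `Z`. -/
def axialInner (Z q p : H) : ℝ := ⟪q, p⟫ - ⟪Z, q⟫ * ⟪Z, p⟫

/-- The distance of `q` to the axis spanned by the unit vector `Z`. -/
def axialRadius (Z q : H) : ℝ := √(axialInner Z q q)

/-- The squared norm of the angular momentum of `(q, p)` about the axis spanned by `Z`. -/
def axialMomentumSq (Z : H) (z : H × H) : ℝ :=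
  axialInner Z z.1 z.1 * axialInner Z z.2 z.2 - axialInner Z z.1 z.2 ^ 2

/-- The norm of the angular momentum of `(q, p)` about the axis spanned by `Z`. -/
def axialMomentum (Z : H) (z : H × H) : ℝ := √(axialMomentumSq Z z)

/-- The multiple of `q` at distance one from the axis. -/
def conePosition (Z : H) (z : H × H) : H := (axialRadius Z z.1)⁻¹ • z.1

/-- The velocity of `conePosition`, divided by its squared norm. -/
def coneVelocity (Z : H) (z : H × H) : H :=
  axialRadius Z z.1 • z.2 - (axialInner Z z.1 z.2 / axialRadius Z z.1) • z.1

/-- The section at distance one from the axis of the cone over the Kepler orbit through `z`, as a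
function of the angle about the axis. -/
def keplerCone (Z : H) (M : ℝ) (z : H × H) (φ : ℝ) : H :=
  (M / axialMomentum Z z ^ 2 * (1 - Real.cos φ)) • Z + Real.cos φ • conePosition Z z
    + (Real.sin φ / axialMomentum Z z) • coneVelocity Z z

/-- The derivative of `keplerCone` with respect to the angle. -/
def keplerConeDeriv (Z : H) (M : ℝ) (z : H × H) (φ : ℝ) : H :=
  (M / axialMomentum Z z ^ 2 * Real.sin φ) • Z - Real.sin φ • conePosition Z z
    + (Real.cos φ / axialMomentum Z z) • coneVelocity Z z

/-- The components of `x` and `e` orthogonal to the unit vector `Z` are orthonormal. Up to positive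
multiples and rescaled velocities, all states of non-zero angular momentum are of the form
`(x, ℓ • e)` with such `x` and `e`. -/
structure IsAxialOrthonormal (Z x e : H) : Prop where
  self_left : axialInner Z x x = 1
  cross : axialInner Z x e = 0
  self_right : axialInner Z e e = 1

lemma axialInner_comm (Z q p : H) : axialInner Z q p = axialInner Z p q := by
  simp only [axialInner, real_inner_comm q p]
  ring

lemma axialInner_add_left (Z q q' p : H) :
    axialInner Z (q + q') p = axialInner Z q p + axialInner Z q' p := by
  simp only [axialInner, inner_add_left, inner_add_right]
  ring

lemma axialInner_sub_left (Z q q' p : H) :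
    axialInner Z (q - q') p = axialInner Z q p - axialInner Z q' p := by
  simp only [axialInner, inner_sub_left, inner_sub_right]
  ring

lemma axialInner_smul_left (Z q p : H) (c : ℝ) :
    axialInner Z (c • q) p = c * axialInner Z q p := by
  simp only [axialInner, real_inner_smul_left, real_inner_smul_right]
  ring

lemma axialInner_add_right (Z q p p' : H) :
    axialInner Z q (p + p') = axialInner Z q p + axialInner Z q p' := by
  simp only [axialInner_comm Z q, axialInner_add_left]

lemma axialInner_sub_right (Z q p p' : H) :
    axialInner Z q (p - p') = axialInner Z q p - axialInner Z q p' := by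
  simp only [axialInner_comm Z q, axialInner_sub_left]

lemma axialInner_smul_right (Z q p : H) (c : ℝ) :
    axialInner Z q (c • p) = c * axialInner Z q p := by
  simp only [axialInner_comm Z q, axialInner_smul_left]

lemma norm_sq_eq_axialInner (Z q : H) : ‖q‖ ^ 2 = axialInner Z q q + ⟪Z, q⟫ ^ 2 := by
  rw [axialInner, real_inner_self_eq_norm_sq]
  ring

lemma axialMomentum_pos {Z : H} {z : H × H} (hz : 0 < axialMomentumSq Z z) :
    0 < axialMomentum Z z :=
  Real.sqrt_pos.2 hz

lemma axialRadius_pos {Z q : H} (hq : 0 < axialInner Z q q) : 0 < axialRadius Z q :=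
  Real.sqrt_pos.2 hq

variable {Z : H}

lemma axialInner_axis_right (hZ : ‖Z‖ = 1) (q : H) : axialInner Z q Z = 0 := by
  simp [axialInner, hZ, real_inner_comm]

lemma axialInner_axis_left (hZ : ‖Z‖ = 1) (q : H) : axialInner Z Z q = 0 := by
  rw [axialInner_comm, axialInner_axis_right hZ]

lemma axialInner_eq_inner (hZ : ‖Z‖ = 1) (q p : H) :
    axialInner Z q p = ⟪q - ⟪Z, q⟫ • Z, p - ⟪Z, p⟫ • Z⟫ := by
  simp only [axialInner, inner_sub_left, inner_sub_right,
    real_inner_smul_right, real_inner_self_eq_norm_sq, hZ, real_inner_comm]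
  ring

lemma axialInner_self_nonneg (hZ : ‖Z‖ = 1) (q : H) : 0 ≤ axialInner Z q q := by
  rw [axialInner_eq_inner hZ]
  exact real_inner_self_nonneg

lemma axialInner_self_pos_of_ne {q : H} (hZ : ‖Z‖ = 1) (hq : ‖q‖ = 1) (hqZ : q ≠ Z)
    (hqZ' : q ≠ -Z) : 0 < axialInner Z q q := by
  have hlt : ⟪Z, q⟫ < 1 := inner_lt_one_iff_real_of_norm_eq_one hZ hq |>.2 hqZ.symm
  have hgt : ⟪Z, -q⟫ < 1 := inner_lt_one_iff_real_of_norm_eq_one hZ (by rwa [norm_neg]) |>.2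
    fun h => hqZ' (by rw [h, neg_neg])
  rw [inner_neg_right] at hgt
  rw [axialInner, real_inner_self_eq_norm_sq, hq]
  nlinarith

lemma axialMomentumSq_nonneg (hZ : ‖Z‖ = 1) (z : H × H) : 0 ≤ axialMomentumSq Z z := by
  have hcs := real_inner_mul_inner_self_le (z.1 - ⟪Z, z.1⟫ • Z) (z.2 - ⟪Z, z.2⟫ • Z)
  simp only [← axialInner_eq_inner hZ] at hcs
  rw [axialMomentumSq]
  linarith

lemma axialInner_self_pos_of_momentum (hZ : ‖Z‖ = 1) {z : H × H} (hz : 0 < axialMomentumSq Z z) :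
    0 < axialInner Z z.1 z.1 := by
  refine (axialInner_self_nonneg hZ z.1).lt_of_ne fun h => ?_
  rw [axialMomentumSq, ← h] at hz
  linarith [sq_nonneg (axialInner Z z.1 z.2)]

lemma axialMomentum_sq (hZ : ‖Z‖ = 1) (z : H × H) :
    axialMomentum Z z ^ 2 = axialMomentumSq Z z :=
  Real.sq_sqrt (axialMomentumSq_nonneg hZ z)

lemma axialRadius_sq (hZ : ‖Z‖ = 1) (q : H) : axialRadius Z q ^ 2 = axialInner Z q q :=
  Real.sq_sqrt (axialInner_self_nonneg hZ q)

lemma axialInner_conePosition_self (hZ : ‖Z‖ = 1) {z : H × H} (hz : 0 < axialInner Z z.1 z.1) :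
    axialInner Z (conePosition Z z) (conePosition Z z) = 1 := by
  have hr := axialRadius_pos hz
  rw [conePosition, axialInner_smul_left, axialInner_smul_right, ← axialRadius_sq hZ]
  field_simp

lemma axialInner_conePosition_coneVelocity (hZ : ‖Z‖ = 1) {z : H × H}
    (hz : 0 < axialInner Z z.1 z.1) :
    axialInner Z (conePosition Z z) (coneVelocity Z z) = 0 := by
  have hr := axialRadius_pos hz
  rw [conePosition, coneVelocity, axialInner_smul_left, axialInner_sub_right,
    axialInner_smul_right, axialInner_smul_right, ← axialRadius_sq hZ]
  field_simp
  ring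

lemma axialInner_coneVelocity_self (hZ : ‖Z‖ = 1) {z : H × H} (hz : 0 < axialInner Z z.1 z.1) :
    axialInner Z (coneVelocity Z z) (coneVelocity Z z) = axialMomentumSq Z z := by
  have hr := axialRadius_pos hz
  simp only [coneVelocity, axialInner_sub_left, axialInner_sub_right, axialInner_smul_left,
    axialInner_smul_right, axialMomentumSq, axialInner_comm Z z.2 z.1]
  rw [← axialRadius_sq hZ z.1]
  field_simp
  ring

lemma isAxialOrthonormal_cone (hZ : ‖Z‖ = 1) {z : H × H} (hz : 0 < axialMomentumSq Z z) :
    IsAxialOrthonormal Z (conePosition Z z) ((axialMomentum Z z)⁻¹ • coneVelocity Z z) where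
  self_left := axialInner_conePosition_self hZ (axialInner_self_pos_of_momentum hZ hz)
  cross := by
    rw [axialInner_smul_right, axialInner_conePosition_coneVelocity hZ
      (axialInner_self_pos_of_momentum hZ hz), mul_zero]
  self_right := by
    have hℓ := axialMomentum_pos hz
    rw [axialInner_smul_left, axialInner_smul_right, axialInner_coneVelocity_self hZ
      (axialInner_self_pos_of_momentum hZ hz), ← axialMomentum_sq hZ]
    field_simp

lemma IsAxialOrthonormal.rotate (hZ : ‖Z‖ = 1) {x e : H} (h : IsAxialOrthonormal Z x e)
    (α β φ : ℝ) :
    IsAxialOrthonormal Z (α • Z + Real.cos φ • x + Real.sin φ • e)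
      (β • Z - Real.sin φ • x + Real.cos φ • e) := by
  have hcs := Real.sin_sq_add_cos_sq φ
  constructor <;>
  simp only [axialInner_add_left, axialInner_add_right, axialInner_sub_left, axialInner_sub_right,
    axialInner_smul_left, axialInner_smul_right, axialInner_axis_left hZ, axialInner_axis_right hZ,
    axialInner_comm Z e x, h.self_left, h.cross, h.self_right]
  · linear_combination hcs
  · ring
  · linear_combination hcs

lemma isAxialOrthonormal_keplerCone (hZ : ‖Z‖ = 1) (M : ℝ) {z : H × H}
    (hz : 0 < axialMomentumSq Z z) (φ : ℝ) :
    IsAxialOrthonormal Z (keplerCone Z M z φ) (keplerConeDeriv Z M z φ) := by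
  simpa only [keplerCone, keplerConeDeriv, smul_smul, ← div_eq_mul_inv] using
    (isAxialOrthonormal_cone hZ hz).rotate hZ (M / axialMomentum Z z ^ 2 * (1 - Real.cos φ))
      (M / axialMomentum Z z ^ 2 * Real.sin φ) φ

lemma norm_keplerCone_sq (hZ : ‖Z‖ = 1) (M : ℝ) {z : H × H}
    (hz : 0 < axialMomentumSq Z z) (φ : ℝ) :
    ‖keplerCone Z M z φ‖ ^ 2 = 1 + ⟪Z, keplerCone Z M z φ⟫ ^ 2 := by
  rw [norm_sq_eq_axialInner Z, (isAxialOrthonormal_keplerCone hZ M hz φ).self_left]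

lemma norm_keplerCone_pos (hZ : ‖Z‖ = 1) (M : ℝ) {z : H × H}
    (hz : 0 < axialMomentumSq Z z) (φ : ℝ) : 0 < ‖keplerCone Z M z φ‖ := by
  refine (norm_nonneg _).lt_of_ne' fun h => ?_
  have hsq := norm_keplerCone_sq hZ M hz φ
  rw [h] at hsq
  linarith [sq_nonneg ⟪Z, keplerCone Z M z φ⟫]

lemma hasDerivAt_keplerCone (Z : H) (M : ℝ) (z : H × H) (φ : ℝ) :
    HasDerivAt (keplerCone Z M z) (keplerConeDeriv Z M z φ) φ := by
  refine (((((Real.hasDerivAt_cos φ).const_sub 1).const_mul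
    (M / axialMomentum Z z ^ 2)).smul_const Z).add
    ((Real.hasDerivAt_cos φ).smul_const (conePosition Z z))).add
    (((Real.hasDerivAt_sin φ).div_const (axialMomentum Z z)).smul_const
      (coneVelocity Z z)) |>.congr_deriv ?_
  rw [keplerConeDeriv]
  module

lemma hasDerivAt_keplerConeDeriv (Z : H) (M : ℝ) (z : H × H) (φ : ℝ) :
    HasDerivAt (keplerConeDeriv Z M z)
      ((M / axialMomentum Z z ^ 2) • Z - keplerCone Z M z φ) φ := by
  refine ((((Real.hasDerivAt_sin φ).const_mul (M / axialMomentum Z z ^ 2)).smul_const Z).sub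
    ((Real.hasDerivAt_sin φ).smul_const (conePosition Z z))).add
    (((Real.hasDerivAt_cos φ).div_const (axialMomentum Z z)).smul_const
      (coneVelocity Z z)) |>.congr_deriv ?_
  rw [keplerCone]
  module

lemma keplerCone_add_two_pi (Z : H) (M : ℝ) (z : H × H) (φ : ℝ) :
    keplerCone Z M z (φ + 2 * Real.pi) = keplerCone Z M z φ := by
  simp only [keplerCone, Real.cos_add_two_pi, Real.sin_add_two_pi]

lemma keplerConeDeriv_add_two_pi (Z : H) (M : ℝ) (z : H × H) (φ : ℝ) :
    keplerConeDeriv Z M z (φ + 2 * Real.pi) = keplerConeDeriv Z M z φ := by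
  simp only [keplerConeDeriv, Real.cos_add_two_pi, Real.sin_add_two_pi]

lemma keplerCone_zero (Z : H) (M : ℝ) (z : H × H) :
    keplerCone Z M z 0 = conePosition Z z := by
  simp [keplerCone]

lemma contDiff_keplerCone {m : WithTop ℕ∞} (Z : H) (M : ℝ) (z : H × H) :
    ContDiff ℝ m (keplerCone Z M z) := by
  unfold keplerCone
  fun_prop

end Cone

/-! ### Motions in a central field -/

lemma surjective_of_le_hasDerivAt {f f' : ℝ → ℝ} {c : ℝ} (hc : 0 < c)
    (hf : ∀ x, HasDerivAt f (f' x) x) (h : ∀ x, c ≤ f' x) : Function.Surjective f := by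
  have hmono : Monotone fun x => f x - c * x :=
    monotone_of_hasDerivAt_nonneg (fun x => (hf x).sub ((hasDerivAt_id x).const_mul c))
      fun x => by simpa using h x
  have hcont : Continuous f := continuous_iff_continuousAt.2 fun x => (hf x).continuousAt
  refine hcont.surjective ?_ ?_
  · refine Filter.tendsto_atTop_mono' Filter.atTop (f₁ := fun x => c * x + f 0) ?_
      (Filter.tendsto_atTop_add_const_right _ _ (Filter.tendsto_id.const_mul_atTop hc))
    filter_upwards [Filter.eventually_ge_atTop 0] with x hx
    linarith [hmono hx]
  · refine Filter.tendsto_atBot_mono' Filter.atBot (f₁ := fun x => c * x + f 0) ?_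
      (Filter.tendsto_atBot_add_const_right _ _ (Filter.tendsto_id.const_mul_atBot hc))
    filter_upwards [Filter.eventually_le_atBot 0] with x hx
    linarith [hmono hx]

lemma exists_lt_of_le_hasDerivAt_hasDerivAt {f f' f'' : ℝ → ℝ} {c : ℝ} (hc : 0 < c)
    (hf : ∀ t, HasDerivAt f (f' t) t) (hf' : ∀ t, HasDerivAt f' (f'' t) t)
    (h : ∀ t, c ≤ f'' t) (B : ℝ) : ∃ t, B < f t := by
  obtain ⟨t₀, ht₀⟩ := surjective_of_le_hasDerivAt hc hf' h 1
  have hmono' : Monotone f' :=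
    monotone_of_hasDerivAt_nonneg hf' fun t => hc.le.trans (h t)
  have hd : ∀ t, HasDerivAt (fun t => f t - t) (f' t - 1) t :=
    fun t => (hf t).sub (hasDerivAt_id t)
  have hmono : MonotoneOn (fun t => f t - t) (Set.Ici t₀) := by
    refine monotoneOn_of_hasDerivWithinAt_nonneg (convex_Ici t₀)
      (fun t _ => (hd t).continuousAt.continuousWithinAt) (fun t _ => (hd t).hasDerivWithinAt)
      fun t ht => ?_
    rw [interior_Ici] at ht
    linarith [hmono' (le_of_lt ht)]
  have hle : t₀ ≤ t₀ + (|B - f t₀| + 1) := by linarith [abs_nonneg (B - f t₀)]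
  refine ⟨t₀ + (|B - f t₀| + 1), ?_⟩
  linarith [hmono Set.self_mem_Ici (Set.mem_Ici.2 hle) hle, le_abs_self (B - f t₀)]

section CentralMotion

variable {H : Type*} [NormedAddCommGroup H] [InnerProductSpace ℝ H] {Z : H}

lemma hasDerivAt_axialInner {f g : ℝ → H} {f' g' : H} {t : ℝ} (Z : H) (hf : HasDerivAt f f' t)
    (hg : HasDerivAt g g' t) :
    HasDerivAt (fun t => axialInner Z (f t) (g t))
      (axialInner Z f' (g t) + axialInner Z (f t) g') t := by
  have hZ := hasDerivAt_const t Z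
  refine ((hf.inner ℝ hg).sub ((hZ.inner ℝ hf).mul (hZ.inner ℝ hg))).congr_deriv ?_
  simp only [axialInner, inner_zero_left]
  ring

lemma hasDerivAt_axialRadius {f : ℝ → H} {f' : H} {t : ℝ} (Z : H) (hf : HasDerivAt f f' t)
    (hr : 0 < axialInner Z (f t) (f t)) :
    HasDerivAt (fun t => axialRadius Z (f t))
      (axialInner Z (f t) f' / axialRadius Z (f t)) t := by
  refine ((hasDerivAt_axialInner Z hf hf).sqrt hr.ne').congr_deriv ?_
  rw [axialInner_comm Z f', axialRadius]
  ring

lemma eq_cos_smul_add_sin_smul (φ : ℝ) (b c : H) :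
    b = Real.cos φ • (Real.cos φ • b - Real.sin φ • c)
      + Real.sin φ • (Real.sin φ • b + Real.cos φ • c) := by
  have hcs := Real.sin_sq_add_cos_sq φ
  match_scalars
  · linear_combination -hcs
  · ring

/-- `φ` is the angle about the axis, as a function of time, along the Kepler motion through `z`. -/
structure IsOrbitAngle (Z : H) (M : ℝ) (z : H × H) (φ : ℝ → ℝ) : Prop where
  map_zero : φ 0 = 0
  hasDerivAt : ∀ t, HasDerivAt φ (axialMomentum Z z * ‖keplerCone Z M z (φ t)‖ ^ 2) t

/-- The motion on the unit sphere whose cone is the Kepler cone, run through with the angle `φ`. -/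
def coneMotion (Z : H) (M : ℝ) (z : H × H) (φ : ℝ → ℝ) (t : ℝ) : H :=
  ‖keplerCone Z M z (φ t)‖⁻¹ • keplerCone Z M z (φ t)

/-- `γ` is a motion on the unit sphere, of velocity `v`, which avoids the axis of the unit vector
`Z` and has potential `-M cot θ`, where `θ` is the angle to `Z`. The tangential part of Newton's
equation is expressed by an arbitrary multiplier `k`. -/
structure IsCentralMotion (Z : H) (M : ℝ) (γ v : ℝ → H) : Prop where
  norm_eq_one : ∀ t, ‖γ t‖ = 1
  axialInner_pos : ∀ t, 0 < axialInner Z (γ t) (γ t)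
  hasDerivAt : ∀ t, HasDerivAt γ (v t) t
  newton : ∀ t, ∃ k : ℝ, HasDerivAt v (k • γ t + (M / axialRadius Z (γ t) ^ 3) • Z) t

namespace IsCentralMotion

variable {M : ℝ} {γ v : ℝ → H}

lemma inner_eq_zero (h : IsCentralMotion Z M γ v) (t : ℝ) : ⟪γ t, v t⟫ = 0 := by
  have hd := (h.hasDerivAt t).inner ℝ (h.hasDerivAt t)
  simp only [real_inner_self_eq_norm_sq, h.norm_eq_one] at hd
  linarith [hd.unique (hasDerivAt_const t _), real_inner_comm (γ t) (v t)]

lemma axialMomentumSq_eq (hZ : ‖Z‖ = 1) (h : IsCentralMotion Z M γ v) (t : ℝ) :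
    axialMomentumSq Z (γ t, v t) = axialMomentumSq Z (γ 0, v 0) := by
  have hd : ∀ t, HasDerivAt (fun t => axialMomentumSq Z (γ t, v t)) 0 t := fun t => by
    obtain ⟨k, hv⟩ := h.newton t
    refine (((hasDerivAt_axialInner Z (h.hasDerivAt t) (h.hasDerivAt t)).mul
      (hasDerivAt_axialInner Z hv hv)).sub
      ((hasDerivAt_axialInner Z (h.hasDerivAt t) hv).pow 2)).congr_deriv ?_
    simp only [axialInner_add_left, axialInner_add_right, axialInner_smul_left,
      axialInner_smul_right, axialInner_axis_left hZ, axialInner_axis_right hZ,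
      axialInner_comm Z (v t) (γ t)]
    ring
  exact is_const_of_deriv_eq_zero (fun t => (hd t).differentiableAt) (fun t => (hd t).deriv) t 0

lemma norm_conePosition (h : IsCentralMotion Z M γ v) (t : ℝ) :
    ‖conePosition Z (γ t, v t)‖ = (axialRadius Z (γ t))⁻¹ := by
  rw [conePosition, norm_smul, h.norm_eq_one, norm_inv, Real.norm_eq_abs,
    abs_of_pos (axialRadius_pos (h.axialInner_pos t)), mul_one]

lemma norm_conePosition_sq (hZ : ‖Z‖ = 1) (h : IsCentralMotion Z M γ v) (t : ℝ) :
    ‖conePosition Z (γ t, v t)‖ ^ 2 = 1 + ⟪Z, conePosition Z (γ t, v t)⟫ ^ 2 := by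
  rw [norm_sq_eq_axialInner Z, axialInner_conePosition_self hZ (h.axialInner_pos t)]

lemma hasDerivAt_conePosition (h : IsCentralMotion Z M γ v) (t : ℝ) :
    HasDerivAt (fun t => conePosition Z (γ t, v t))
      (‖conePosition Z (γ t, v t)‖ ^ 2 • coneVelocity Z (γ t, v t)) t := by
  have hr := axialRadius_pos (h.axialInner_pos t)
  refine (((hasDerivAt_axialRadius Z (h.hasDerivAt t) (h.axialInner_pos t)).inv hr.ne').smul
    (h.hasDerivAt t)).congr_deriv ?_
  simp only [h.norm_conePosition, coneVelocity, Pi.inv_apply]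
  match_scalars <;> field_simp

lemma hasDerivAt_coneVelocity (hZ : ‖Z‖ = 1) (h : IsCentralMotion Z M γ v) (t : ℝ) :
    HasDerivAt (fun t => coneVelocity Z (γ t, v t))
      (‖conePosition Z (γ t, v t)‖ ^ 2 •
        (M • Z - axialMomentumSq Z (γ 0, v 0) • conePosition Z (γ t, v t))) t := by
  obtain ⟨k, hv⟩ := h.newton t
  have hr := axialRadius_pos (h.axialInner_pos t)
  have hr' := hasDerivAt_axialRadius Z (h.hasDerivAt t) (h.axialInner_pos t)
  refine ((hr'.smul hv).sub (((hasDerivAt_axialInner Z (h.hasDerivAt t) hv).div hr' hr.ne').smul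
    (h.hasDerivAt t))).congr_deriv ?_
  rw [h.norm_conePosition, ← h.axialMomentumSq_eq hZ t]
  simp only [conePosition, axialMomentumSq, axialInner_add_right, Pi.div_apply,
    axialInner_smul_right, axialInner_axis_right hZ, ← axialRadius_sq hZ (γ t)]
  match_scalars <;> field_simp <;> ring

/-- If the angular momentum vanished, then `arctan (cot θ) < π / 2` would have second derivative at
least `M`: the motion would fall into the center. -/
lemma axialMomentumSq_pos (hZ : ‖Z‖ = 1) (hM : 0 < M) (h : IsCentralMotion Z M γ v) :
    0 < axialMomentumSq Z (γ 0, v 0) := by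
  refine (axialMomentumSq_nonneg hZ _).lt_of_ne fun hzero => ?_
  set w : ℝ → ℝ := fun t => ⟪Z, conePosition Z (γ t, v t)⟫
  set w' : ℝ → ℝ := fun t => ⟪Z, coneVelocity Z (γ t, v t)⟫
  have harctan : ∀ t, HasDerivAt (fun t => Real.arctan (w t)) (w' t) t := fun t => by
    refine ((hasDerivAt_const t Z).inner ℝ (h.hasDerivAt_conePosition t)).arctan.congr_deriv ?_
    have hpos : 1 + w t ^ 2 ≠ 0 := by positivity
    rw [inner_zero_left, add_zero, real_inner_smul_right, h.norm_conePosition_sq hZ,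
      one_div, inv_mul_cancel_left₀ hpos]
  have hw' : ∀ t, HasDerivAt w' ((1 + w t ^ 2) * M) t := fun t => by
    refine ((hasDerivAt_const t Z).inner ℝ (h.hasDerivAt_coneVelocity hZ t)).congr_deriv ?_
    rw [inner_zero_left, add_zero, real_inner_smul_right, h.norm_conePosition_sq hZ, ← hzero,
      zero_smul, sub_zero, real_inner_smul_right, real_inner_self_eq_norm_sq, hZ, one_pow, mul_one]
  have hle : ∀ t, M ≤ (1 + w t ^ 2) * M := fun t =>
    le_mul_of_one_le_left hM.le (by linarith [sq_nonneg (w t)])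
  obtain ⟨t, ht⟩ := exists_lt_of_le_hasDerivAt_hasDerivAt hM harctan hw' hle (Real.pi / 2)
  exact ht.not_gt (Real.arctan_lt_pi_div_two _)

lemma exists_hasDerivAt_angle (h : IsCentralMotion Z M γ v) :
    ∃ φ : ℝ → ℝ, φ 0 = 0 ∧ ∀ t, HasDerivAt φ
      (axialMomentum Z (γ 0, v 0) * ‖conePosition Z (γ t, v t)‖ ^ 2) t := by
  have hcont : Continuous fun t =>
      axialMomentum Z (γ 0, v 0) * ‖conePosition Z (γ t, v t)‖ ^ 2 :=
    continuous_const.mul ((continuous_iff_continuousAt.2 fun t =>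
      (h.hasDerivAt_conePosition t).continuousAt).norm.pow 2)
  refine ⟨fun t => ∫ x in (0 : ℝ)..t,
    axialMomentum Z (γ 0, v 0) * ‖conePosition Z (γ x, v x)‖ ^ 2, by simp, fun t => ?_⟩
  exact intervalIntegral.integral_hasDerivAt_right (hcont.intervalIntegrable _ _)
    (hcont.stronglyMeasurableAtFilter _ _) hcont.continuousAt

/-- In a frame rotating with the angle `φ`, the cone motion is at rest. -/
lemma conePosition_eq_keplerCone (hZ : ‖Z‖ = 1) (h : IsCentralMotion Z M γ v)
    (hℓ : 0 < axialMomentumSq Z (γ 0, v 0)) {φ : ℝ → ℝ} (hφ₀ : φ 0 = 0)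
    (hφ : ∀ t, HasDerivAt φ
      (axialMomentum Z (γ 0, v 0) * ‖conePosition Z (γ t, v t)‖ ^ 2) t) (t : ℝ) :
    conePosition Z (γ t, v t) = keplerCone Z M (γ 0, v 0) (φ t) := by
  have hℓsq := axialMomentum_sq hZ (γ 0, v 0)
  have hℓpos := axialMomentum_pos hℓ
  set ℓ := axialMomentum Z (γ 0, v 0) with hℓdef
  set X : ℝ → H := fun t => conePosition Z (γ t, v t) - (M / ℓ ^ 2) • Z
  set Θ : ℝ → H := fun t => ℓ⁻¹ • coneVelocity Z (γ t, v t)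
  have hX : ∀ t, HasDerivAt X (‖conePosition Z (γ t, v t)‖ ^ 2 • ℓ • Θ t) t := fun t => by
    refine ((h.hasDerivAt_conePosition t).sub_const _).congr_deriv ?_
    rw [smul_inv_smul₀ hℓpos.ne']
  have hΘ : ∀ t, HasDerivAt Θ (-(‖conePosition Z (γ t, v t)‖ ^ 2 • ℓ • X t)) t := fun t => by
    refine ((h.hasDerivAt_coneVelocity hZ t).const_smul ℓ⁻¹).congr_deriv ?_
    simp only [X, ← hℓsq]
    match_scalars <;> field_simp
  have hA : ∀ t, HasDerivAt (fun t => Real.cos (φ t) • X t - Real.sin (φ t) • Θ t) 0 t :=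
    fun t => (((hφ t).cos.smul (hX t)).sub ((hφ t).sin.smul (hΘ t))).congr_deriv (by module)
  have hB : ∀ t, HasDerivAt (fun t => Real.sin (φ t) • X t + Real.cos (φ t) • Θ t) 0 t :=
    fun t => (((hφ t).sin.smul (hX t)).add ((hφ t).cos.smul (hΘ t))).congr_deriv (by module)
  have hA₀ : Real.cos (φ t) • X t - Real.sin (φ t) • Θ t = X 0 := by
    simpa [hφ₀] using is_const_of_deriv_eq_zero (fun t => (hA t).differentiableAt)
      (fun t => (hA t).deriv) t 0
  have hB₀ : Real.sin (φ t) • X t + Real.cos (φ t) • Θ t = Θ 0 := by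
    simpa [hφ₀] using is_const_of_deriv_eq_zero (fun t => (hB t).differentiableAt)
      (fun t => (hB t).deriv) t 0
  have hrot := eq_cos_smul_add_sin_smul (φ t) (X t) (Θ t)
  rw [hA₀, hB₀, sub_eq_iff_eq_add] at hrot
  rw [hrot, keplerCone, ← hℓdef]
  simp only [X, Θ]
  module

lemma exists_isOrbitAngle (hZ : ‖Z‖ = 1) (hM : 0 < M) (h : IsCentralMotion Z M γ v) :
    ∃ φ, IsOrbitAngle Z M (γ 0, v 0) φ ∧ γ = coneMotion Z M (γ 0, v 0) φ := by
  obtain ⟨φ, hφ₀, hφ⟩ := h.exists_hasDerivAt_angle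
  have hcone := h.conePosition_eq_keplerCone hZ (h.axialMomentumSq_pos hZ hM) hφ₀ hφ
  refine ⟨φ, ⟨hφ₀, fun t => hcone t ▸ hφ t⟩, funext fun t => ?_⟩
  rw [coneMotion, ← hcone, h.norm_conePosition, inv_inv, conePosition,
    smul_inv_smul₀ (axialRadius_pos (h.axialInner_pos t)).ne']

end IsCentralMotion

end CentralMotion

/-! ### Time and angle along a Kepler orbit -/

lemma contDiff_of_hasDerivAt_comp {φ g : ℝ → ℝ} (hφ : ∀ t, HasDerivAt φ (g (φ t)) t) :
    ∀ m : ℕ, ContDiff ℝ m g → ContDiff ℝ (m + 1) φ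
  | 0, hg => by
    have hcont : Continuous φ := continuous_iff_continuousAt.2 fun t => (hφ t).continuousAt
    rw [Nat.cast_zero, zero_add, contDiff_one_iff_deriv, deriv_eq hφ]
    exact ⟨fun t => (hφ t).differentiableAt, hg.continuous.comp hcont⟩
  | m + 1, hg => by
    rw [contDiff_succ_iff_deriv, deriv_eq hφ]
    have hm : ContDiff ℝ (m + 1) φ :=
      contDiff_of_hasDerivAt_comp hφ m (hg.of_le (by exact_mod_cast Nat.le_succ m))
    exact ⟨fun t => (hφ t).differentiableAt, fun h => absurd h (by simp), hg.comp hm⟩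

section Period

variable {H : Type*} [NormedAddCommGroup H] [InnerProductSpace ℝ H] {Z : H} {M : ℝ} {z : H × H}

/-- The density of time with respect to the angle about the axis along a Kepler orbit. -/
def timeDensity (Z : H) (M : ℝ) (z : H × H) (φ : ℝ) : ℝ :=
  (axialMomentum Z z * ‖keplerCone Z M z φ‖ ^ 2)⁻¹

/-- The time at which the Kepler motion reaches a given angle about the axis. -/
def timeOfAngle (Z : H) (M : ℝ) (z : H × H) (φ : ℝ) : ℝ :=
  ∫ x in (0 : ℝ)..φ, timeDensity Z M z x

/-- The time integral of a function on the cone over one turn of the Kepler orbit through `z`. -/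
def orbitIntegral (Z : H) (M : ℝ) (U : H → ℝ) (z : H × H) : ℝ :=
  ∫ φ in (0 : ℝ)..2 * Real.pi, U (keplerCone Z M z φ) * timeDensity Z M z φ

lemma timeDensity_pos (hZ : ‖Z‖ = 1) (hz : 0 < axialMomentumSq Z z) (φ : ℝ) :
    0 < timeDensity Z M z φ :=
  inv_pos.2 (mul_pos (axialMomentum_pos hz) (pow_pos (norm_keplerCone_pos hZ M hz φ) 2))

lemma continuous_timeDensity (hZ : ‖Z‖ = 1) (hz : 0 < axialMomentumSq Z z) :
    Continuous (timeDensity Z M z) :=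
  (continuous_const.mul ((contDiff_keplerCone (m := 0) Z M z).continuous.norm.pow 2)).inv₀
    fun φ => (inv_pos.1 (timeDensity_pos hZ hz φ)).ne'

lemma periodic_timeDensity (Z : H) (M : ℝ) (z : H × H) :
    Function.Periodic (timeDensity Z M z) (2 * Real.pi) := fun φ => by
  simp only [timeDensity, keplerCone_add_two_pi]

lemma timeOfAngle_zero (Z : H) (M : ℝ) (z : H × H) : timeOfAngle Z M z 0 = 0 :=
  intervalIntegral.integral_same

lemma timeOfAngle_two_pi_pos (hZ : ‖Z‖ = 1) (hz : 0 < axialMomentumSq Z z) :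
    0 < timeOfAngle Z M z (2 * Real.pi) :=
  intervalIntegral.intervalIntegral_pos_of_pos
    ((continuous_timeDensity hZ hz).intervalIntegrable _ _) (timeDensity_pos hZ hz) Real.two_pi_pos

lemma hasDerivAt_timeOfAngle (hZ : ‖Z‖ = 1) (hz : 0 < axialMomentumSq Z z) (φ : ℝ) :
    HasDerivAt (timeOfAngle Z M z) (timeDensity Z M z φ) φ :=
  have hcont : Continuous (timeDensity Z M z) := continuous_timeDensity hZ hz
  intervalIntegral.integral_hasDerivAt_right (hcont.intervalIntegrable _ _)
    (hcont.stronglyMeasurableAtFilter _ _) hcont.continuousAt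

lemma timeOfAngle_add_two_pi (hZ : ‖Z‖ = 1) (hz : 0 < axialMomentumSq Z z) (φ : ℝ) :
    timeOfAngle Z M z (φ + 2 * Real.pi)
      = timeOfAngle Z M z φ + timeOfAngle Z M z (2 * Real.pi) := by
  have hint := (continuous_timeDensity (M := M) hZ hz).intervalIntegrable
    (μ := MeasureTheory.volume)
  have hturn := (periodic_timeDensity Z M z).intervalIntegral_add_eq φ 0
  rw [zero_add] at hturn
  rw [timeOfAngle, timeOfAngle, timeOfAngle, ← hturn,
    intervalIntegral.integral_add_adjacent_intervals (hint _ _) (hint _ _)]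

lemma surjective_timeOfAngle (hZ : ‖Z‖ = 1) (hz : 0 < axialMomentumSq Z z) :
    Function.Surjective (timeOfAngle Z M z) := by
  obtain ⟨-, ⟨φ₀, rfl⟩, hmin⟩ := ((periodic_timeDensity Z M z).compact_of_continuous
    Real.two_pi_pos.ne' (continuous_timeDensity hZ hz)).exists_isLeast (Set.range_nonempty _)
  exact surjective_of_le_hasDerivAt (timeDensity_pos hZ hz φ₀) (hasDerivAt_timeOfAngle hZ hz)
    fun φ => hmin (Set.mem_range_self φ)

lemma exists_isOrbitAngle (hZ : ‖Z‖ = 1) (hz : 0 < axialMomentumSq Z z) :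
    ∃ φ : ℝ → ℝ, IsOrbitAngle Z M z φ ∧
      ∀ t, φ (t + timeOfAngle Z M z (2 * Real.pi)) = φ t + 2 * Real.pi := by
  have hmono : StrictMono (timeOfAngle Z M z) :=
    strictMono_of_hasDerivAt_pos (hasDerivAt_timeOfAngle hZ hz) (timeDensity_pos hZ hz)
  set e := (hmono.orderIsoOfSurjective _ (surjective_timeOfAngle hZ hz)).toHomeomorph
  have he : ∀ φ, e φ = timeOfAngle Z M z φ := fun φ => rfl
  have hinv : ∀ t, timeOfAngle Z M z (e.symm t) = t := e.apply_symm_apply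
  refine ⟨e.symm, ⟨?_, fun t => ?_⟩, fun t => ?_⟩
  · rw [e.symm_apply_eq, he, timeOfAngle_zero]
  · simpa only [timeDensity, inv_inv] using HasDerivAt.of_local_left_inverse
      e.symm.continuous.continuousAt (hasDerivAt_timeOfAngle hZ hz _)
      (timeDensity_pos hZ hz _).ne' (Filter.Eventually.of_forall hinv)
  · rw [e.symm_apply_eq, he, timeOfAngle_add_two_pi hZ hz, hinv]

lemma axialRadius_smul_of_pos {c : ℝ} (hc : 0 < c) (q : H) :
    axialRadius Z (c • q) = c * axialRadius Z q := by
  rw [axialRadius, axialRadius, axialInner_smul_left, axialInner_smul_right, ← mul_assoc, ← sq,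
    Real.sqrt_mul (sq_nonneg c), Real.sqrt_sq hc.le]

lemma axialRadius_keplerCone (hZ : ‖Z‖ = 1) (hz : 0 < axialMomentumSq Z z) (φ : ℝ) :
    axialRadius Z (keplerCone Z M z φ) = 1 := by
  rw [axialRadius, (isAxialOrthonormal_keplerCone hZ M hz φ).self_left, Real.sqrt_one]

lemma axialInner_conePosition_keplerCone (hZ : ‖Z‖ = 1) (hz : 0 < axialMomentumSq Z z) (φ : ℝ) :
    axialInner Z (conePosition Z z) (keplerCone Z M z φ) = Real.cos φ := by
  have hq := axialInner_self_pos_of_momentum hZ hz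
  rw [keplerCone, axialInner_add_right, axialInner_add_right, axialInner_smul_right,
    axialInner_smul_right, axialInner_smul_right, axialInner_axis_right hZ,
    axialInner_conePosition_self hZ hq, axialInner_conePosition_coneVelocity hZ hq]
  ring

namespace IsOrbitAngle

variable {φ : ℝ → ℝ}

lemma continuous (h : IsOrbitAngle Z M z φ) : Continuous φ :=
  continuous_iff_continuousAt.2 fun t => (h.hasDerivAt t).continuousAt

lemma contDiff (h : IsOrbitAngle Z M z φ) : ContDiff ℝ 2 φ := by
  have hg : ContDiff ℝ (1 : ℕ) fun φ => axialMomentum Z z * ‖keplerCone Z M z φ‖ ^ 2 :=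
    contDiff_const.mul ((contDiff_keplerCone Z M z).norm_sq ℝ)
  simpa only [Nat.cast_one, one_add_one_eq_two] using
    contDiff_of_hasDerivAt_comp (g := fun φ => axialMomentum Z z * ‖keplerCone Z M z φ‖ ^ 2)
      h.hasDerivAt 1 hg

lemma contDiff_coneMotion (hZ : ‖Z‖ = 1) (hz : 0 < axialMomentumSq Z z)
    (h : IsOrbitAngle Z M z φ) : ContDiff ℝ 2 (coneMotion Z M z φ) := by
  have hX : ContDiff ℝ 2 fun t => keplerCone Z M z (φ t) :=
    (contDiff_keplerCone Z M z).comp h.contDiff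
  have hpos := fun t => norm_keplerCone_pos hZ M hz (φ t)
  exact ((hX.norm ℝ fun t => norm_pos_iff.1 (hpos t)).inv fun t => (hpos t).ne').smul hX

lemma hasDerivAt_keplerCone (h : IsOrbitAngle Z M z φ) (t : ℝ) :
    HasDerivAt (fun t => keplerCone Z M z (φ t)) (‖keplerCone Z M z (φ t)‖ ^ 2 •
      axialMomentum Z z • keplerConeDeriv Z M z (φ t)) t := by
  refine ((HemisphericalLagrange.hasDerivAt_keplerCone Z M z (φ t)).scomp t
    (h.hasDerivAt t)).congr_deriv ?_
  module

lemma hasDerivAt_keplerConeDeriv (hz : 0 < axialMomentumSq Z z) (h : IsOrbitAngle Z M z φ)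
    (t : ℝ) :
    HasDerivAt (fun t => axialMomentum Z z • keplerConeDeriv Z M z (φ t))
      (‖keplerCone Z M z (φ t)‖ ^ 2 •
        (M • Z - axialMomentum Z z ^ 2 • keplerCone Z M z (φ t))) t := by
  have hℓ := axialMomentum_pos hz
  refine (((HemisphericalLagrange.hasDerivAt_keplerConeDeriv Z M z (φ t)).scomp t
    (h.hasDerivAt t)).const_smul (axialMomentum Z z)).congr_deriv ?_
  match_scalars <;> field_simp

lemma hasDerivAt_norm_keplerCone (hZ : ‖Z‖ = 1) (hz : 0 < axialMomentumSq Z z)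
    (h : IsOrbitAngle Z M z φ) (t : ℝ) :
    HasDerivAt (fun t => ‖keplerCone Z M z (φ t)‖) (‖keplerCone Z M z (φ t)‖ *
      ⟪keplerCone Z M z (φ t), axialMomentum Z z • keplerConeDeriv Z M z (φ t)⟫) t := by
  have hpos := norm_keplerCone_pos hZ M hz (φ t)
  have hsq := (h.hasDerivAt_keplerCone t).norm_sq.sqrt (pow_pos hpos 2).ne'
  simp only [Real.sqrt_sq (norm_nonneg _)] at hsq
  refine hsq.congr_deriv ?_
  rw [real_inner_smul_right]
  field_simp

end IsOrbitAngle

/-- The velocity of `coneMotion`. -/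
def coneMotionVelocity (Z : H) (M : ℝ) (z : H × H) (φ : ℝ → ℝ) (t : ℝ) : H :=
  ‖keplerCone Z M z (φ t)‖ • axialMomentum Z z • keplerConeDeriv Z M z (φ t)
    - (⟪keplerCone Z M z (φ t), axialMomentum Z z • keplerConeDeriv Z M z (φ t)⟫
      / ‖keplerCone Z M z (φ t)‖) • keplerCone Z M z (φ t)

namespace IsOrbitAngle

variable {φ : ℝ → ℝ}

lemma hasDerivAt_coneMotion (hZ : ‖Z‖ = 1) (hz : 0 < axialMomentumSq Z z)
    (h : IsOrbitAngle Z M z φ) (t : ℝ) :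
    HasDerivAt (coneMotion Z M z φ) (coneMotionVelocity Z M z φ t) t := by
  have hpos := norm_keplerCone_pos hZ M hz (φ t)
  refine (((h.hasDerivAt_norm_keplerCone hZ hz t).inv hpos.ne').smul
    (h.hasDerivAt_keplerCone t)).congr_deriv ?_
  simp only [coneMotionVelocity, Pi.inv_apply]
  match_scalars <;> field_simp

lemma exists_hasDerivAt_coneMotionVelocity (hZ : ‖Z‖ = 1) (hz : 0 < axialMomentumSq Z z)
    (h : IsOrbitAngle Z M z φ) (t : ℝ) :
    ∃ k : ℝ, HasDerivAt (coneMotionVelocity Z M z φ)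
      (k • coneMotion Z M z φ t + (M * ‖keplerCone Z M z (φ t)‖ ^ 3) • Z) t := by
  have hpos := norm_keplerCone_pos hZ M hz (φ t)
  have hX := h.hasDerivAt_keplerCone t
  have hΘ := h.hasDerivAt_keplerConeDeriv hz t
  have hnorm := h.hasDerivAt_norm_keplerCone hZ hz t
  set g : ℝ → ℝ := fun t =>
    ⟪keplerCone Z M z (φ t), axialMomentum Z z • keplerConeDeriv Z M z (φ t)⟫
      / ‖keplerCone Z M z (φ t)‖ with hg
  have hquot : HasDerivAt g (deriv g t) t :=
    ((hX.inner ℝ hΘ).div hnorm hpos.ne').differentiableAt.hasDerivAt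
  refine ⟨-‖keplerCone Z M z (φ t)‖ *
    (‖keplerCone Z M z (φ t)‖ ^ 3 * axialMomentum Z z ^ 2 + deriv g t),
    ((hnorm.smul hΘ).sub (hquot.smul hX)).congr_deriv ?_⟩
  rw [coneMotion]
  simp only [hg]
  match_scalars <;> field_simp <;> ring

lemma isCentralMotion (hZ : ‖Z‖ = 1) (hz : 0 < axialMomentumSq Z z) (h : IsOrbitAngle Z M z φ) :
    IsCentralMotion Z M (coneMotion Z M z φ) (coneMotionVelocity Z M z φ) := by
  have hpos := fun t => norm_keplerCone_pos hZ M hz (φ t)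
  have hrad : ∀ t, axialRadius Z (coneMotion Z M z φ t) = ‖keplerCone Z M z (φ t)‖⁻¹ := fun t => by
    rw [coneMotion, axialRadius_smul_of_pos (inv_pos.2 (hpos t)), axialRadius_keplerCone hZ hz,
      mul_one]
  refine ⟨fun t => ?_, fun t => ?_, h.hasDerivAt_coneMotion hZ hz, fun t => ?_⟩
  · rw [coneMotion, norm_smul, norm_inv, norm_norm, inv_mul_cancel₀ (hpos t).ne']
  · rw [← axialRadius_sq hZ, hrad]
    exact pow_pos (inv_pos.2 (hpos t)) 2
  · simpa only [hrad, inv_pow, div_inv_eq_mul] using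
      h.exists_hasDerivAt_coneMotionVelocity hZ hz t

lemma norm_keplerCone_map_zero (hz : 0 < axialInner Z z.1 z.1) (h : IsOrbitAngle Z M z φ)
    (hnorm : ‖z.1‖ = 1) : ‖keplerCone Z M z (φ 0)‖ = (axialRadius Z z.1)⁻¹ := by
  rw [h.map_zero, keplerCone_zero, conePosition, norm_smul, hnorm, norm_inv, Real.norm_eq_abs,
    abs_of_pos (axialRadius_pos hz), mul_one]

lemma coneMotion_zero (hz : 0 < axialInner Z z.1 z.1) (h : IsOrbitAngle Z M z φ)
    (hnorm : ‖z.1‖ = 1) : coneMotion Z M z φ 0 = z.1 := by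
  rw [coneMotion, h.norm_keplerCone_map_zero hz hnorm, h.map_zero, keplerCone_zero, conePosition,
    inv_inv, smul_inv_smul₀ (axialRadius_pos hz).ne']

lemma coneMotionVelocity_zero (hZ : ‖Z‖ = 1) (hz : 0 < axialMomentumSq Z z)
    (h : IsOrbitAngle Z M z φ) (hnorm : ‖z.1‖ = 1) (horth : ⟪z.1, z.2⟫ = 0) :
    coneMotionVelocity Z M z φ 0 = z.2 := by
  have hq := axialInner_self_pos_of_momentum hZ hz
  have hr := axialRadius_pos hq
  have hvel : axialMomentum Z z • keplerConeDeriv Z M z 0 = coneVelocity Z z := by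
    have hℓ := axialMomentum_pos hz
    simp [keplerConeDeriv, smul_smul, hℓ.ne']
  rw [coneMotionVelocity, h.norm_keplerCone_map_zero hq hnorm, h.map_zero, hvel, keplerCone_zero,
    conePosition, coneVelocity, inner_sub_right, real_inner_smul_left, real_inner_smul_left,
    real_inner_smul_right, real_inner_smul_right, horth, real_inner_self_eq_norm_sq, hnorm]
  match_scalars <;> field_simp
  ring

lemma exists_int_mul_two_pi_eq (hZ : ‖Z‖ = 1) (hz : 0 < axialMomentumSq Z z)
    (h : IsOrbitAngle Z M z φ) {T : ℝ} (hT : coneMotion Z M z φ T = coneMotion Z M z φ 0) :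
    ∃ k : ℤ, (k : ℝ) * (2 * Real.pi) = φ T := by
  have hinv := fun t => inv_pos.2 (norm_keplerCone_pos hZ M hz (φ t))
  have hnorm := congrArg (axialRadius Z) hT
  simp only [coneMotion, axialRadius_smul_of_pos (hinv _), axialRadius_keplerCone hZ hz,
    mul_one] at hnorm
  rw [coneMotion, coneMotion, hnorm] at hT
  have hcone := congrArg (axialInner Z (conePosition Z z)) (smul_right_injective H (hinv 0).ne' hT)
  rw [axialInner_conePosition_keplerCone hZ hz, axialInner_conePosition_keplerCone hZ hz,
    h.map_zero, Real.cos_zero] at hcone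
  exact (Real.cos_eq_one_iff _).1 hcone

lemma integral_keplerCone (hZ : ‖Z‖ = 1) (hz : 0 < axialMomentumSq Z z)
    (h : IsOrbitAngle Z M z φ) {U : H → ℝ} (hU : Continuous fun φ => U (keplerCone Z M z φ))
    (T : ℝ) :
    ∫ t in (0 : ℝ)..T, U (keplerCone Z M z (φ t))
      = ∫ x in (0 : ℝ)..φ T, U (keplerCone Z M z x) * timeDensity Z M z x := by
  have hspeed : Continuous fun t => axialMomentum Z z * ‖keplerCone Z M z (φ t)‖ ^ 2 :=
    continuous_const.mul (((contDiff_keplerCone (m := 0) Z M z).continuous.comp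
      h.continuous).norm.pow 2)
  have hsubst := intervalIntegral.integral_comp_mul_deriv (a := 0) (b := T)
    (g := fun x => U (keplerCone Z M z x) * timeDensity Z M z x)
    (fun t _ => h.hasDerivAt t) hspeed.continuousOn (hU.mul (continuous_timeDensity (M := M) hZ hz))
  rw [h.map_zero] at hsubst
  rw [← hsubst]
  refine intervalIntegral.integral_congr fun t _ => ?_
  have hpos := inv_pos.1 (timeDensity_pos (M := M) hZ hz (φ t))
  simp only [Function.comp_apply, timeDensity]
  rw [inv_mul_cancel_right₀ hpos.ne']

lemma integral_keplerCone_of_turns (hZ : ‖Z‖ = 1) (hz : 0 < axialMomentumSq Z z)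
    (h : IsOrbitAngle Z M z φ) {U : H → ℝ} (hU : Continuous fun φ => U (keplerCone Z M z φ))
    {T : ℝ} {k : ℤ} (hk : (k : ℝ) * (2 * Real.pi) = φ T) :
    ∫ t in (0 : ℝ)..T, U (keplerCone Z M z (φ t)) = k * orbitIntegral Z M U z := by
  have hper : Function.Periodic (fun x => U (keplerCone Z M z x) * timeDensity Z M z x)
      (2 * Real.pi) := fun x => by
    simp only [keplerCone_add_two_pi, periodic_timeDensity Z M z x]
  have hcont := hU.mul (continuous_timeDensity (M := M) hZ hz)
  have hturns := hper.intervalIntegral_add_zsmul_eq k 0 fun _ _ => hcont.intervalIntegrable _ _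
  rw [zero_add, zero_add, zsmul_eq_mul, zsmul_eq_mul, hk] at hturns
  rw [h.integral_keplerCone hZ hz hU, hturns, orbitIntegral]

/-- Both the integral of `U` along the motion and the period are the same number of turns. -/
lemma average_eq (hZ : ‖Z‖ = 1) (hz : 0 < axialMomentumSq Z z) (h : IsOrbitAngle Z M z φ)
    {U : H → ℝ} (hUcone : ∀ (c : ℝ) q, 0 < c → U (c • q) = U q)
    (hU : Continuous fun φ => U (keplerCone Z M z φ)) {T : ℝ} (hT : 0 < T)
    (hTper : coneMotion Z M z φ T = coneMotion Z M z φ 0) :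
    ∫ s in (0 : ℝ)..1, U (coneMotion Z M z φ (T * s))
      = orbitIntegral Z M U z / orbitIntegral Z M (fun _ => 1) z := by
  obtain ⟨k, hk⟩ := h.exists_int_mul_two_pi_eq hZ hz hTper
  have hperiod : T = k * orbitIntegral Z M (fun _ => 1) z := by
    simpa using h.integral_keplerCone_of_turns hZ hz (U := fun _ => 1) continuous_const hk
  have hk₀ : (k : ℝ) ≠ 0 := by
    rintro hk₀
    rw [hk₀, zero_mul] at hperiod
    exact hT.ne' hperiod
  have hcone : ∀ t, U (coneMotion Z M z φ t) = U (keplerCone Z M z (φ t)) := fun t =>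
    hUcone _ _ (inv_pos.2 (norm_keplerCone_pos hZ M hz _))
  rw [intervalIntegral.integral_comp_mul_left (fun t => U (coneMotion Z M z φ t)) hT.ne', mul_zero,
    mul_one, intervalIntegral.integral_congr fun t _ => hcone t,
    h.integral_keplerCone_of_turns hZ hz hU hk, smul_eq_mul, ← div_eq_inv_mul]
  nth_rw 1 [hperiod]
  rw [mul_div_mul_left _ _ hk₀]

end IsOrbitAngle

end Period

/-! ### The motions of the spherical Kepler problem -/

section AxialCalculus

variable {H : Type*} [NormedAddCommGroup H] [InnerProductSpace ℝ H] {Z : H} {m : WithTop ℕ∞}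

lemma contDiff_axialInner (Z : H) : ContDiff ℝ m fun z : H × H => axialInner Z z.1 z.2 :=
  (contDiff_fst.inner ℝ contDiff_snd).sub
    ((contDiff_const.inner ℝ contDiff_fst).mul (contDiff_const.inner ℝ contDiff_snd))

lemma contDiff_axialInner_self (Z : H) : ContDiff ℝ m fun q : H => axialInner Z q q :=
  (contDiff_axialInner Z).comp (contDiff_id.prodMk contDiff_id)

lemma contDiffAt_axialRadius {q : H} (hq : 0 < axialInner Z q q) :
    ContDiffAt ℝ m (axialRadius Z) q :=
  (contDiff_axialInner_self Z).contDiffAt.sqrt hq.ne'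

lemma contDiffAt_inner_div_axialRadius (u : H) {q : H} (hq : 0 < axialInner Z q q) :
    ContDiffAt ℝ m (fun q => ⟪u, q⟫ / axialRadius Z q) q :=
  (contDiff_const.inner ℝ contDiff_id).contDiffAt.div (contDiffAt_axialRadius hq)
    (axialRadius_pos hq).ne'

lemma hasLineDerivAt_inner_div_axialRadius (hZ : ‖Z‖ = 1) (u : H) {q : H}
    (hq : 0 < axialInner Z q q) (v : H) :
    HasLineDerivAt ℝ (fun q => ⟪u, q⟫ / axialRadius Z q)
      ((⟪u, v⟫ * axialInner Z q q - ⟪u, q⟫ * axialInner Z q v) / axialRadius Z q ^ 3) q v := by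
  have hline : HasDerivAt (fun t : ℝ => q + t • v) v 0 := (hasFDerivAt_id q).hasLineDerivAt v
  have hq₀ : q + (0 : ℝ) • v = q := by rw [zero_smul, add_zero]
  have hr := axialRadius_pos hq
  refine (((hasDerivAt_const 0 u).inner ℝ hline).div (hasDerivAt_axialRadius Z hline
    (by rwa [hq₀])) (by rw [hq₀]; exact hr.ne')).congr_deriv ?_
  rw [hq₀, inner_zero_left, add_zero, ← axialRadius_sq hZ q]
  field_simp

lemma cot_angle_eq (hZ : ‖Z‖ = 1) (q : H) :
    Real.cot (InnerProductGeometry.angle q Z) = ⟪Z, q⟫ / axialRadius Z q := by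
  rcases eq_or_ne q 0 with rfl | hq
  · simp [Real.cot_eq_cos_div_sin]
  have hrad : axialRadius Z q = √(⟪q, q⟫ * ⟪Z, Z⟫ - ⟪q, Z⟫ * ⟪q, Z⟫) := by
    rw [axialRadius, axialInner, real_inner_self_eq_norm_sq Z, hZ, real_inner_comm q Z, one_pow,
      mul_one]
  rw [hrad, ← InnerProductGeometry.sin_angle_mul_norm_mul_norm, real_inner_comm,
    ← InnerProductGeometry.cos_angle_mul_norm_mul_norm, Real.cot_eq_cos_div_sin, hZ, mul_one,
    mul_div_mul_right _ _ (norm_ne_zero_iff.2 hq)]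

end AxialCalculus

variable {n : ℕ}

lemma norm_southPole (n : ℕ) : ‖southPole n‖ = 1 := by
  rw [southPole, norm_neg, PiLp.norm_single, norm_one]

lemma yIdx_ne_zIdx (n : ℕ) : yIdx n ≠ zIdx n := (Fin.castSucc_lt_last _).ne

lemma norm_center₁ (n : ℕ) (a : ℝ) : ‖center₁ n a‖ = 1 := by
  have horth : ⟪EuclideanSpace.single (yIdx n) a, southPole n⟫ = 0 := by
    simp [southPole, EuclideanSpace.inner_single_left, yIdx_ne_zIdx n]
  have hsq := norm_add_sq_eq_norm_sq_add_norm_sq_of_inner_eq_zero _ _ horth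
  rw [norm_southPole, PiLp.norm_single, Real.norm_eq_abs, abs_mul_abs_self] at hsq
  have hnorm : ‖EuclideanSpace.single (yIdx n) a + southPole n‖ = √(1 + a ^ 2) := by
    rw [eq_comm, Real.sqrt_eq_iff_mul_self_eq (by positivity) (norm_nonneg _), hsq]
    ring
  have hs : √(1 + a ^ 2) ≠ 0 := by positivity
  rw [center₁, norm_smul, hnorm, norm_inv, Real.norm_of_nonneg (Real.sqrt_nonneg _),
    inv_mul_cancel₀ hs]

section KeplerMotion

variable {a m₁ : ℝ} {z : Ambient n × Ambient n} {γ v : ℝ → Ambient n}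

lemma firstPotential_eq (a m₁ : ℝ) (q : Ambient n) :
    firstPotential a m₁ q
      = -(m₁ * √(1 + a ^ 2)) * (⟪center₁ n a, q⟫ / axialRadius (center₁ n a) q) := by
  rw [firstPotential, keplerPotential, cot_angle_eq (norm_center₁ n a)]

lemma tangentialPart_add (q w w' : Ambient n) :
    tangentialPart q (w + w') = tangentialPart q w + tangentialPart q w' := by
  simp only [tangentialPart, inner_add_right]
  module

lemma tangentialPart_smul (q w : Ambient n) (c : ℝ) :
    tangentialPart q (c • w) = c • tangentialPart q w := by
  simp only [tangentialPart, real_inner_smul_right]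
  module

lemma tangentialPart_self {q : Ambient n} (hq : ‖q‖ = 1) : tangentialPart q q = 0 := by
  simp [tangentialPart, hq]

lemma gradient_firstPotential {q : Ambient n} (hnorm : ‖q‖ = 1)
    (hq : 0 < axialInner (center₁ n a) q q) :
    gradient (firstPotential a m₁) q
      = -(m₁ * √(1 + a ^ 2) / axialRadius (center₁ n a) q ^ 3) •
        tangentialPart q (center₁ n a) := by
  have hV : firstPotential a m₁ = fun q : Ambient n =>
      -(m₁ * √(1 + a ^ 2)) * (⟪center₁ n a, q⟫ / axialRadius (center₁ n a) q) :=
    funext (firstPotential_eq a m₁)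
  have hdiff : DifferentiableAt ℝ (firstPotential a m₁) q := by
    rw [hV]
    exact ((contDiffAt_inner_div_axialRadius (m := 1) _ hq).differentiableAt
      one_ne_zero).const_mul _
  refine ext_inner_right ℝ fun δ => ?_
  have hline : HasLineDerivAt ℝ (fun q : Ambient n =>
      -(m₁ * √(1 + a ^ 2)) * (⟪center₁ n a, q⟫ / axialRadius (center₁ n a) q)) _ q δ :=
    HasDerivAt.const_mul _
      (hasLineDerivAt_inner_div_axialRadius (norm_center₁ n a) (center₁ n a) hq δ)
  rw [inner_gradient_left, ← hdiff.lineDeriv_eq_fderiv, hV, hline.lineDeriv, real_inner_smul_left,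
    tangentialPart, inner_sub_left, real_inner_smul_left, axialInner, axialInner,
    real_inner_self_eq_norm_sq, hnorm, real_inner_comm q]
  ring

lemma tangentialPart_gradient_firstPotential {q : Ambient n} (hnorm : ‖q‖ = 1)
    (hq : 0 < axialInner (center₁ n a) q q) :
    tangentialPart q (gradient (firstPotential a m₁) q)
      = gradient (firstPotential a m₁) q := by
  have hidem : tangentialPart q (tangentialPart q (center₁ n a))
      = tangentialPart q (center₁ n a) := by
    simp [tangentialPart, inner_sub_right, real_inner_smul_right, hnorm]
  rw [gradient_firstPotential hnorm hq, tangentialPart_smul, hidem]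

lemma IsKeplerMotion.isCentralMotion (h : IsKeplerMotion a m₁ z γ) :
    IsCentralMotion (center₁ n a) (m₁ * √(1 + a ^ 2)) γ (deriv γ) := by
  have hpos : ∀ t, 0 < axialInner (center₁ n a) (γ t) (γ t) := fun t =>
    axialInner_self_pos_of_ne (norm_center₁ n a) (h.norm_eq_one t) (h.ne_center t)
      (h.ne_antipode t)
  have hderiv : ContDiff ℝ 1 (deriv γ) :=
    (contDiff_succ_iff_deriv.1 (h.contDiff.of_le one_add_one_eq_two.le)).2.2
  refine ⟨h.norm_eq_one, hpos, fun t => (h.contDiff.differentiable two_ne_zero t).hasDerivAt,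
    fun t => ⟨⟪γ t, deriv (deriv γ) t⟫ - m₁ * √(1 + a ^ 2) / axialRadius (center₁ n a) (γ t) ^ 3 *
      ⟪γ t, center₁ n a⟫, (hderiv.differentiable one_ne_zero t).hasDerivAt.congr_deriv ?_⟩⟩
  have hnewton := h.newton t
  rw [tangentialPart_gradient_firstPotential (h.norm_eq_one t) (hpos t),
    gradient_firstPotential (h.norm_eq_one t) (hpos t), neg_smul, neg_neg, tangentialPart,
    tangentialPart, sub_eq_iff_eq_add] at hnewton
  exact hnewton.trans (by module)

lemma IsCentralMotion.isKeplerMotion (hγ : ContDiff ℝ 2 γ)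
    (h : IsCentralMotion (center₁ n a) (m₁ * √(1 + a ^ 2)) γ v) :
    IsKeplerMotion a m₁ (γ 0, v 0) γ := by
  have hZ := norm_center₁ n a
  have hderiv : deriv γ = v := funext fun t => (h.hasDerivAt t).deriv
  refine ⟨hγ, h.norm_eq_one, fun t ht => ?_, fun t ht => ?_, fun t => ?_, rfl,
    congrFun hderiv 0⟩
  · have hpos := h.axialInner_pos t
    rw [ht, axialInner_axis_left hZ] at hpos
    exact hpos.false
  · have hpos := h.axialInner_pos t
    rw [ht, ← neg_one_smul ℝ (center₁ n a), axialInner_smul_left, axialInner_smul_right,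
      axialInner_axis_left hZ, mul_zero, mul_zero] at hpos
    exact hpos.false
  · obtain ⟨k, hk⟩ := h.newton t
    rw [hderiv, hk.deriv, tangentialPart_add, tangentialPart_smul, tangentialPart_smul,
      tangentialPart_self (h.norm_eq_one t),
      tangentialPart_gradient_firstPotential (h.norm_eq_one t) (h.axialInner_pos t),
      gradient_firstPotential (h.norm_eq_one t) (h.axialInner_pos t), smul_zero, zero_add, neg_smul,
      neg_neg]

lemma exists_isClosedKeplerMotion (hnorm : ‖z.1‖ = 1) (horth : ⟪z.1, z.2⟫ = 0)
    (hz : 0 < axialMomentumSq (center₁ n a) z) :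
    ∃ (γ : ℝ → Ambient n) (T : ℝ), IsClosedKeplerMotion a m₁ z γ T := by
  have hZ := norm_center₁ n a
  obtain ⟨φ, hφ, hturn⟩ := exists_isOrbitAngle (M := m₁ * √(1 + a ^ 2)) hZ hz
  have hmotion := (hφ.isCentralMotion hZ hz).isKeplerMotion (hφ.contDiff_coneMotion hZ hz)
  rw [hφ.coneMotion_zero (axialInner_self_pos_of_momentum hZ hz) hnorm,
    hφ.coneMotionVelocity_zero hZ hz hnorm horth] at hmotion
  refine ⟨_, _, hmotion, timeOfAngle_two_pi_pos (M := m₁ * √(1 + a ^ 2)) hZ hz, fun t => ?_⟩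
  simp only [coneMotion, hturn, keplerCone_add_two_pi]

lemma IsKeplerMotion.norm_fst (h : IsKeplerMotion a m₁ z γ) : ‖z.1‖ = 1 := by
  rw [← h.position, h.norm_eq_one]

lemma IsKeplerMotion.inner_eq_zero (h : IsKeplerMotion a m₁ z γ) : ⟪z.1, z.2⟫ = 0 := by
  rw [← h.position, ← h.velocity, h.isCentralMotion.inner_eq_zero]

lemma IsKeplerMotion.axialMomentumSq_pos (hm₁ : 0 < m₁) (h : IsKeplerMotion a m₁ z γ) :
    0 < axialMomentumSq (center₁ n a) z := by
  have hpos := h.isCentralMotion.axialMomentumSq_pos (norm_center₁ n a) (by positivity)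
  rwa [h.position, h.velocity] at hpos

lemma IsKeplerMotion.exists_isOrbitAngle (hm₁ : 0 < m₁) (h : IsKeplerMotion a m₁ z γ) :
    ∃ φ : ℝ → ℝ, IsOrbitAngle (center₁ n a) (m₁ * √(1 + a ^ 2)) z φ ∧
      γ = coneMotion (center₁ n a) (m₁ * √(1 + a ^ 2)) z φ := by
  rw [show z = (γ 0, deriv γ 0) by rw [h.position, h.velocity]]
  exact h.isCentralMotion.exists_isOrbitAngle (norm_center₁ n a) (by positivity)

lemma IsClosedKeplerMotion.average_eq {T : ℝ} (hm₁ : 0 < m₁) (h : IsClosedKeplerMotion a m₁ z γ T)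
    {U : Ambient n → ℝ} (hUcone : ∀ (c : ℝ) q, 0 < c → U (c • q) = U q)
    (hU : Continuous fun φ => U (keplerCone (center₁ n a) (m₁ * √(1 + a ^ 2)) z φ)) :
    ∫ s in (0 : ℝ)..1, U (γ (T * s))
      = orbitIntegral (center₁ n a) (m₁ * √(1 + a ^ 2)) U z
        / orbitIntegral (center₁ n a) (m₁ * √(1 + a ^ 2)) (fun _ => 1) z := by
  obtain ⟨hmotion, hT, hper⟩ := h
  obtain ⟨φ, hφ, rfl⟩ := hmotion.exists_isOrbitAngle hm₁
  exact hφ.average_eq (norm_center₁ n a) (hmotion.axialMomentumSq_pos hm₁) hUcone hU hT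
    (by simpa using hper 0)

end KeplerMotion

/-! ### The function `D` in homogeneous coordinates -/

/-- The expression of `D` as a function on `T^*ℝ^{d+1}` which is invariant under
`toTangentSphere`; here `Z` is the first center, `Y` the unit vector orthogonal to `Z` in the plane
of the centers, and `N` the north pole. -/
def axialIntegral {H : Type*} [NormedAddCommGroup H] [InnerProductSpace ℝ H] (Y Z N : H)
    (h m : ℝ) (z : H × H) : ℝ :=
  axialMomentumSq Z z - 2 * h *
    (axialInner Z z.1 z.1 * (⟪Y, z.2⟫ * ⟪N, z.2⟫)
      - axialInner Z z.1 z.2 * (⟪Y, z.2⟫ * ⟪N, z.1⟫ + ⟪Y, z.1⟫ * ⟪N, z.2⟫)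
      + axialInner Z z.2 z.2 * (⟪Y, z.1⟫ * ⟪N, z.1⟫)
      + m * (⟪Y, z.1⟫ / axialRadius Z z.1))

/-- An orthonormal basis `(Y, Z)` of the plane of the two centers, where `Z` is the first center,
together with the coordinates `(h, -k)` of the north pole `N` in this basis. -/
structure IsCenterFrame {H : Type*} [NormedAddCommGroup H] [InnerProductSpace ℝ H] (Y Z N : H)
    (h k : ℝ) : Prop where
  norm_axis : ‖Z‖ = 1
  norm_self : ‖Y‖ = 1
  inner_eq_zero : ⟪Z, Y⟫ = 0
  pole_eq : N = h • Y - k • Z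
  sq_add_sq : h ^ 2 + k ^ 2 = 1

/-- The unit vector `(0, …, 0, 1, a) / √(1 + a²)`, orthogonal to the first center. -/
def axisVector (n : ℕ) (a : ℝ) : Ambient n :=
  (√(1 + a ^ 2))⁻¹ • (EuclideanSpace.single (yIdx n) 1 + EuclideanSpace.single (zIdx n) a)

/-- The north pole `(0, …, 0, 1)`. -/
def northPole (n : ℕ) : Ambient n := EuclideanSpace.single (zIdx n) 1

/-- The coordinates of the component of a vector orthogonal to the first center, with respect to an
orthonormal basis that ends with `axisVector`. -/
def axialCoord (a : ℝ) (i : Fin (n + 1)) : Ambient n →L[ℝ] ℝ :=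
  if i = Fin.last n then innerSL ℝ (axisVector n a) else EuclideanSpace.proj i.castSucc

section Coordinates

variable {a : ℝ}

lemma sqrt_one_add_sq (a : ℝ) : √(1 + a ^ 2) ^ 2 = 1 + a ^ 2 := Real.sq_sqrt (by positivity)

lemma inner_axisVector (a : ℝ) (q : Ambient n) :
    ⟪axisVector n a, q⟫ = (√(1 + a ^ 2))⁻¹ * (q (yIdx n) + a * q (zIdx n)) := by
  simp [axisVector, inner_add_left, real_inner_smul_left, EuclideanSpace.inner_single_left, mul_add]

lemma inner_center₁ (a : ℝ) (q : Ambient n) :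
    ⟪center₁ n a, q⟫ = (√(1 + a ^ 2))⁻¹ * (a * q (yIdx n) - q (zIdx n)) := by
  simp [center₁, southPole, inner_add_left, real_inner_smul_left,
    EuclideanSpace.inner_single_left, sub_eq_add_neg, mul_add]

lemma inner_northPole (q : Ambient n) : ⟪northPole n, q⟫ = q (zIdx n) := by
  simp [northPole, EuclideanSpace.inner_single_left]

lemma axisVector_apply_yIdx : axisVector n a (yIdx n) = (√(1 + a ^ 2))⁻¹ := by
  simp [axisVector, yIdx_ne_zIdx n]

lemma axisVector_apply_zIdx : axisVector n a (zIdx n) = (√(1 + a ^ 2))⁻¹ * a := by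
  simp [axisVector, (yIdx_ne_zIdx n).symm]

lemma norm_axisVector (n : ℕ) (a : ℝ) : ‖axisVector n a‖ = 1 := by
  refine (pow_eq_one_iff_of_nonneg (norm_nonneg _) two_ne_zero).1 ?_
  rw [← real_inner_self_eq_norm_sq, inner_axisVector, axisVector_apply_yIdx, axisVector_apply_zIdx]
  field_simp
  rw [sqrt_one_add_sq]

lemma northPole_eq : northPole n = (a / √(1 + a ^ 2)) • axisVector n a
    - (√(1 + a ^ 2))⁻¹ • center₁ n a := by
  refine ext_inner_right ℝ fun q => ?_
  rw [inner_sub_left, real_inner_smul_left, real_inner_smul_left, inner_northPole,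
    inner_axisVector, inner_center₁]
  field_simp
  rw [sqrt_one_add_sq]
  ring

lemma center₂_eq : center₂ n a = (1 - 2 * (a / √(1 + a ^ 2)) ^ 2) • center₁ n a
    - (2 * (a / √(1 + a ^ 2)) * (√(1 + a ^ 2))⁻¹) • axisVector n a := by
  refine ext_inner_right ℝ fun q => ?_
  rw [inner_sub_left, real_inner_smul_left, real_inner_smul_left, center₂, inner_center₁,
    inner_axisVector, inner_center₁, neg_sq]
  field_simp
  rw [sqrt_one_add_sq]
  ring

lemma isCenterFrame (n : ℕ) (a : ℝ) : IsCenterFrame (axisVector n a) (center₁ n a) (northPole n)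
    (a / √(1 + a ^ 2)) (√(1 + a ^ 2))⁻¹ where
  norm_axis := norm_center₁ n a
  norm_self := norm_axisVector n a
  inner_eq_zero := by
    rw [inner_center₁, axisVector_apply_yIdx, axisVector_apply_zIdx]
    ring
  pole_eq := northPole_eq
  sq_add_sq := by
    rw [div_pow, inv_pow, sqrt_one_add_sq]
    field_simp
    ring

lemma axialCoord_last (a : ℝ) (q : Ambient n) :
    axialCoord a (Fin.last n) q = ⟪axisVector n a, q⟫ := by
  simp [axialCoord]

lemma axialCoord_of_ne {i : Fin (n + 1)} (hi : i ≠ Fin.last n) (a : ℝ) (q : Ambient n) :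
    axialCoord a i q = q i.castSucc := by
  simp [axialCoord, hi]

lemma sum_axialCoord_mul (a : ℝ) (q p : Ambient n) :
    ∑ i, axialCoord a i q * axialCoord a i p = axialInner (center₁ n a) q p := by
  have hinner : ⟪q, p⟫ = ∑ i : Fin n, q i.castSucc.castSucc * p i.castSucc.castSucc
      + q (yIdx n) * p (yIdx n) + q (zIdx n) * p (zIdx n) := by
    rw [PiLp.inner_apply, Fin.sum_univ_castSucc, Fin.sum_univ_castSucc]
    simp only [RCLike.inner_apply, conj_trivial, mul_comm (p.ofLp _)]
    rfl
  simp only [Fin.sum_univ_castSucc, axialCoord_last,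
    axialCoord_of_ne (Fin.castSucc_lt_last _).ne, axialInner, hinner, inner_axisVector,
    inner_center₁]
  field_simp
  rw [sqrt_one_add_sq]
  ring

lemma euclPosition_apply {q : Ambient n} (hq : ⟪northPole n, q⟫ ≠ 0) (i : Fin (n + 1)) :
    euclPosition a q i = -(axialCoord a i q / ⟪northPole n, q⟫) := by
  rw [inner_northPole] at hq ⊢
  simp only [euclPosition, centralProjection]
  split_ifs with hi
  · rw [hi, axialCoord_last, inner_axisVector, show (Fin.last n).castSucc = yIdx n from rfl]
    field_simp
    ring
  · rw [axialCoord_of_ne hi, neg_div]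

lemma hasFDerivAt_euclPosition_apply {q : Ambient n} (hq : ⟪northPole n, q⟫ ≠ 0)
    (i : Fin (n + 1)) :
    HasFDerivAt (fun q => euclPosition a q i)
      ((axialCoord a i q * (⟪northPole n, q⟫ ^ 2)⁻¹) • innerSL ℝ (northPole n)
        - (⟪northPole n, q⟫)⁻¹ • axialCoord a i) q := by
  have hN : HasFDerivAt (fun q : Ambient n => ⟪northPole n, q⟫) (innerSL ℝ (northPole n)) q :=
    (innerSL ℝ (northPole n)).hasFDerivAt
  have hquot := ((axialCoord a i).hasFDerivAt.mul ((hasDerivAt_inv hq).comp_hasFDerivAt q hN)).neg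
  refine (hquot.congr_fderiv ?_).congr_of_eventuallyEq ?_
  · simp only [Function.comp_apply]
    module
  · filter_upwards [hN.continuousAt.eventually_ne hq] with p hp using euclPosition_apply hp i

lemma fderiv_euclPosition_apply {q : Ambient n} (hq : ⟪northPole n, q⟫ ≠ 0) (v : Ambient n)
    (i : Fin (n + 1)) :
    fderiv ℝ (euclPosition a) q v i = (⟪northPole n, q⟫ ^ 2)⁻¹ *
      (axialCoord a i q * ⟪northPole n, v⟫ - axialCoord a i v * ⟪northPole n, q⟫) := by
  have hdiff : DifferentiableAt ℝ (euclPosition a) q := differentiableAt_euclidean.2 fun i =>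
    (hasFDerivAt_euclPosition_apply hq i).differentiableAt
  have hproj := (EuclideanSpace.proj i : Chart n →L[ℝ] ℝ).hasFDerivAt.comp q hdiff.hasFDerivAt
  have heq := congrArg (fun L => L v) (hproj.unique (hasFDerivAt_euclPosition_apply hq i))
  refine (show fderiv ℝ (euclPosition a) q v i = _ from heq).trans ?_
  simp only [smul_apply, sub_apply, innerSL_apply_apply, smul_eq_mul]
  field_simp

lemma one_add_norm_centralProjection_sq {q : Ambient n} (hnorm : ‖q‖ = 1)
    (hq : ⟪northPole n, q⟫ ≠ 0) :
    1 + ‖centralProjection q‖ ^ 2 = (⟪northPole n, q⟫ ^ 2)⁻¹ := by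
  rw [inner_northPole] at hq ⊢
  have hsum : ‖q‖ ^ 2 = ∑ i : Fin (n + 1), q i.castSucc ^ 2 + q (zIdx n) ^ 2 := by
    rw [EuclideanSpace.real_norm_sq_eq, Fin.sum_univ_castSucc]
    rfl
  have hproj : ‖centralProjection q‖ ^ 2
      = (∑ i : Fin (n + 1), q i.castSucc ^ 2) / q (zIdx n) ^ 2 := by
    simp only [EuclideanSpace.real_norm_sq_eq, centralProjection, div_pow, neg_sq, Finset.sum_div]
  rw [hnorm] at hsum
  rw [hproj]
  field_simp
  linear_combination -hsum

lemma euclVelocity_apply {q : Ambient n} (hnorm : ‖q‖ = 1) (hq : ⟪northPole n, q⟫ ≠ 0)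
    (v : Ambient n) (i : Fin (n + 1)) :
    euclVelocity a q v i
      = axialCoord a i q * ⟪northPole n, v⟫ - axialCoord a i v * ⟪northPole n, q⟫ := by
  rw [euclVelocity, PiLp.smul_apply, fderiv_euclPosition_apply hq,
    one_add_norm_centralProjection_sq hnorm hq, smul_eq_mul]
  field_simp

lemma sum_sum_Ioi_sq_sub {ι : Type*} [Fintype ι] [LinearOrder ι] [LocallyFiniteOrderTop ι]
    [LocallyFiniteOrderBot ι] (P W : ι → ℝ) :
    ∑ i, ∑ j ∈ Finset.Ioi i, (P i * W j - P j * W i) ^ 2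
      = (∑ i, P i * P i) * (∑ i, W i * W i) - (∑ i, P i * W i) ^ 2 := by
  have hdouble : 2 * ∑ i, ∑ j ∈ Finset.Ioi i, (P i * W j - P j * W i) ^ 2
      = ∑ i, ∑ j ∈ {i}ᶜ, (P j * W i - P i * W j) ^ 2 := by
    rw [← Finset.sum_sum_Ioi_add_eq_sum_sum_off_diag, Finset.mul_sum]
    simp only [Finset.mul_sum]
    exact Finset.sum_congr rfl fun i _ => Finset.sum_congr rfl fun j _ => by ring
  have hdiag : ∀ i, ∑ j ∈ {i}ᶜ, (P j * W i - P i * W j) ^ 2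
      = ∑ j, (P j * W i - P i * W j) ^ 2 := fun i =>
    Finset.sum_subset (Finset.subset_univ _) fun j _ hj => by
      rw [Finset.mem_compl, Finset.mem_singleton, not_not] at hj
      rw [hj, sub_self, zero_pow two_ne_zero]
  have hexpand : ∀ i j, (P j * W i - P i * W j) ^ 2 = (W i * W i) * (P j * P j)
      + (P i * P i) * (W j * W j) - 2 * ((P i * W i) * (P j * W j)) := fun i j => by ring
  have hall : ∑ i, ∑ j, (P j * W i - P i * W j) ^ 2
      = 2 * ((∑ i, P i * P i) * (∑ i, W i * W i) - (∑ i, P i * W i) ^ 2) := by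
    simp only [hexpand, Finset.sum_sub_distrib, Finset.sum_add_distrib, ← Finset.mul_sum,
      ← Finset.sum_mul]
    ring
  simp only [hdiag, hall] at hdouble
  linarith

variable {q v : Ambient n}

lemma sum_euclPosition_mul_self (hq : ⟪northPole n, q⟫ ≠ 0) :
    ∑ i, euclPosition a q i * euclPosition a q i
      = axialInner (center₁ n a) q q / ⟪northPole n, q⟫ ^ 2 := by
  rw [← sum_axialCoord_mul, Finset.sum_div]
  refine Finset.sum_congr rfl fun i _ => ?_
  rw [euclPosition_apply hq]
  ring

lemma sum_euclPosition_mul_euclVelocity (hnorm : ‖q‖ = 1) (hq : ⟪northPole n, q⟫ ≠ 0) :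
    ∑ i, euclPosition a q i * euclVelocity a q v i
      = axialInner (center₁ n a) q v
        - ⟪northPole n, v⟫ / ⟪northPole n, q⟫ * axialInner (center₁ n a) q q := by
  simp only [← sum_axialCoord_mul, Finset.mul_sum, ← Finset.sum_sub_distrib]
  refine Finset.sum_congr rfl fun i _ => ?_
  rw [euclPosition_apply hq, euclVelocity_apply hnorm hq]
  field_simp
  ring

lemma sum_euclVelocity_mul_self (hnorm : ‖q‖ = 1) (hq : ⟪northPole n, q⟫ ≠ 0) :
    ∑ i, euclVelocity a q v i * euclVelocity a q v i
      = ⟪northPole n, v⟫ ^ 2 * axialInner (center₁ n a) q q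
        - 2 * (⟪northPole n, v⟫ * ⟪northPole n, q⟫) * axialInner (center₁ n a) q v
        + ⟪northPole n, q⟫ ^ 2 * axialInner (center₁ n a) v v := by
  simp only [← sum_axialCoord_mul, Finset.mul_sum, ← Finset.sum_sub_distrib,
    ← Finset.sum_add_distrib]
  refine Finset.sum_congr rfl fun i _ => ?_
  rw [euclVelocity_apply hnorm hq]
  ring

lemma norm_euclPosition (hq : ⟪northPole n, q⟫ < 0) :
    ‖euclPosition a q‖ = -(axialRadius (center₁ n a) q / ⟪northPole n, q⟫) := by
  have hneg : 0 ≤ -(axialRadius (center₁ n a) q / ⟪northPole n, q⟫) :=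
    neg_nonneg.2 (div_nonpos_of_nonneg_of_nonpos (Real.sqrt_nonneg _) hq.le)
  rw [← sq_eq_sq₀ (norm_nonneg _) hneg, neg_sq, div_pow, axialRadius_sq (norm_center₁ n a),
    ← sum_euclPosition_mul_self hq.ne, EuclideanSpace.real_norm_sq_eq]
  simp only [sq]

lemma laplaceRungeLenz_eq (m : ℝ) (P W : Chart n) :
    laplaceRungeLenz m P W = W (Fin.last n) * ∑ i, P i * W i - P (Fin.last n) * ∑ i, W i * W i
      + m * P (Fin.last n) / ‖P‖ := by
  rw [laplaceRungeLenz, Finset.mul_sum, Finset.mul_sum, ← Finset.sum_sub_distrib]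
  congr 1
  exact Finset.sum_congr rfl fun i _ => by ring

lemma functionD_eq_axialIntegral (m₁ : ℝ) (hnorm : ‖q‖ = 1) (hq : ⟪northPole n, q⟫ < 0)
    (hpos : 0 < axialInner (center₁ n a) q q) :
    functionD a m₁ (q, v) = axialIntegral (axisVector n a) (center₁ n a) (northPole n)
      (a / √(1 + a ^ 2)) m₁ (q, v) := by
  have hr := axialRadius_pos hpos
  have hq₀ := hq.ne
  simp only [functionD, angularMomentumSq, laplaceRungeLenz_eq, axialIntegral, axialMomentumSq]
  rw [sum_sum_Ioi_sq_sub, sum_euclPosition_mul_self hq₀,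
    sum_euclPosition_mul_euclVelocity hnorm hq₀, sum_euclVelocity_mul_self hnorm hq₀,
    norm_euclPosition hq, euclPosition_apply hq₀, euclVelocity_apply hnorm hq₀, axialCoord_last,
    axialCoord_last]
  field_simp
  ring

end Coordinates

/-! ### Differentiation under the integral over an orbit -/

section Parametric

variable {E G : Type*} [NormedAddCommGroup E] [NormedSpace ℝ E] [NormedAddCommGroup G]
  [NormedSpace ℝ G] {F : E × ℝ → G} {x : E} {b c : ℝ}

lemma hasFDerivAt_partial {t : ℝ} (h : ContDiffAt ℝ 1 F (x, t)) :
    HasFDerivAt (fun y => F (y, t)) ((fderiv ℝ F (x, t)).comp (ContinuousLinearMap.inl ℝ E ℝ)) x :=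
  (h.differentiableAt one_ne_zero).hasFDerivAt.comp x (hasFDerivAt_prodMk_left x t)

lemma norm_fderiv_partial_le {t : ℝ} (h : ContDiffAt ℝ 1 F (x, t)) :
    ‖fderiv ℝ (fun y => F (y, t)) x‖ ≤ ‖fderiv ℝ F (x, t)‖ := by
  rw [(hasFDerivAt_partial h).fderiv]
  exact (ContinuousLinearMap.opNorm_comp_le _ _).trans
    (mul_le_of_le_one_right (norm_nonneg _) (ContinuousLinearMap.norm_inl_le_one ℝ E ℝ))

lemma continuousAt_fderiv {p : E × ℝ} (h : ContDiffAt ℝ 1 F p) : ContinuousAt (fderiv ℝ F) p :=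
  (h.fderiv_right (m := 0) (zero_add 1).le).continuousAt

lemma continuousOn_partial (h : ∀ t ∈ Set.uIcc b c, ContDiffAt ℝ 1 F (x, t)) :
    ContinuousOn (fun t => F (x, t)) (Set.uIcc b c) := fun t ht =>
  ((h t ht).continuousAt.comp (Continuous.prodMk_right x).continuousAt).continuousWithinAt

lemma continuousOn_fderiv_partial (h : ∀ t ∈ Set.uIcc b c, ContDiffAt ℝ 1 F (x, t)) :
    ContinuousOn (fun t => fderiv ℝ (fun y => F (y, t)) x) (Set.uIcc b c) := by
  have hcomp : ContinuousOn (fun t => (fderiv ℝ F (x, t)).comp (ContinuousLinearMap.inl ℝ E ℝ))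
      (Set.uIcc b c) := fun t ht =>
    (((continuousAt_fderiv (h t ht)).comp (Continuous.prodMk_right x).continuousAt).clm_comp
      continuousAt_const).continuousWithinAt
  exact hcomp.congr fun t ht => (hasFDerivAt_partial (h t ht)).fderiv

lemma exists_eventually_contDiffAt_norm_fderiv_lt
    (h : ∀ t ∈ Set.uIcc b c, ContDiffAt ℝ 1 F (x, t)) :
    ∃ C, ∀ᶠ y in nhds x, ∀ t ∈ Set.uIcc b c,
      ContDiffAt ℝ 1 F (y, t) ∧ ‖fderiv ℝ F (y, t)‖ < C := by
  have hcont : ContinuousOn (fun t => ‖fderiv ℝ F (x, t)‖) (Set.uIcc b c) := fun t ht =>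
    ((continuousAt_fderiv (h t ht)).norm.comp
      (Continuous.prodMk_right x).continuousAt).continuousWithinAt
  obtain ⟨C, hC⟩ := isCompact_uIcc.bddAbove_image hcont
  refine ⟨C + 1, isCompact_uIcc.eventually_forall_of_forall_eventually
    (P := fun y t => ContDiffAt ℝ 1 F (y, t) ∧ ‖fderiv ℝ F (y, t)‖ < C + 1) fun t ht => ?_⟩
  exact ((h t ht).eventually (by simp)).and ((continuousAt_fderiv (h t ht)).norm.eventually_lt
    continuousAt_const ((hC (Set.mem_image_of_mem _ ht)).trans_lt (lt_add_one C)))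

lemma hasFDerivAt_intervalIntegral_of_contDiffAt
    (h : ∀ t ∈ Set.uIcc b c, ContDiffAt ℝ 1 F (x, t)) :
    HasFDerivAt (fun y => ∫ t in b..c, F (y, t))
      (∫ t in b..c, fderiv ℝ (fun y => F (y, t)) x) x := by
  obtain ⟨C, hC⟩ := exists_eventually_contDiffAt_norm_fderiv_lt h
  refine intervalIntegral.hasFDerivAt_integral_of_dominated_of_fderiv_le
    (F := fun y t => F (y, t)) (F' := fun y t => fderiv ℝ (fun y => F (y, t)) y)
    (bound := fun _ => C) hC ?_ (continuousOn_partial h).intervalIntegrable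
    (((continuousOn_fderiv_partial h).mono Set.uIoc_subset_uIcc).aestronglyMeasurable
      measurableSet_uIoc) ?_ intervalIntegrable_const ?_
  · filter_upwards [hC] with y hy
    exact ((continuousOn_partial fun t ht => (hy t ht).1).mono
      Set.uIoc_subset_uIcc).aestronglyMeasurable measurableSet_uIoc
  · refine Filter.Eventually.of_forall fun t ht y hy => ?_
    obtain ⟨hsmooth, hlt⟩ := hy t (Set.uIoc_subset_uIcc ht)
    exact (norm_fderiv_partial_le hsmooth).trans hlt.le
  · refine Filter.Eventually.of_forall fun t ht y hy => ?_
    exact (hasFDerivAt_partial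
      (hy t (Set.uIoc_subset_uIcc ht)).1).differentiableAt.hasFDerivAt

end Parametric

section ConeSmooth

variable {H : Type*} [NormedAddCommGroup H] [InnerProductSpace ℝ H] {Z : H} {M : ℝ} {z : H × H}
  {m : WithTop ℕ∞}

lemma contDiff_axialMomentumSq (Z : H) : ContDiff ℝ m (axialMomentumSq Z) :=
  (((contDiff_axialInner_self Z).comp contDiff_fst).mul
    ((contDiff_axialInner_self Z).comp contDiff_snd)).sub ((contDiff_axialInner Z).pow 2)

lemma contDiffAt_axialMomentum (hz : 0 < axialMomentumSq Z z) :
    ContDiffAt ℝ m (axialMomentum Z) z :=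
  (contDiff_axialMomentumSq Z).contDiffAt.sqrt hz.ne'

lemma contDiffAt_axialRadius_fst (hz : 0 < axialInner Z z.1 z.1) :
    ContDiffAt ℝ m (fun z : H × H => axialRadius Z z.1) z :=
  (contDiffAt_axialRadius hz).comp z contDiffAt_fst

lemma contDiffAt_conePosition (hz : 0 < axialInner Z z.1 z.1) :
    ContDiffAt ℝ m (conePosition Z) z :=
  ((contDiffAt_axialRadius_fst hz).inv (axialRadius_pos hz).ne').smul contDiffAt_fst

lemma contDiffAt_coneVelocity (hz : 0 < axialInner Z z.1 z.1) :
    ContDiffAt ℝ m (coneVelocity Z) z :=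
  ((contDiffAt_axialRadius_fst hz).smul contDiffAt_snd).sub
    (((contDiff_axialInner Z).contDiffAt.div (contDiffAt_axialRadius_fst hz)
      (axialRadius_pos hz).ne').smul contDiffAt_fst)

lemma contDiffAt_keplerCone_uncurry (hZ : ‖Z‖ = 1) (hz : 0 < axialMomentumSq Z z) (φ : ℝ) :
    ContDiffAt ℝ m (fun p : (H × H) × ℝ => keplerCone Z M p.1 p.2) (z, φ) := by
  have hq := axialInner_self_pos_of_momentum hZ hz
  have hℓ := (axialMomentum_pos hz).ne'
  have hmomentum : ContDiffAt ℝ m (fun p : (H × H) × ℝ => axialMomentum Z p.1) (z, φ) :=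
    ContDiffAt.comp (g := axialMomentum Z) (z, φ) (contDiffAt_axialMomentum hz) contDiffAt_fst
  have hposition : ContDiffAt ℝ m (fun p : (H × H) × ℝ => conePosition Z p.1) (z, φ) :=
    ContDiffAt.comp (z, φ) (contDiffAt_conePosition hq) contDiffAt_fst
  have hvelocity : ContDiffAt ℝ m (fun p : (H × H) × ℝ => coneVelocity Z p.1) (z, φ) :=
    ContDiffAt.comp (z, φ) (contDiffAt_coneVelocity hq) contDiffAt_fst
  unfold keplerCone
  fun_prop (disch := first | exact hℓ | exact pow_ne_zero 2 hℓ)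

lemma contDiffAt_orbitIntegrand (hZ : ‖Z‖ = 1) (hz : 0 < axialMomentumSq Z z) {U : H → ℝ} {φ : ℝ}
    (hU : ContDiffAt ℝ m U (keplerCone Z M z φ)) :
    ContDiffAt ℝ m (fun p : (H × H) × ℝ => U (keplerCone Z M p.1 p.2) * timeDensity Z M p.1 p.2)
      (z, φ) := by
  have hℓ := axialMomentum_pos hz
  have hX := norm_keplerCone_pos hZ M hz φ
  have hmomentum : ContDiffAt ℝ m (fun p : (H × H) × ℝ => axialMomentum Z p.1) (z, φ) :=
    ContDiffAt.comp (g := axialMomentum Z) (z, φ) (contDiffAt_axialMomentum hz) contDiffAt_fst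
  have hcone := contDiffAt_keplerCone_uncurry (M := M) (m := m) hZ hz φ
  exact (ContDiffAt.comp (g := U) (z, φ) hU hcone).mul
    ((hmomentum.mul (hcone.norm_sq ℝ)).inv (by positivity))

lemma hasFDerivAt_orbitIntegral (hZ : ‖Z‖ = 1) (hz : 0 < axialMomentumSq Z z) {U : H → ℝ}
    (hU : ∀ φ, ContDiffAt ℝ 1 U (keplerCone Z M z φ)) :
    HasFDerivAt (orbitIntegral Z M U) (∫ φ in (0 : ℝ)..2 * Real.pi,
      fderiv ℝ (fun z => U (keplerCone Z M z φ) * timeDensity Z M z φ) z) z :=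
  hasFDerivAt_intervalIntegral_of_contDiffAt
    (F := fun p : (H × H) × ℝ => U (keplerCone Z M p.1 p.2) * timeDensity Z M p.1 p.2)
    fun φ _ => contDiffAt_orbitIntegrand hZ hz (hU φ)

lemma orbitIntegral_one_pos (hZ : ‖Z‖ = 1) (hz : 0 < axialMomentumSq Z z) :
    0 < orbitIntegral Z M (fun _ => 1) z := by
  simp only [orbitIntegral, one_mul]
  exact timeOfAngle_two_pi_pos hZ hz

lemma eventually_keplerCone_mem (hZ : ‖Z‖ = 1) (hz : 0 < axialMomentumSq Z z) {S : Set H}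
    (hS : IsOpen S) (h : ∀ φ, keplerCone Z M z φ ∈ S) :
    ∀ᶠ y in nhds z, 0 < axialMomentumSq Z y ∧ ∀ φ, keplerCone Z M y φ ∈ S := by
  have hmomentum : ∀ᶠ y in nhds z, 0 < axialMomentumSq Z y :=
    (contDiff_axialMomentumSq (m := 0) Z).continuous.continuousAt.eventually_const_lt hz
  have hturn : ∀ᶠ y in nhds z, ∀ φ ∈ Set.Icc (0 : ℝ) (2 * Real.pi), keplerCone Z M y φ ∈ S :=
    isCompact_Icc.eventually_forall_of_forall_eventually
      (P := fun y φ => keplerCone Z M y φ ∈ S) fun φ _ =>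
        (contDiffAt_keplerCone_uncurry (m := 0) hZ hz φ).continuousAt.preimage_mem_nhds
          (hS.mem_nhds (h φ))
  filter_upwards [hmomentum, hturn] with y hy hmem
  refine ⟨hy, fun φ => ?_⟩
  have hper : Function.Periodic (keplerCone Z M y) (2 * Real.pi) := keplerCone_add_two_pi Z M y
  obtain ⟨ψ, hψ, heq⟩ := hper.exists_mem_Ico₀ Real.two_pi_pos φ
  rw [heq]
  exact hmem ψ ⟨hψ.1, hψ.2.le⟩

end ConeSmooth

/-! ### The Hamiltonian vector field of `D` -/

section Flow

variable {H : Type*} [NormedAddCommGroup H] [InnerProductSpace ℝ H]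

/-- The component of `q` orthogonal to the unit vector `Z`. -/
def axialPart (Z q : H) : H := q - ⟪Z, q⟫ • Z

/-- The position component of the Hamiltonian vector field of `axialIntegral`, at points `(x, y)`
whose components orthogonal to `Z` are orthogonal, the first being a unit vector. -/
def flowPosition (Y Z N : H) (h : ℝ) (z : H × H) : H :=
  (2 : ℝ) • axialPart Z z.2 - (2 * h) • (⟪N, z.2⟫ • Y + ⟪Y, z.2⟫ • N
    - (⟪Y, z.2⟫ * ⟪N, z.1⟫ + ⟪Y, z.1⟫ * ⟪N, z.2⟫) • axialPart Z z.1
    + (2 * (⟪Y, z.1⟫ * ⟪N, z.1⟫)) • axialPart Z z.2)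

/-- The momentum component of the Hamiltonian vector field of `axialIntegral`, at points `(x, y)`
whose components orthogonal to `Z` are orthogonal, the first being a unit vector. -/
def flowMomentum (Y Z N : H) (h m : ℝ) (z : H × H) : H :=
  -(2 * axialInner Z z.2 z.2) • axialPart Z z.1 + (2 * h) • ((2 * (⟪Y, z.2⟫ * ⟪N, z.2⟫)) •
      axialPart Z z.1
    - (⟪Y, z.2⟫ * ⟪N, z.1⟫ + ⟪Y, z.1⟫ * ⟪N, z.2⟫) • axialPart Z z.2
    + axialInner Z z.2 z.2 • (⟪N, z.1⟫ • Y + ⟪Y, z.1⟫ • N)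
    + m • (Y - ⟪Y, z.1⟫ • axialPart Z z.1))

/-- The Hamiltonian vector field of `axialIntegral`, at points `(x, y)` whose components orthogonal
to `Z` are orthogonal, the first being a unit vector. -/
def flowField (Y Z N : H) (h m : ℝ) (z : H × H) : H × H :=
  (flowPosition Y Z N h z, flowMomentum Y Z N h m z)

/-- The energy of the Kepler problem in homogeneous coordinates. -/
def axialEnergy (Z : H) (M : ℝ) (z : H × H) : ℝ :=
  (⟪z.1, z.1⟫ * ⟪z.2, z.2⟫ - ⟪z.1, z.2⟫ ^ 2) / 2 - M * (⟪Z, z.1⟫ / axialRadius Z z.1)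

variable {Y Z N x e : H} {h m M k ℓ : ℝ} {z δ : H × H}

lemma hasDerivAt_fst_line (z δ : H × H) : HasDerivAt (fun ε : ℝ => (z + ε • δ).1) δ.1 0 :=
  (hasFDerivAt_fst (𝕜 := ℝ) (p := z)).hasLineDerivAt δ

lemma hasDerivAt_snd_line (z δ : H × H) : HasDerivAt (fun ε : ℝ => (z + ε • δ).2) δ.2 0 :=
  (hasFDerivAt_snd (𝕜 := ℝ) (p := z)).hasLineDerivAt δ

lemma inner_axialPart_left (Z q p : H) : ⟪axialPart Z q, p⟫ = axialInner Z q p := by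
  rw [axialPart, axialInner, inner_sub_left, real_inner_smul_left]

lemma inner_eq_axialInner_add (Z q p : H) : ⟪q, p⟫ = axialInner Z q p + ⟪Z, q⟫ * ⟪Z, p⟫ := by
  rw [axialInner, sub_add_cancel]

lemma axialInner_axialPart_right (hZ : ‖Z‖ = 1) (q p : H) :
    axialInner Z q (axialPart Z p) = axialInner Z q p := by
  rw [axialPart, axialInner_sub_right, axialInner_smul_right, axialInner_axis_right hZ, mul_zero,
    sub_zero]

lemma inner_axialPart_axis (hZ : ‖Z‖ = 1) (q : H) : ⟪Z, axialPart Z q⟫ = 0 := by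
  rw [axialPart, inner_sub_right, real_inner_smul_right, real_inner_self_eq_norm_sq, hZ, one_pow,
    mul_one, sub_self]

lemma axialRadius_eq_one (hx : axialInner Z x x = 1) : axialRadius Z x = 1 := by
  rw [axialRadius, hx, Real.sqrt_one]

lemma inner_fst_flowPosition (hx : axialInner Z z.1 z.1 = 1) (hxy : axialInner Z z.1 z.2 = 0) :
    ⟪z.1, flowPosition Y Z N h z⟫ = 0 := by
  rw [real_inner_comm]
  simp only [flowPosition, inner_add_left, inner_sub_left, real_inner_smul_left,
    inner_axialPart_left, axialInner_comm Z z.2, hx, hxy]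
  ring

lemma hasLineDerivAt_axialIntegral (hx : axialInner Z z.1 z.1 = 1)
    (hxy : axialInner Z z.1 z.2 = 0) (δ : H × H) :
    HasLineDerivAt ℝ (axialIntegral Y Z N h m)
      (⟪-flowMomentum Y Z N h m z, δ.1⟫ + ⟪flowPosition Y Z N h z, δ.2⟫) z δ := by
  have hq := hasDerivAt_fst_line z δ
  have hp := hasDerivAt_snd_line z δ
  have hzero : z + (0 : ℝ) • δ = z := by simp
  have hqq := hasDerivAt_axialInner Z hq hq
  have hqp := hasDerivAt_axialInner Z hq hp
  have hpp := hasDerivAt_axialInner Z hp hp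
  have hrad := hasDerivAt_axialRadius Z hq (by rw [hzero, hx]; exact one_pos)
  have hYq := (hasDerivAt_const (0 : ℝ) Y).inner ℝ hq
  have hYp := (hasDerivAt_const (0 : ℝ) Y).inner ℝ hp
  have hNq := (hasDerivAt_const (0 : ℝ) N).inner ℝ hq
  have hNp := (hasDerivAt_const (0 : ℝ) N).inner ℝ hp
  refine (((hqq.mul hpp).sub (hqp.pow 2)).sub (((((hqq.mul (hYp.mul hNp)).sub
    (hqp.mul ((hYp.mul hNq).add (hYq.mul hNp)))).add (hpp.mul (hYq.mul hNq))).add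
      ((hYq.div hrad (by rw [hzero, axialRadius_eq_one hx]; exact one_ne_zero)).const_mul
        m)).const_mul (2 * h))).congr_deriv ?_
  simp only [Pi.mul_apply, Pi.add_apply, hzero, axialRadius_eq_one hx, hx, hxy, inner_zero_left,
    add_zero]
  simp only [flowMomentum, flowPosition, inner_add_left, inner_sub_left, inner_neg_left,
    real_inner_smul_left, inner_axialPart_left, axialInner_comm Z δ.1, axialInner_comm Z δ.2]
  ring

namespace IsCenterFrame

lemma axialInner_self_right (hF : IsCenterFrame Y Z N h k) (q : H) : axialInner Z q Y = ⟪Y, q⟫ := by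
  rw [axialInner, hF.inner_eq_zero, mul_zero, sub_zero, real_inner_comm]

lemma inner_axis_axis (hF : IsCenterFrame Y Z N h k) : ⟪Z, Z⟫ = 1 := by
  rw [real_inner_self_eq_norm_sq, hF.norm_axis, one_pow]

lemma inner_self_axis (hF : IsCenterFrame Y Z N h k) : ⟪Y, Z⟫ = 0 := by
  rw [real_inner_comm, hF.inner_eq_zero]

lemma inner_pole (hF : IsCenterFrame Y Z N h k) (q : H) : ⟪N, q⟫ = h * ⟪Y, q⟫ - k * ⟪Z, q⟫ := by
  rw [hF.pole_eq, inner_sub_left, real_inner_smul_left, real_inner_smul_left]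

lemma inner_axis_pole (hF : IsCenterFrame Y Z N h k) : ⟪Z, N⟫ = -k := by
  rw [real_inner_comm, hF.inner_pole, hF.inner_self_axis, hF.inner_axis_axis]
  ring

lemma axialInner_pole_right (hF : IsCenterFrame Y Z N h k) (q : H) :
    axialInner Z q N = h * ⟪Y, q⟫ := by
  rw [hF.pole_eq, axialInner_sub_right, axialInner_smul_right, axialInner_smul_right,
    hF.axialInner_self_right, axialInner_axis_right hF.norm_axis, mul_zero, sub_zero]

variable (hF : IsCenterFrame Y Z N h k) (hxe : IsAxialOrthonormal Z x e)

include hF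

lemma inner_axis_flowPosition (z : H × H) :
    ⟪Z, flowPosition Y Z N h z⟫ = 2 * h * k * ⟪Y, z.2⟫ := by
  simp only [flowPosition, inner_add_right, inner_sub_right, real_inner_smul_right,
    inner_axialPart_axis hF.norm_axis, hF.inner_eq_zero, hF.inner_axis_pole]
  ring

lemma inner_axis_flowMomentum (z : H × H) :
    ⟪Z, flowMomentum Y Z N h m z⟫ = -(2 * h * k * axialInner Z z.2 z.2 * ⟪Y, z.1⟫) := by
  simp only [flowMomentum, inner_add_right, inner_sub_right, real_inner_smul_right,
    inner_axialPart_axis hF.norm_axis, hF.inner_eq_zero, hF.inner_axis_pole]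
  ring

include hxe

lemma axialInner_flowPosition_left :
    axialInner Z x (flowPosition Y Z N h (x, ℓ • e)) = -(2 * ℓ) * (h * k * ⟪Y, e⟫ * ⟪Z, x⟫) := by
  simp only [flowPosition, hF.inner_pole, real_inner_smul_right, axialInner_add_right,
    axialInner_sub_right, axialInner_smul_right, axialInner_axialPart_right hF.norm_axis,
    hF.axialInner_self_right, hF.axialInner_pole_right, hxe.self_left, hxe.cross]
  ring

lemma axialInner_flowPosition_right :
    axialInner Z e (flowPosition Y Z N h (x, ℓ • e)) = (2 * ℓ) * (1 - h * (2 * h * ⟪Y, e⟫ ^ 2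
      - ⟪Z, e⟫ * ⟪Y, e⟫ * k + 2 * h * ⟪Y, x⟫ ^ 2 - 2 * ⟪Y, x⟫ * ⟪Z, x⟫ * k)) := by
  simp only [flowPosition, hF.inner_pole, real_inner_smul_right, axialInner_add_right,
    axialInner_sub_right, axialInner_smul_right, axialInner_axialPart_right hF.norm_axis,
    hF.axialInner_self_right, hF.axialInner_pole_right, axialInner_comm Z e x, hxe.cross,
    hxe.self_right]
  ring

lemma axialInner_flowMomentum_left :
    axialInner Z x (flowMomentum Y Z N h m (x, ℓ • e)) = (2 * ℓ) * ℓ * (-1 + h * (2 * (⟪Y, e⟫ *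
      (h * ⟪Y, e⟫ - k * ⟪Z, e⟫)) + (h * ⟪Y, x⟫ - k * ⟪Z, x⟫) * ⟪Y, x⟫ + h * ⟪Y, x⟫ ^ 2)) := by
  simp only [flowMomentum, hF.inner_pole, real_inner_smul_right, axialInner_add_right,
    axialInner_sub_right, axialInner_smul_right, axialInner_smul_left,
    axialInner_axialPart_right hF.norm_axis, hF.axialInner_self_right, hF.axialInner_pole_right,
    hxe.self_left, hxe.cross, hxe.self_right]
  ring

lemma axialInner_flowMomentum_right :
    axialInner Z e (flowMomentum Y Z N h m (x, ℓ • e)) = 2 * ℓ * ℓ * (h * k * ⟪Y, x⟫ * ⟪Z, e⟫)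
      + 2 * h * m * ⟪Y, e⟫ := by
  simp only [flowMomentum, hF.inner_pole, real_inner_smul_right, axialInner_add_right,
    axialInner_sub_right, axialInner_smul_right, axialInner_smul_left,
    axialInner_axialPart_right hF.norm_axis, hF.axialInner_self_right, hF.axialInner_pole_right,
    axialInner_comm Z e x, hxe.cross, hxe.self_right]
  ring

lemma hasLineDerivAt_axialEnergy (hm : m = M * k) :
    HasLineDerivAt ℝ (axialEnergy Z M) 0 (x, ℓ • e) (flowField Y Z N h m (x, ℓ • e)) := by
  have hq := hasDerivAt_fst_line (x, ℓ • e) (flowField Y Z N h m (x, ℓ • e))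
  have hp := hasDerivAt_snd_line (x, ℓ • e) (flowField Y Z N h m (x, ℓ • e))
  have hzero : (x, ℓ • e) + (0 : ℝ) • flowField Y Z N h m (x, ℓ • e) = (x, ℓ • e) := by simp
  have hr := axialRadius_eq_one hxe.self_left
  have hrad := hasDerivAt_axialRadius Z hq (by rw [hzero, hxe.self_left]; exact one_pos)
  have hZq := (hasDerivAt_const (0 : ℝ) Z).inner ℝ hq
  refine (((((hq.inner ℝ hq).mul (hp.inner ℝ hp)).sub ((hq.inner ℝ hp).pow 2)).div_const 2).sub
    ((hZq.div hrad (by rw [hzero, hr]; exact one_ne_zero)).const_mul M)).congr_deriv ?_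
  simp only [hzero, hr, inner_zero_left, add_zero]
  simp only [flowField, real_inner_smul_left, real_inner_smul_right,
    real_inner_comm x (flowPosition _ _ _ _ _), real_inner_comm e (flowPosition _ _ _ _ _),
    real_inner_comm e (flowMomentum _ _ _ _ _ _)]
  simp only [inner_eq_axialInner_add Z x, inner_eq_axialInner_add Z e,
    hF.axialInner_flowPosition_left hxe, hF.axialInner_flowPosition_right hxe,
    hF.axialInner_flowMomentum_left hxe, hF.axialInner_flowMomentum_right hxe,
    hF.inner_axis_flowPosition, hF.inner_axis_flowMomentum, real_inner_smul_right,
    axialInner_smul_left, axialInner_smul_right, hxe.self_left, hxe.cross, hxe.self_right, hm]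
  ring

end IsCenterFrame
end Flow

/-! ### Deformation of Kepler orbits by the flow of `D` -/

section Normalized

variable {H : Type*} [NormedAddCommGroup H] [InnerProductSpace ℝ H] {Z x e : H}
  {M ℓ : ℝ} {δ : H × H}

namespace IsAxialOrthonormal

variable (hxe : IsAxialOrthonormal Z x e)

include hxe

lemma axialMomentumSq_smul (ℓ : ℝ) : axialMomentumSq Z (x, ℓ • e) = ℓ ^ 2 := by
  simp only [axialMomentumSq, axialInner_smul_left, axialInner_smul_right, hxe.self_left, hxe.cross,
    hxe.self_right]
  ring

lemma axialMomentumSq_smul_pos (hℓ : 0 < ℓ) : 0 < axialMomentumSq Z (x, ℓ • e) := by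
  rw [hxe.axialMomentumSq_smul]
  positivity

lemma axialMomentum_smul (hℓ : 0 < ℓ) : axialMomentum Z (x, ℓ • e) = ℓ := by
  rw [axialMomentum, hxe.axialMomentumSq_smul, Real.sqrt_sq hℓ.le]

lemma conePosition_eq (y : H) : conePosition Z (x, y) = x := by
  rw [conePosition, axialRadius_eq_one hxe.self_left, inv_one, one_smul]

lemma coneVelocity_smul (ℓ : ℝ) : coneVelocity Z (x, ℓ • e) = ℓ • e := by
  rw [coneVelocity, axialRadius_eq_one hxe.self_left, axialInner_smul_right, hxe.cross, mul_zero,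
    zero_div, zero_smul, sub_zero, one_smul]

lemma keplerCone_smul (hℓ : 0 < ℓ) (φ : ℝ) :
    keplerCone Z M (x, ℓ • e) φ = (M / ℓ ^ 2 * (1 - Real.cos φ)) • Z + Real.cos φ • x
      + Real.sin φ • e := by
  rw [keplerCone, hxe.conePosition_eq, hxe.coneVelocity_smul, hxe.axialMomentum_smul hℓ, smul_smul,
    div_mul_cancel₀ _ hℓ.ne']

lemma keplerConeDeriv_smul (hℓ : 0 < ℓ) (φ : ℝ) :
    keplerConeDeriv Z M (x, ℓ • e) φ = (M / ℓ ^ 2 * Real.sin φ) • Z - Real.sin φ • x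
      + Real.cos φ • e := by
  rw [keplerConeDeriv, hxe.conePosition_eq, hxe.coneVelocity_smul, hxe.axialMomentum_smul hℓ,
    smul_smul, div_mul_cancel₀ _ hℓ.ne']

lemma inner_keplerCone_smul (hℓ : 0 < ℓ) (φ : ℝ) (u : H) :
    ⟪u, keplerCone Z M (x, ℓ • e) φ⟫ = M / ℓ ^ 2 * (1 - Real.cos φ) * ⟪u, Z⟫
      + Real.cos φ * ⟪u, x⟫ + Real.sin φ * ⟪u, e⟫ := by
  simp only [hxe.keplerCone_smul hℓ, inner_add_right, real_inner_smul_right]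

lemma inner_keplerConeDeriv_smul (hℓ : 0 < ℓ) (φ : ℝ) (u : H) :
    ⟪u, keplerConeDeriv Z M (x, ℓ • e) φ⟫ = M / ℓ ^ 2 * Real.sin φ * ⟪u, Z⟫
      - Real.sin φ * ⟪u, x⟫ + Real.cos φ * ⟪u, e⟫ := by
  simp only [hxe.keplerConeDeriv_smul hℓ, inner_add_right, inner_sub_right, real_inner_smul_right]

lemma hasLineDerivAt_axialMomentum (hℓ : 0 < ℓ) :
    HasLineDerivAt ℝ (axialMomentum Z) (ℓ * axialInner Z x δ.1 + axialInner Z e δ.2)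
      (x, ℓ • e) δ := by
  have hq := hasDerivAt_fst_line (x, ℓ • e) δ
  have hp := hasDerivAt_snd_line (x, ℓ • e) δ
  have hzero : (x, ℓ • e) + (0 : ℝ) • δ = (x, ℓ • e) := by simp
  have hsq : HasDerivAt (fun ε : ℝ => axialMomentumSq Z ((x, ℓ • e) + ε • δ)) _ 0 :=
    ((hasDerivAt_axialInner Z hq hq).mul (hasDerivAt_axialInner Z hp hp)).sub
      ((hasDerivAt_axialInner Z hq hp).pow 2)
  refine (hsq.sqrt (by rw [hzero]; exact (hxe.axialMomentumSq_smul_pos hℓ).ne')).congr_deriv ?_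
  simp only [hzero, hxe.axialMomentumSq_smul, Real.sqrt_sq hℓ.le]
  simp only [axialInner_comm Z δ.1, axialInner_comm Z δ.2, axialInner_smul_left,
    axialInner_smul_right, hxe.self_left, hxe.cross, hxe.self_right]
  field_simp
  ring

lemma hasLineDerivAt_conePosition (y : H) :
    HasLineDerivAt ℝ (conePosition Z) (δ.1 - axialInner Z x δ.1 • x) (x, y) δ := by
  have hq := hasDerivAt_fst_line (x, y) δ
  have hzero : (x, y) + (0 : ℝ) • δ = (x, y) := by simp
  have hr := axialRadius_eq_one hxe.self_left
  have hrad := hasDerivAt_axialRadius Z hq (by rw [hzero, hxe.self_left]; exact one_pos)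
  refine ((hrad.inv (by rw [hzero, hr]; exact one_ne_zero)).smul hq).congr_deriv ?_
  simp only [Pi.inv_apply, hzero, hr]
  module

lemma hasLineDerivAt_coneVelocity (ℓ : ℝ) :
    HasLineDerivAt ℝ (coneVelocity Z) ((ℓ * axialInner Z x δ.1) • e + δ.2
      - (ℓ * axialInner Z e δ.1 + axialInner Z x δ.2) • x) (x, ℓ • e) δ := by
  have hq := hasDerivAt_fst_line (x, ℓ • e) δ
  have hp := hasDerivAt_snd_line (x, ℓ • e) δ
  have hzero : (x, ℓ • e) + (0 : ℝ) • δ = (x, ℓ • e) := by simp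
  have hr := axialRadius_eq_one hxe.self_left
  have hrad := hasDerivAt_axialRadius Z hq (by rw [hzero, hxe.self_left]; exact one_pos)
  refine ((hrad.smul hp).sub (((hasDerivAt_axialInner Z hq hp).div hrad
    (by rw [hzero, hr]; exact one_ne_zero)).smul hq)).congr_deriv ?_
  simp only [Pi.div_apply, hzero]
  simp only [hr, axialInner_smul_left, axialInner_smul_right, hxe.cross, axialInner_comm Z δ.1]
  match_scalars <;> ring

lemma hasLineDerivAt_keplerCone (hℓ : 0 < ℓ) (φ : ℝ) :
    HasLineDerivAt ℝ (fun z => keplerCone Z M z φ)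
      ((-2 * (M / ℓ ^ 2) * (axialInner Z x δ.1 + axialInner Z e δ.2 / ℓ) * (1 - Real.cos φ)) • Z
        + Real.cos φ • (δ.1 - axialInner Z x δ.1 • x)
        + Real.sin φ • (ℓ⁻¹ • δ.2 - (axialInner Z e δ.1 + axialInner Z x δ.2 / ℓ) • x
          - (axialInner Z e δ.2 / ℓ) • e)) (x, ℓ • e) δ := by
  have hzero : (x, ℓ • e) + (0 : ℝ) • δ = (x, ℓ • e) := by simp
  have hmom : HasDerivAt (fun ε : ℝ => axialMomentum Z ((x, ℓ • e) + ε • δ)) _ 0 :=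
    hxe.hasLineDerivAt_axialMomentum hℓ
  have hpos : HasDerivAt (fun ε : ℝ => conePosition Z ((x, ℓ • e) + ε • δ)) _ 0 :=
    hxe.hasLineDerivAt_conePosition (ℓ • e)
  have hvel : HasDerivAt (fun ε : ℝ => coneVelocity Z ((x, ℓ • e) + ε • δ)) _ 0 :=
    hxe.hasLineDerivAt_coneVelocity ℓ
  have hmom_zero : axialMomentum Z ((x, ℓ • e) + (0 : ℝ) • δ) = ℓ := by
    rw [hzero, hxe.axialMomentum_smul hℓ]
  refine ((((((hasDerivAt_const (0 : ℝ) M).div (hmom.pow 2)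
    (by rw [Pi.pow_apply, hmom_zero]; positivity)).mul_const (1 - Real.cos φ)).smul_const Z).add
    (hpos.const_smul (Real.cos φ))).add (((hasDerivAt_const (0 : ℝ) (Real.sin φ)).div hmom
      (by rw [hmom_zero]; exact hℓ.ne')).smul hvel)).congr_deriv ?_
  simp only [Pi.pow_apply, Pi.div_apply, hzero, hxe.axialMomentum_smul hℓ, hxe.coneVelocity_smul]
  match_scalars <;> field_simp <;> ring

end IsAxialOrthonormal

end Normalized

section Deformation

variable {H : Type*} [NormedAddCommGroup H] [InnerProductSpace ℝ H] {Y Z N x e : H}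
  {h m M k ℓ : ℝ}

lemma cone_deformation_identity {κ c sn w₀ w₁ y₁ y₂ : ℝ} (hcs : sn ^ 2 + c ^ 2 = 1) (x e Y Z : H)
    {w w' u u' A B A₀ B₀ : ℝ} (hw : w = κ * (1 - c) + c * w₀ + sn * w₁)
    (hw' : w' = κ * sn - sn * w₀ + c * w₁) (hu : u = c * y₁ + sn * y₂)
    (hu' : u' = c * y₂ - sn * y₁) (hA : A = h * u - k * w) (hB : B = h * u' - k * w')
    (hA₀ : A₀ = h * y₁ - k * w₀) (hB₀ : B₀ = h * y₂ - k * w₁)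
    {X X' : H} (hX : X = (κ * (1 - c)) • Z + c • x + sn • e)
    (hX' : X' = (κ * sn) • Z - sn • x + c • e) :
    (-2 * κ * (h * k * (y₁ * w₁ - y₂ * (w₀ - κ))) * (1 - c)) • Z
      + c • ((e - w₁ • Z) - h • (B₀ • Y + y₂ • (h • Y - k • Z) - (y₂ * A₀ + y₁ * B₀) • (x - w₀ • Z)
          + (2 * (y₁ * A₀)) • (e - w₁ • Z)) + (h * k * y₂ * w₀) • x)
      + sn • (-(h * k * y₂ * w₀) • e
          + (-(x - w₀ • Z) + h • ((2 * (y₂ * B₀)) • (x - w₀ • Z)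
            - (y₂ * A₀ + y₁ * B₀) • (e - w₁ • Z) + (A₀ • Y + y₁ • (h • Y - k • Z)))
            + (h * k * κ) • (Y - y₁ • (x - w₀ • Z)))
          - ((1 - h * (2 * h * y₂ ^ 2 - w₁ * y₂ * k + 2 * h * y₁ ^ 2 - 2 * y₁ * w₀ * k))
            + (-1 + h * (2 * (y₂ * B₀) + A₀ * y₁ + h * y₁ ^ 2))) • x
          - (h * k * (y₁ * w₁ - y₂ * (w₀ - κ))) • e)
    = ((X' - w' • Z) - h • (B • Y + u' • (h • Y - k • Z) - (u' * A + u * B) • (X - w • Z)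
          + (2 * (u * A)) • (X' - w' • Z)))
      + (h * k * u' * w) • X
      - (h * k * (w' * u' + 2 * w * u - w₁ * y₂ - 2 * w₀ * y₁)) • X' := by
  rw [hX, hX']
  match_scalars
  all_goals subst hA hB hA₀ hB₀
  all_goals subst hw hw' hu hu'
  · linear_combination (c * h * k * w₀ * w₁ * y₁ + 2 * c * h * k * w₀ * y₂ * κ
      - c * h * k * w₀ ^ 2 * y₂ - 2 * c * h * k * w₁ * y₁ * κ - c * h * k * y₂ * κ ^ 2
      + 2 * c * h ^ 2 * w₀ * y₁ * y₂ - 2 * c * h ^ 2 * w₁ * y₁ ^ 2 - h * k * sn * w₀ * w₁ * y₂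
      + h * k * sn * w₀ * y₁ * κ + h * k * sn * w₁ * y₂ * κ + h * k * sn * w₁ ^ 2 * y₁
      - h * k * sn * y₁ * κ ^ 2 - 2 * h * k * w₀ * y₂ * κ + 2 * h * k * w₁ * y₁ * κ
      + 2 * h * k * y₂ * κ ^ 2 + 2 * h ^ 2 * sn * w₀ * y₂ ^ 2
      - 2 * h ^ 2 * sn * w₁ * y₁ * y₂) * hcs
  · linear_combination (c * h * k * w₁ * y₂ + 2 * c * h ^ 2 * y₁ ^ 2 - h * k * sn * w₀ * y₂
      + h * k * sn * y₂ * κ + 2 * h ^ 2 * sn * y₁ * y₂) * hcs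
  · ring
  · linear_combination (c * h * k * w₁ * y₁ - 2 * c * h ^ 2 * y₁ * y₂ - h * k * sn * w₀ * y₁
      + h * k * sn * y₁ * κ - 2 * h ^ 2 * sn * y₂ ^ 2) * hcs

/-- The rate at which the flow of `D` shifts the angle about the axis at the point `X` of an orbit
with tangent vector `X'`, up to an additive constant of the orbit. -/
def angleShift (Y Z : H) (h k ℓ : ℝ) (X X' : H) : ℝ :=
  2 * ℓ * (h * k * (⟪Z, X'⟫ * ⟪Y, X'⟫ + 2 * ⟪Z, X⟫ * ⟪Y, X⟫))

/-- The rate at which the flow of `D` shifts the angle about the axis along the Kepler orbit through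
`(x, ℓ • e)`. -/
def orbitShift (Y Z x e : H) (h k M ℓ φ : ℝ) : ℝ :=
  angleShift Y Z h k ℓ (keplerCone Z M (x, ℓ • e) φ) (keplerConeDeriv Z M (x, ℓ • e) φ)
    - angleShift Y Z h k ℓ x e

lemma hasDerivAt_timeDensity (hZ : ‖Z‖ = 1) {z : H × H} (hz : 0 < axialMomentumSq Z z) (φ : ℝ) :
    HasDerivAt (timeDensity Z M z) (-(2 * ⟪Z, keplerCone Z M z φ⟫ * ⟪Z, keplerConeDeriv Z M z φ⟫)
      / (axialMomentum Z z * (1 + ⟪Z, keplerCone Z M z φ⟫ ^ 2) ^ 2)) φ := by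
  have hℓ := axialMomentum_pos hz
  have haxis : HasDerivAt (fun φ => ⟪Z, keplerCone Z M z φ⟫) ⟪Z, keplerConeDeriv Z M z φ⟫ φ := by
    simpa only [inner_zero_left, add_zero] using
      (hasDerivAt_const φ Z).inner ℝ (hasDerivAt_keplerCone Z M z φ)
  have heq : timeDensity Z M z
      = fun φ => (axialMomentum Z z * (1 + ⟪Z, keplerCone Z M z φ⟫ ^ 2))⁻¹ := by
    funext φ
    rw [timeDensity, norm_keplerCone_sq hZ M hz]
  rw [heq]
  refine ((((haxis.pow 2).const_add 1).const_mul (axialMomentum Z z)).inv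
    (mul_pos hℓ (by simp only [Pi.pow_apply]; positivity)).ne').congr_deriv ?_
  simp only [Pi.pow_apply, Nat.cast_ofNat, Nat.reduceSub, pow_one]
  field_simp

namespace IsCenterFrame

variable (hF : IsCenterFrame Y Z N h k) (hxe : IsAxialOrthonormal Z x e)

include hF hxe

lemma hasLineDerivAt_axialMomentum_flowField (hm : m = M * k) (hℓ : 0 < ℓ) :
    HasLineDerivAt ℝ (axialMomentum Z)
      (2 * ℓ * ℓ * (h * k * (⟪Y, x⟫ * ⟪Z, e⟫ - ⟪Y, e⟫ * (⟪Z, x⟫ - M / ℓ ^ 2))))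
      (x, ℓ • e) (flowField Y Z N h m (x, ℓ • e)) := by
  convert hxe.hasLineDerivAt_axialMomentum hℓ using 1
  rw [flowField, hF.axialInner_flowPosition_left hxe, hF.axialInner_flowMomentum_right hxe, hm]
  field_simp
  ring

lemma rungeLenz_keplerCone (hℓ : 0 < ℓ) (φ : ℝ) {X X' : H}
    (hX : X = keplerCone Z M (x, ℓ • e) φ) (hX' : X' = keplerConeDeriv Z M (x, ℓ • e) φ) :
    ⟪Y, X⟫ * ⟪Z, X'⟫ - ⟪Y, X'⟫ * (⟪Z, X⟫ - M / ℓ ^ 2)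
      = ⟪Y, x⟫ * ⟪Z, e⟫ - ⟪Y, e⟫ * (⟪Z, x⟫ - M / ℓ ^ 2) := by
  simp only [hX, hX', hxe.inner_keplerCone_smul hℓ, hxe.inner_keplerConeDeriv_smul hℓ,
    hF.inner_self_axis, hF.inner_axis_axis]
  linear_combination (⟪Y, x⟫ * ⟪Z, e⟫ - ⟪Y, e⟫ * (⟪Z, x⟫ - M / ℓ ^ 2)) *
    Real.sin_sq_add_cos_sq φ

lemma hasDerivAt_orbitShift (hℓ : 0 < ℓ) (φ : ℝ) {X X' : H}
    (hX : X = keplerCone Z M (x, ℓ • e) φ) (hX' : X' = keplerConeDeriv Z M (x, ℓ • e) φ) :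
    HasDerivAt (orbitShift Y Z x e h k M ℓ)
      (2 * ℓ * (h * k * (M / ℓ ^ 2 * ⟪Y, X'⟫ + ⟪Z, X⟫ * ⟪Y, X'⟫ + ⟪Z, X'⟫ * ⟪Y, X⟫))) φ := by
  have hcone := hasDerivAt_keplerCone Z M (x, ℓ • e) φ
  have hconeDeriv := hasDerivAt_keplerConeDeriv Z M (x, ℓ • e) φ
  have hinner {c : ℝ → H} {c' : H} (hc : HasDerivAt c c' φ) (u : H) :
      HasDerivAt (fun φ => ⟪u, c φ⟫) ⟪u, c'⟫ φ := by
    simpa only [inner_zero_left, add_zero] using (hasDerivAt_const φ u).inner ℝ hc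
  refine ((((((hinner hconeDeriv Z).mul (hinner hconeDeriv Y)).add
    (((hinner hcone Z).const_mul 2).mul (hinner hcone Y))).const_mul (h * k)).const_mul
      (2 * ℓ)).sub_const _).congr_deriv ?_
  simp only [← hX, ← hX', hxe.axialMomentum_smul hℓ, inner_sub_right, real_inner_smul_right,
    hF.inner_axis_axis, hF.inner_self_axis]
  ring

lemma hasLineDerivAt_keplerCone_flowField (hm : m = M * k) (hℓ : 0 < ℓ) (φ : ℝ) {X X' : H}
    (hX : X = keplerCone Z M (x, ℓ • e) φ) (hX' : X' = keplerConeDeriv Z M (x, ℓ • e) φ) :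
    HasLineDerivAt ℝ (fun z => keplerCone Z M z φ)
      (flowPosition Y Z N h (X, ℓ • X') + (2 * ℓ * (h * k * ⟪Y, X'⟫ * ⟪Z, X⟫)) • X
        - orbitShift Y Z x e h k M ℓ φ • X')
      (x, ℓ • e) (flowField Y Z N h m (x, ℓ • e)) := by
  have hdeform := cone_deformation_identity (h := h) (k := k) (κ := M / ℓ ^ 2) (w₀ := ⟪Z, x⟫)
    (w₁ := ⟪Z, e⟫) (y₁ := ⟪Y, x⟫) (y₂ := ⟪Y, e⟫)
    (Real.sin_sq_add_cos_sq φ) x e Y Z (w := ⟪Z, X⟫) (w' := ⟪Z, X'⟫) (u := ⟪Y, X⟫) (u' := ⟪Y, X'⟫)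
    (X := X) (X' := X')
    (by rw [hX, hxe.inner_keplerCone_smul hℓ, hF.inner_axis_axis]; ring)
    (by rw [hX', hxe.inner_keplerConeDeriv_smul hℓ, hF.inner_axis_axis]; ring)
    (by rw [hX, hxe.inner_keplerCone_smul hℓ, hF.inner_self_axis]; ring)
    (by rw [hX', hxe.inner_keplerConeDeriv_smul hℓ, hF.inner_self_axis]; ring)
    rfl rfl rfl rfl
    (by rw [hX, hxe.keplerCone_smul hℓ])
    (by rw [hX', hxe.keplerConeDeriv_smul hℓ])
  have hscale := congrArg (fun v => (2 * ℓ) • v) hdeform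
  convert hxe.hasLineDerivAt_keplerCone hℓ φ using 1
  rw [flowField, hF.axialInner_flowPosition_left hxe, hF.axialInner_flowMomentum_right hxe,
    hF.axialInner_flowPosition_right hxe, hF.axialInner_flowMomentum_left hxe]
  refine Eq.trans ?_ (hscale.symm.trans ?_)
  · simp only [flowPosition, axialPart, orbitShift, ← hX, ← hX', angleShift, hF.pole_eq,
      inner_sub_left, real_inner_smul_left, real_inner_smul_right]
    module
  · simp only [flowPosition, flowMomentum, axialPart, hF.pole_eq, inner_sub_left,
      real_inner_smul_left, real_inner_smul_right, axialInner_smul_left, axialInner_smul_right,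
      hxe.self_right, hm]
    match_scalars <;> field_simp <;> ring

/-- The flow of `D` transports the time density along the orbits with velocity `-orbitShift`. -/
lemma hasLineDerivAt_timeDensity_flowField (hm : m = M * k) (hℓ : 0 < ℓ) {φ s' ρ' : ℝ}
    (hs : HasDerivAt (orbitShift Y Z x e h k M ℓ) s' φ)
    (hρ : HasDerivAt (timeDensity Z M (x, ℓ • e)) ρ' φ) :
    HasLineDerivAt ℝ (fun z => timeDensity Z M z φ)
      (-(s' * timeDensity Z M (x, ℓ • e) φ + orbitShift Y Z x e h k M ℓ φ * ρ'))
      (x, ℓ • e) (flowField Y Z N h m (x, ℓ • e)) := by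
  set X := keplerCone Z M (x, ℓ • e) φ with hX
  set X' := keplerConeDeriv Z M (x, ℓ • e) φ with hX'
  have hz : 0 < axialMomentumSq Z (x, ℓ • e) := hxe.axialMomentumSq_smul_pos hℓ
  have hzero : (x, ℓ • e) + (0 : ℝ) • flowField Y Z N h m (x, ℓ • e) = (x, ℓ • e) := by simp
  have hXX' : IsAxialOrthonormal Z X X' := isAxialOrthonormal_keplerCone hF.norm_axis M hz φ
  have hnorm : ‖X‖ ^ 2 = 1 + ⟪Z, X⟫ ^ 2 := norm_keplerCone_sq hF.norm_axis M hz φ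
  have hinner : ⟪X, X'⟫ = ⟪Z, X⟫ * ⟪Z, X'⟫ := by
    rw [inner_eq_axialInner_add Z, hXX'.cross, zero_add]
  have hcross : axialInner Z X (ℓ • X') = 0 := by
    rw [axialInner_smul_right, hXX'.cross, mul_zero]
  have hflow : ⟪X, flowPosition Y Z N h (X, ℓ • X')⟫ = 0 :=
    inner_fst_flowPosition (z := (X, ℓ • X')) hXX'.self_left hcross
  have hmom : HasDerivAt (fun ε : ℝ => axialMomentum Z ((x, ℓ • e) + ε • flowField Y Z N h m
      (x, ℓ • e))) _ 0 := hF.hasLineDerivAt_axialMomentum_flowField hxe hm hℓ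
  have hcone : HasDerivAt (fun ε : ℝ => keplerCone Z M ((x, ℓ • e) + ε • flowField Y Z N h m
      (x, ℓ • e)) φ) _ 0 := hF.hasLineDerivAt_keplerCone_flowField hxe hm hℓ φ hX hX'
  refine ((hmom.mul hcone.norm_sq).inv (by
    rw [Pi.mul_apply, hzero, hxe.axialMomentum_smul hℓ, ← hX, hnorm]; positivity)).congr_deriv ?_
  rw [hs.unique (hF.hasDerivAt_orbitShift hxe hℓ φ hX hX'),
    hρ.unique (hasDerivAt_timeDensity hF.norm_axis hz φ), timeDensity]
  simp only [Pi.mul_apply, hzero, ← hX, ← hX', hxe.axialMomentum_smul hℓ, hnorm, inner_add_right,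
    inner_sub_right, real_inner_smul_right, hflow, hinner,
    real_inner_self_eq_norm_sq, ← hF.rungeLenz_keplerCone hxe hℓ φ hX hX']
  field_simp
  ring

/-- The potential changes along the orbit by `V'(F) = ‖X‖² W'`, with `F` the velocity of `D` at the
point of the orbit, and both `V` and the density are transported with velocity `-orbitShift`. -/
lemma hasDerivAt_orbitIntegrand_primitive (hm : m = M * k) (hℓ : 0 < ℓ) {φ : ℝ} {V W : H → ℝ}
    {X X' : H} (hX : X = keplerCone Z M (x, ℓ • e) φ)
    (hX' : X' = keplerConeDeriv Z M (x, ℓ • e) φ)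
    (hV : DifferentiableAt ℝ V X) (hW : DifferentiableAt ℝ W X) (hV_self : fderiv ℝ V X X = 0)
    (hVW : fderiv ℝ V X (flowPosition Y Z N h (X, ℓ • X'))
      = (1 + ⟪Z, X⟫ ^ 2) * fderiv ℝ W X (ℓ • X')) :
    HasDerivAt (fun φ => W (keplerCone Z M (x, ℓ • e) φ) - orbitShift Y Z x e h k M ℓ φ
        * (V (keplerCone Z M (x, ℓ • e) φ) * timeDensity Z M (x, ℓ • e) φ))
      (lineDeriv ℝ (fun z => V (keplerCone Z M z φ) * timeDensity Z M z φ) (x, ℓ • e)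
        (flowField Y Z N h m (x, ℓ • e))) φ := by
  have hz : 0 < axialMomentumSq Z (x, ℓ • e) := hxe.axialMomentumSq_smul_pos hℓ
  have hzero : (x, ℓ • e) + (0 : ℝ) • flowField Y Z N h m (x, ℓ • e) = (x, ℓ • e) := by simp
  have hshift := hF.hasDerivAt_orbitShift hxe hℓ φ hX hX'
  have hdensity := hasDerivAt_timeDensity (M := M) hF.norm_axis hz φ
  have hcone : HasDerivAt (keplerCone Z M (x, ℓ • e)) X' φ :=
    hX' ▸ hasDerivAt_keplerCone Z M (x, ℓ • e) φ
  have hVcone := HasFDerivAt.comp_hasDerivAt φ (hX ▸ hV.hasFDerivAt) hcone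
  have hWcone := HasFDerivAt.comp_hasDerivAt φ (hX ▸ hW.hasFDerivAt) hcone
  have hconeFlow : HasDerivAt (fun ε : ℝ =>
      keplerCone Z M ((x, ℓ • e) + ε • flowField Y Z N h m (x, ℓ • e)) φ) _ 0 :=
    hF.hasLineDerivAt_keplerCone_flowField hxe hm hℓ φ hX hX'
  have hVflow := HasFDerivAt.comp_hasDerivAt (0 : ℝ) (by rw [hzero, ← hX]; exact hV.hasFDerivAt)
    hconeFlow
  have hdensityFlow : HasDerivAt (fun ε : ℝ =>
      timeDensity Z M ((x, ℓ • e) + ε • flowField Y Z N h m (x, ℓ • e)) φ) _ 0 :=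
    hF.hasLineDerivAt_timeDensity_flowField hxe hm hℓ hshift hdensity
  have hflow : HasLineDerivAt ℝ (fun z => V (keplerCone Z M z φ) * timeDensity Z M z φ) _
    (x, ℓ • e) (flowField Y Z N h m (x, ℓ • e)) := hVflow.mul hdensityFlow
  rw [hflow.lineDeriv]
  refine (hWcone.sub (hshift.mul (hVcone.mul hdensity))).congr_deriv ?_
  have hρ : timeDensity Z M (x, ℓ • e) φ = (ℓ * (1 + ⟪Z, X⟫ ^ 2))⁻¹ := by
    rw [timeDensity, hxe.axialMomentum_smul hℓ, norm_keplerCone_sq hF.norm_axis M hz, ← hX]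
  simp only [Function.comp_apply, Pi.mul_apply, hzero, ← hX, ← hX', hρ, map_add, map_sub, map_smul,
    smul_eq_mul, hVW, hV_self]
  field_simp
  ring

/-- Over a closed orbit, the derivative of `hasDerivAt_orbitIntegrand_primitive` integrates to
zero. -/
lemma fderiv_orbitIntegral_flowField (hm : m = M * k) (hℓ : 0 < ℓ) {V W : H → ℝ}
    (hV : ∀ φ, ContDiffAt ℝ 1 V (keplerCone Z M (x, ℓ • e) φ))
    (hW : ∀ φ, DifferentiableAt ℝ W (keplerCone Z M (x, ℓ • e) φ))
    (hV_self : ∀ φ, fderiv ℝ V (keplerCone Z M (x, ℓ • e) φ) (keplerCone Z M (x, ℓ • e) φ) = 0)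
    (hVW : ∀ φ y, axialInner Z (keplerCone Z M (x, ℓ • e) φ) y = 0 →
      fderiv ℝ V (keplerCone Z M (x, ℓ • e) φ)
          (flowPosition Y Z N h (keplerCone Z M (x, ℓ • e) φ, y))
        = (1 + ⟪Z, keplerCone Z M (x, ℓ • e) φ⟫ ^ 2)
          * fderiv ℝ W (keplerCone Z M (x, ℓ • e) φ) y) :
    fderiv ℝ (orbitIntegral Z M V) (x, ℓ • e) (flowField Y Z N h m (x, ℓ • e)) = 0 := by
  have hZ := hF.norm_axis
  have hz : 0 < axialMomentumSq Z (x, ℓ • e) := hxe.axialMomentumSq_smul_pos hℓ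
  have hcont := continuousOn_fderiv_partial (b := 0) (c := 2 * Real.pi)
    fun φ _ => contDiffAt_orbitIntegrand (M := M) hZ hz (hV φ)
  have hderiv : ∀ φ, HasDerivAt (fun φ => W (keplerCone Z M (x, ℓ • e) φ)
        - orbitShift Y Z x e h k M ℓ φ
          * (V (keplerCone Z M (x, ℓ • e) φ) * timeDensity Z M (x, ℓ • e) φ))
      (fderiv ℝ (fun z => V (keplerCone Z M z φ) * timeDensity Z M z φ) (x, ℓ • e)
        (flowField Y Z N h m (x, ℓ • e))) φ := by
    intro φ
    rw [← (hasFDerivAt_partial (contDiffAt_orbitIntegrand (M := M) hZ hz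
      (hV φ))).differentiableAt.lineDeriv_eq_fderiv]
    refine hF.hasDerivAt_orbitIntegrand_primitive hxe hm hℓ rfl rfl
      ((hV φ).differentiableAt one_ne_zero) (hW φ) (hV_self φ) (hVW φ _ ?_)
    rw [axialInner_smul_right, (isAxialOrthonormal_keplerCone hZ M hz φ).cross, mul_zero]
  rw [(hasFDerivAt_orbitIntegral hZ hz hV).fderiv,
    ContinuousLinearMap.intervalIntegral_apply hcont.intervalIntegrable,
    intervalIntegral.integral_eq_sub_of_hasDerivAt (fun φ _ => hderiv φ)
      (hcont.clm_apply continuousOn_const).intervalIntegrable]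
  have hcone := keplerCone_add_two_pi Z M (x, ℓ • e) 0
  have hconeDeriv := keplerConeDeriv_add_two_pi Z M (x, ℓ • e) 0
  have hdensity := periodic_timeDensity Z M (x, ℓ • e) 0
  rw [zero_add] at hcone hconeDeriv hdensity
  simp only [orbitShift, hcone, hconeDeriv, hdensity, sub_self]

end IsCenterFrame

end Deformation

/-! ### The potential of the second center and of the Hooke center -/

section FrameIdentities

variable {H : Type*} [NormedAddCommGroup H] [InnerProductSpace ℝ H] {Y Z N : H} {h k : ℝ}
  {z : H × H}

lemma hasLineDerivAt_axialInner_self (Z q v : H) :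
    HasLineDerivAt ℝ (fun q => axialInner Z q q) (2 * axialInner Z q v) q v := by
  have hline : HasDerivAt (fun t : ℝ => q + t • v) v 0 := (hasFDerivAt_id q).hasLineDerivAt v
  refine (hasDerivAt_axialInner Z hline hline).congr_deriv ?_
  rw [zero_smul, add_zero, axialInner_comm Z v, two_mul]

lemma hasLineDerivAt_inner_right (u q v : H) : HasLineDerivAt ℝ (fun q => ⟪u, q⟫) ⟪u, v⟫ q v :=
  (innerSL ℝ u).hasFDerivAt.hasLineDerivAt v

lemma hasLineDerivAt_div_inner_sq {A : H → ℝ} {A' : ℝ} {q v : H} (hA : HasLineDerivAt ℝ A A' q v)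
    (hN : ⟪N, q⟫ ≠ 0) :
    HasLineDerivAt ℝ (fun q => A q / ⟪N, q⟫ ^ 2)
      ((A' * ⟪N, q⟫ - 2 * A q * ⟪N, v⟫) / ⟪N, q⟫ ^ 3) q v := by
  have hq : q + (0 : ℝ) • v = q := by rw [zero_smul, add_zero]
  have hpow : HasDerivAt (fun t : ℝ => ⟪N, q + t • v⟫ ^ 2) _ 0 :=
    HasDerivAt.pow (hasLineDerivAt_inner_right N q v) 2
  refine (HasDerivAt.div hA hpow (by rw [hq]; exact pow_ne_zero 2 hN)).congr_deriv ?_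
  simp only [hq, Nat.cast_ofNat, Nat.reduceSub, pow_one]
  field_simp

namespace IsCenterFrame

variable (hF : IsCenterFrame Y Z N h k)

include hF

lemma inner_self_flowPosition (z : H × H) :
    ⟪Y, flowPosition Y Z N h z⟫ = 2 * ⟪Y, z.2⟫ - 2 * h * (⟪N, z.2⟫ + h * ⟪Y, z.2⟫
      - (⟪Y, z.2⟫ * ⟪N, z.1⟫ + ⟪Y, z.1⟫ * ⟪N, z.2⟫) * ⟪Y, z.1⟫
      + 2 * (⟪Y, z.1⟫ * ⟪N, z.1⟫) * ⟪Y, z.2⟫) := by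
  have hpart : ∀ u, ⟪Y, axialPart Z u⟫ = ⟪Y, u⟫ := fun u => by
    rw [axialPart, inner_sub_right, real_inner_smul_right, hF.inner_self_axis, mul_zero, sub_zero]
  have hYY : ⟪Y, Y⟫ = 1 := by rw [real_inner_self_eq_norm_sq, hF.norm_self, one_pow]
  have hYN : ⟪Y, N⟫ = h := by
    rw [real_inner_comm, hF.inner_pole, hYY, real_inner_comm, hF.inner_self_axis]
    ring
  simp only [flowPosition, inner_add_right, inner_sub_right, real_inner_smul_right, hpart, hYY, hYN]
  ring

variable (hx : axialInner Z z.1 z.1 = 1) (hxy : axialInner Z z.1 z.2 = 0)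

include hx hxy

lemma inner_pole_flowPosition :
    ⟪N, flowPosition Y Z N h z⟫ = 2 * h ^ 2 *
      ((axialInner Z z.1 z.2 - ⟪Y, z.1⟫ * ⟪Y, z.2⟫) * ⟪N, z.1⟫
        - (axialInner Z z.1 z.1 - ⟪Y, z.1⟫ ^ 2) * ⟪N, z.2⟫) := by
  rw [hx, hxy, hF.inner_pole (flowPosition Y Z N h z), hF.inner_self_flowPosition,
    hF.inner_axis_flowPosition]
  simp only [hF.inner_pole]
  linear_combination (-2 * h * ⟪Y, z.2⟫) * hF.sq_add_sq

lemma inner_reflectedAxis_flowPosition {Z' : H}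
    (hZ' : Z' = (1 - 2 * h ^ 2) • Z - (2 * h * k) • Y) :
    ⟪Z', flowPosition Y Z N h z⟫ = -(2 * h * k) *
      (⟪Y - (2 * h) • N, z.2⟫ * axialInner Z' z.1 z.1
        - ⟪Y - (2 * h) • N, z.1⟫ * axialInner Z' z.1 z.2) := by
  have hinner : ∀ u, ⟪Z', u⟫ = (1 - 2 * h ^ 2) * ⟪Z, u⟫ - 2 * h * k * ⟪Y, u⟫ := fun u => by
    rw [hZ', inner_sub_left, real_inner_smul_left, real_inner_smul_left]
  have hnorm : ⟪z.1, z.1⟫ = 1 + ⟪Z, z.1⟫ ^ 2 := by rw [inner_eq_axialInner_add Z, hx, sq]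
  have hcross : ⟪z.1, z.2⟫ = ⟪Z, z.1⟫ * ⟪Z, z.2⟫ := by
    rw [inner_eq_axialInner_add Z, hxy, zero_add]
  simp only [axialInner, hnorm, hcross, hinner, inner_sub_left,
    real_inner_smul_left, hF.inner_self_flowPosition, hF.inner_axis_flowPosition, hF.inner_pole]
  generalize ⟪Y, z.1⟫ = α
  generalize ⟪Y, z.2⟫ = α'
  generalize ⟪Z, z.1⟫ = w
  generalize ⟪Z, z.2⟫ = w'
  linear_combination -(-8 * h ^ 3 * k * w * w' * α + 8 * h ^ 3 * k * w ^ 2 * α'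
    - 16 * h ^ 4 * k ^ 2 * w * α * α' + 16 * h ^ 4 * k ^ 2 * w' * α ^ 2
    + 16 * h ^ 5 * k * w * w' * α - 16 * h ^ 5 * k * w ^ 2 * α') * hF.sq_add_sq

end IsCenterFrame

end FrameIdentities

section Potentials

variable {a m₂ f : ℝ} {X v : Ambient n}

lemma norm_center₂ (n : ℕ) (a : ℝ) : ‖center₂ n a‖ = 1 := norm_center₁ n (-a)

/-- The correction for which `D + integralCorrection` is, to first order in the perturbation, a
first integral of the Lagrange problem. -/
def integralCorrection (n : ℕ) (a m₂ f : ℝ) (X : Ambient n) : ℝ :=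
  2 * (a / √(1 + a ^ 2)) * m₂ *
      (⟪axisVector n a - (2 * (a / √(1 + a ^ 2))) • northPole n, X⟫ / axialRadius (center₂ n a) X)
    - 2 * (a / √(1 + a ^ 2)) ^ 2 * f *
      ((axialInner (center₁ n a) X X - ⟪axisVector n a, X⟫ ^ 2) / ⟪northPole n, X⟫ ^ 2)

/-- The cone over the points of the lower hemisphere distinct from the second center. -/
def regularCone (n : ℕ) (a : ℝ) : Set (Ambient n) :=
  {X | ⟪northPole n, X⟫ < 0 ∧ 0 < axialInner (center₂ n a) X X}

lemma perturbingPotential_eq (X : Ambient n) :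
    perturbingPotential a m₂ f X =
      -(m₂ * √(1 + a ^ 2)) * (⟪center₂ n a, X⟫ / axialRadius (center₂ n a) X)
        + f * (axialInner (northPole n) X X / ⟪northPole n, X⟫ ^ 2) := by
  have hpole : southPole n = -northPole n := rfl
  have htan : Real.tan (InnerProductGeometry.angle X (southPole n))
      = axialRadius (southPole n) X / ⟪southPole n, X⟫ := by
    rw [← inv_div, ← cot_angle_eq (norm_southPole n) X, Real.cot_eq_cos_div_sin, inv_div,
      Real.tan_eq_sin_div_cos]
  rw [perturbingPotential, keplerPotential, hookePotential, cot_angle_eq (norm_center₂ n a), htan,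
    div_pow, axialRadius_sq (norm_southPole n), hpole]
  simp only [axialInner, inner_neg_left, neg_sq, neg_mul_neg]

lemma perturbingPotential_smul {c : ℝ} (hc : 0 < c) (X : Ambient n) :
    perturbingPotential a m₂ f (c • X) = perturbingPotential a m₂ f X := by
  simp only [perturbingPotential, keplerPotential, hookePotential,
    InnerProductGeometry.angle_smul_left_of_pos _ _ hc]

lemma isOpen_regularCone : IsOpen (regularCone n a) :=
  (isOpen_lt (innerSL ℝ (northPole n)).continuous continuous_const).inter
    (isOpen_lt continuous_const (contDiff_axialInner_self (m := 1) (center₂ n a)).continuous)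

lemma contDiff_inner_right (u : Ambient n) : ContDiff ℝ 1 fun X : Ambient n => ⟪u, X⟫ :=
  contDiff_const.inner ℝ contDiff_id

lemma contDiffAt_perturbingPotential (hX : X ∈ regularCone n a) :
    ContDiffAt ℝ 1 (perturbingPotential a m₂ f) X := by
  rw [funext (perturbingPotential_eq (a := a) (m₂ := m₂) (f := f) (n := n))]
  exact (contDiffAt_const.mul (contDiffAt_inner_div_axialRadius _ hX.2)).add
    (contDiffAt_const.mul ((contDiff_axialInner_self _).contDiffAt.div
      ((contDiff_inner_right _).contDiffAt.pow 2) (pow_ne_zero 2 hX.1.ne)))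

lemma differentiableAt_integralCorrection (hX : X ∈ regularCone n a) :
    DifferentiableAt ℝ (integralCorrection n a m₂ f) X :=
  ((contDiffAt_const.mul (contDiffAt_inner_div_axialRadius _ hX.2)).sub
    (contDiffAt_const.mul (((contDiff_axialInner_self _).contDiffAt.sub
      ((contDiff_inner_right _).contDiffAt.pow 2)).div
      ((contDiff_inner_right _).contDiffAt.pow 2)
      (pow_ne_zero 2 hX.1.ne)))).differentiableAt one_ne_zero

lemma fderiv_perturbingPotential_self (hX : X ∈ regularCone n a) :
    fderiv ℝ (perturbingPotential a m₂ f) X X = 0 := by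
  have hd := (contDiffAt_perturbingPotential (m₂ := m₂) (f := f) hX).differentiableAt one_ne_zero
  rw [← hd.lineDeriv_eq_fderiv]
  refine HasLineDerivAt.lineDeriv ((hasDerivAt_const 0
    (perturbingPotential a m₂ f X)).congr_of_eventuallyEq ?_)
  filter_upwards [lt_mem_nhds (neg_one_lt_zero (R := ℝ))] with t ht
  rw [show X + t • X = (1 + t) • X by rw [add_smul, one_smul],
    perturbingPotential_smul (by linarith)]

lemma fderiv_perturbingPotential_of_inner_eq_zero (hX : X ∈ regularCone n a) (hXv : ⟪X, v⟫ = 0) :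
    fderiv ℝ (perturbingPotential a m₂ f) X v = ⟪X, X⟫ *
      (-(m₂ * √(1 + a ^ 2)) * ⟪center₂ n a, v⟫ / axialRadius (center₂ n a) X ^ 3
        - 2 * f * ⟪northPole n, v⟫ / ⟪northPole n, X⟫ ^ 3) := by
  have hd := (contDiffAt_perturbingPotential (m₂ := m₂) (f := f) hX).differentiableAt one_ne_zero
  have hline : HasLineDerivAt ℝ (perturbingPotential a m₂ f) _ X v :=
    (((hasLineDerivAt_inner_div_axialRadius (norm_center₂ n a) _ hX.2 v).const_mul _).add
      ((hasLineDerivAt_div_inner_sq (hasLineDerivAt_axialInner_self (northPole n) X v)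
        hX.1.ne).const_mul f)).congr_of_eventuallyEq
          (Filter.Eventually.of_forall fun t => perturbingPotential_eq (X + t • v))
  rw [← hd.lineDeriv_eq_fderiv, hline.lineDeriv]
  simp only [axialInner, hXv]
  ring

lemma fderiv_integralCorrection_apply (hX : X ∈ regularCone n a) (v : Ambient n) :
    fderiv ℝ (integralCorrection n a m₂ f) X v =
      2 * (a / √(1 + a ^ 2)) * m₂ *
        ((⟪axisVector n a - (2 * (a / √(1 + a ^ 2))) • northPole n, v⟫
            * axialInner (center₂ n a) X X
          - ⟪axisVector n a - (2 * (a / √(1 + a ^ 2))) • northPole n, X⟫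
            * axialInner (center₂ n a) X v) / axialRadius (center₂ n a) X ^ 3)
      - 2 * (a / √(1 + a ^ 2)) ^ 2 * f *
        (2 * ((axialInner (center₁ n a) X v - ⟪axisVector n a, X⟫ * ⟪axisVector n a, v⟫)
            * ⟪northPole n, X⟫
          - (axialInner (center₁ n a) X X - ⟪axisVector n a, X⟫ ^ 2) * ⟪northPole n, v⟫)
            / ⟪northPole n, X⟫ ^ 3) := by
  have hsq : HasLineDerivAt ℝ (fun X => axialInner (center₁ n a) X X - ⟪axisVector n a, X⟫ ^ 2)
      _ X v := HasDerivAt.sub (hasLineDerivAt_axialInner_self (center₁ n a) X v)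
        (HasDerivAt.pow (hasLineDerivAt_inner_right (axisVector n a) X v) 2)
  have hline : HasLineDerivAt ℝ (integralCorrection n a m₂ f) _ X v :=
    ((hasLineDerivAt_inner_div_axialRadius (norm_center₂ n a) _ hX.2 v).const_mul _).sub
      ((hasLineDerivAt_div_inner_sq hsq hX.1.ne).const_mul _)
  rw [← (differentiableAt_integralCorrection hX).lineDeriv_eq_fderiv, hline.lineDeriv]
  simp only [zero_smul, add_zero]
  ring

lemma fderiv_perturbingPotential_flowPosition {y : Ambient n} (hX : X ∈ regularCone n a)
    (hXX : axialInner (center₁ n a) X X = 1) (hXy : axialInner (center₁ n a) X y = 0) :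
    fderiv ℝ (perturbingPotential a m₂ f) X (flowPosition (axisVector n a) (center₁ n a)
        (northPole n) (a / √(1 + a ^ 2)) (X, y))
      = (1 + ⟪center₁ n a, X⟫ ^ 2) * fderiv ℝ (integralCorrection n a m₂ f) X y := by
  have hs : √(1 + a ^ 2) ≠ 0 := by positivity
  have hF := isCenterFrame n a
  have hnorm : ⟪X, X⟫ = 1 + ⟪center₁ n a, X⟫ ^ 2 := by
    rw [inner_eq_axialInner_add (center₁ n a), hXX, sq]
  rw [fderiv_perturbingPotential_of_inner_eq_zero hX
      (inner_fst_flowPosition (z := (X, y)) hXX hXy), fderiv_integralCorrection_apply hX, hnorm,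
    hF.inner_pole_flowPosition (z := (X, y)) hXX hXy,
    hF.inner_reflectedAxis_flowPosition (z := (X, y)) hXX hXy center₂_eq]
  field_simp

end Potentials

/-! ### Invariance under rescaling -/

section Rescaling

variable {H : Type*} [NormedAddCommGroup H] [InnerProductSpace ℝ H]

/-- The linear symplectic map `(q, p) ↦ (c⁻¹ q, c p + d q)`. The functions on `T^*ℝ^{d+1}` pulled
back by `toTangentSphere` are invariant under these maps for `0 < c`, and a point outside the axis
is normalized by one of them. -/
def rescale (c d : ℝ) : H × H →L[ℝ] H × H :=
  (c⁻¹ • ContinuousLinearMap.fst ℝ H H).prod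
    (c • ContinuousLinearMap.snd ℝ H H + d • ContinuousLinearMap.fst ℝ H H)

variable {Y Z N : H} {h m M c d : ℝ} {z : H × H}

lemma rescale_apply (c d : ℝ) (z : H × H) : rescale c d z = (c⁻¹ • z.1, c • z.2 + d • z.1) := rfl

lemma axialMomentumSq_rescale (hc : c ≠ 0) (z : H × H) :
    axialMomentumSq Z (rescale c d z) = axialMomentumSq Z z := by
  simp only [axialMomentumSq, rescale_apply, axialInner_smul_left, axialInner_smul_right,
    axialInner_add_left, axialInner_add_right, axialInner_comm Z z.2 z.1]
  field_simp
  ring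

lemma axialMomentum_rescale (hc : c ≠ 0) (z : H × H) :
    axialMomentum Z (rescale c d z) = axialMomentum Z z := by
  rw [axialMomentum, axialMomentumSq_rescale hc, axialMomentum]

lemma conePosition_rescale (hc : 0 < c) (z : H × H) :
    conePosition Z (rescale c d z) = conePosition Z z := by
  rw [conePosition, rescale_apply, axialRadius_smul_of_pos (inv_pos.2 hc), smul_smul, mul_inv,
    inv_inv, mul_right_comm, mul_inv_cancel₀ hc.ne', one_mul, conePosition]

lemma coneVelocity_rescale (hZ : ‖Z‖ = 1) (hc : 0 < c) (hz : 0 < axialInner Z z.1 z.1) :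
    coneVelocity Z (rescale c d z) = coneVelocity Z z := by
  have hr := axialRadius_pos hz
  simp only [coneVelocity, rescale_apply, axialRadius_smul_of_pos (inv_pos.2 hc),
    axialInner_smul_left, axialInner_smul_right, axialInner_add_right, ← axialRadius_sq hZ z.1]
  match_scalars <;> field_simp
  ring

lemma keplerCone_rescale (hZ : ‖Z‖ = 1) (hc : 0 < c) (hz : 0 < axialInner Z z.1 z.1) (φ : ℝ) :
    keplerCone Z M (rescale c d z) φ = keplerCone Z M z φ := by
  rw [keplerCone, axialMomentum_rescale hc.ne', conePosition_rescale hc,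
    coneVelocity_rescale hZ hc hz, keplerCone]

lemma orbitIntegral_rescale (hZ : ‖Z‖ = 1) (hc : 0 < c) (hz : 0 < axialInner Z z.1 z.1)
    (U : H → ℝ) : orbitIntegral Z M U (rescale c d z) = orbitIntegral Z M U z := by
  simp only [orbitIntegral, timeDensity, keplerCone_rescale hZ hc hz, axialMomentum_rescale hc.ne']

lemma axialIntegral_rescale (hc : 0 < c) (z : H × H) :
    axialIntegral Y Z N h m (rescale c d z) = axialIntegral Y Z N h m z := by
  rw [axialIntegral, axialMomentumSq_rescale hc.ne', axialIntegral]
  simp only [rescale_apply, axialRadius_smul_of_pos (inv_pos.2 hc), axialInner_smul_left,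
    axialInner_smul_right, axialInner_add_left, axialInner_add_right, inner_add_right,
    real_inner_smul_right, axialInner_comm Z z.2 z.1, mul_div_mul_left _ _ (inv_ne_zero hc.ne')]
  field_simp
  ring

lemma axialEnergy_rescale (hc : 0 < c) (z : H × H) :
    axialEnergy Z M (rescale c d z) = axialEnergy Z M z := by
  simp only [axialEnergy, rescale_apply, axialRadius_smul_of_pos (inv_pos.2 hc), inner_add_right,
    inner_add_left, real_inner_smul_right, real_inner_smul_left, real_inner_comm z.1 z.2,
    mul_div_mul_left _ _ (inv_ne_zero hc.ne')]
  field_simp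
  ring

lemma exists_rescale_eq (hz : 0 < axialInner Z z.1 z.1) :
    ∃ c d : ℝ, 0 < c ∧ rescale c d z = (conePosition Z z, coneVelocity Z z) := by
  refine ⟨axialRadius Z z.1, -(axialInner Z z.1 z.2 / axialRadius Z z.1), axialRadius_pos hz, ?_⟩
  rw [rescale_apply, conePosition, coneVelocity, neg_smul, sub_eq_add_neg]

lemma fderiv_eq_fderiv_rescale {F : H × H → ℝ} (hF : DifferentiableAt ℝ F (rescale c d z))
    (hinv : ∀ᶠ w in nhds z, F (rescale c d w) = F w) (δ : H × H) :
    fderiv ℝ F z δ = fderiv ℝ F (rescale c d z) (rescale c d δ) := by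
  have hcomp : F =ᶠ[nhds z] F ∘ rescale c d := hinv.mono fun w hw => hw.symm
  rw [hcomp.fderiv_eq, fderiv_comp z hF (rescale (H := H) c d).differentiableAt,
    ContinuousLinearMap.fderiv, ContinuousLinearMap.comp_apply]

end Rescaling

section Bracket

variable {F G : Ambient n × Ambient n → ℝ} {z : Ambient n × Ambient n}

lemma canonicalBracket_eq {gq gp : Ambient n}
    (hG : ∀ δ, fderiv ℝ G z δ = ⟪gq, δ.1⟫ + ⟪gp, δ.2⟫) :
    canonicalBracket F G z = fderiv ℝ F z (gp, -gq) := by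
  have hbasis : ∀ u : Ambient n, u = ∑ i, u i • EuclideanSpace.single i (1 : ℝ) := fun u => by
    simpa only [EuclideanSpace.basisFun_apply, EuclideanSpace.basisFun_repr] using
      ((EuclideanSpace.basisFun (Fin (n + 2)) ℝ).sum_repr u).symm
  have hsum : ((gp, -gq) : Ambient n × Ambient n) =
      ∑ i, (gp i • ((EuclideanSpace.single i 1, 0) : Ambient n × Ambient n)
        - gq i • ((0, EuclideanSpace.single i 1) : Ambient n × Ambient n)) := by
    refine Prod.ext ?_ ?_
    · simpa [Prod.fst_sum] using hbasis gp
    · simpa [Prod.snd_sum] using hbasis gq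
  rw [hsum, map_sum, canonicalBracket]
  refine Finset.sum_congr rfl fun i _ => ?_
  simp only [map_sub, map_smul, hG, inner_zero_right, zero_add, add_zero, smul_eq_mul,
    EuclideanSpace.inner_single_right, one_mul, conj_trivial]
  ring

lemma canonicalBracket_rescale {c d : ℝ} (hc : c ≠ 0)
    (hF : DifferentiableAt ℝ F (rescale c d z)) (hG : DifferentiableAt ℝ G (rescale c d z))
    (hFinv : ∀ᶠ w in nhds z, F (rescale c d w) = F w)
    (hGinv : ∀ᶠ w in nhds z, G (rescale c d w) = G w) {gq gp : Ambient n}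
    (hgrad : ∀ δ, fderiv ℝ G (rescale c d z) δ = ⟪gq, δ.1⟫ + ⟪gp, δ.2⟫) :
    canonicalBracket F G z = fderiv ℝ F (rescale c d z) (gp, -gq) := by
  have hgrad_z : ∀ δ, fderiv ℝ G z δ = ⟪c⁻¹ • gq + d • gp, δ.1⟫ + ⟪c • gp, δ.2⟫ := fun δ => by
    rw [fderiv_eq_fderiv_rescale hG hGinv, hgrad, rescale_apply]
    simp only [inner_add_left, inner_add_right, real_inner_smul_left, real_inner_smul_right]
    ring
  have hfield : rescale c d (c • gp, -(c⁻¹ • gq + d • gp)) = (gp, -gq) := by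
    refine Prod.ext (inv_smul_smul₀ hc gp) ?_
    simp only [rescale_apply]
    match_scalars <;> field_simp
    ring
  rw [canonicalBracket_eq hgrad_z, fderiv_eq_fderiv_rescale hF hFinv, hfield]

end Bracket

/-! ### The averaged system in homogeneous coordinates -/

section GeneralAxis

variable {H : Type*} [NormedAddCommGroup H] [InnerProductSpace ℝ H] {Y Z N : H} {h m M : ℝ}
  {z : H × H}

lemma differentiableAt_axialEnergy (hz : 0 < axialInner Z z.1 z.1) :
    DifferentiableAt ℝ (axialEnergy Z M) z := by
  have hsmooth : ContDiffAt ℝ 1 (axialEnergy Z M) z :=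
    ((((contDiffAt_fst.inner ℝ contDiffAt_fst).mul (contDiffAt_snd.inner ℝ contDiffAt_snd)).sub
      ((contDiffAt_fst.inner ℝ contDiffAt_snd).pow 2)).div_const 2).sub
    (contDiffAt_const.mul ((contDiffAt_const.inner ℝ contDiffAt_fst).div
      (contDiffAt_axialRadius_fst hz) (axialRadius_pos hz).ne'))
  exact hsmooth.differentiableAt one_ne_zero

lemma differentiableAt_axialIntegral (hz : 0 < axialInner Z z.1 z.1) :
    DifferentiableAt ℝ (axialIntegral Y Z N h m) z := by
  have hfst : ∀ u : H, ContDiffAt ℝ 1 (fun z : H × H => ⟪u, z.1⟫) z :=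
    fun u => contDiffAt_const.inner ℝ contDiffAt_fst
  have hsnd : ∀ u : H, ContDiffAt ℝ 1 (fun z : H × H => ⟪u, z.2⟫) z :=
    fun u => contDiffAt_const.inner ℝ contDiffAt_snd
  have hsmooth : ContDiffAt ℝ 1 (axialIntegral Y Z N h m) z :=
    (contDiff_axialMomentumSq Z).contDiffAt.sub (contDiffAt_const.mul
      ((((((contDiff_axialInner_self Z).comp contDiff_fst).contDiffAt.mul
          ((hsnd Y).mul (hsnd N))).sub
        ((contDiff_axialInner Z).contDiffAt.mul
          (((hsnd Y).mul (hfst N)).add ((hfst Y).mul (hsnd N))))).add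
        (((contDiff_axialInner_self Z).comp contDiff_snd).contDiffAt.mul
          ((hfst Y).mul (hfst N)))).add
      (contDiffAt_const.mul ((hfst Y).div (contDiffAt_axialRadius_fst hz)
        (axialRadius_pos hz).ne'))))
  exact hsmooth.differentiableAt one_ne_zero

lemma fderiv_axialIntegral (hx : axialInner Z z.1 z.1 = 1) (hxy : axialInner Z z.1 z.2 = 0)
    (δ : H × H) :
    fderiv ℝ (axialIntegral Y Z N h m) z δ
      = ⟪-flowMomentum Y Z N h m z, δ.1⟫ + ⟪flowPosition Y Z N h z, δ.2⟫ := by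
  rw [← (differentiableAt_axialIntegral (hx ▸ one_pos)).lineDeriv_eq_fderiv,
    (hasLineDerivAt_axialIntegral hx hxy δ).lineDeriv]

end GeneralAxis

section RegularPoints

variable {a m₁ m₂ f : ℝ} {z : Ambient n × Ambient n}

lemma toTangentSphere_eq_rescale (hz : z.1 ≠ 0) :
    toTangentSphere z = rescale ‖z.1‖ (-⟪‖z.1‖⁻¹ • z.1, z.2⟫) z := by
  have hnorm : ‖z.1‖ ≠ 0 := norm_ne_zero_iff.2 hz
  rw [toTangentSphere, rescale_apply, tangentialPart]
  refine Prod.ext rfl ?_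
  simp only [real_inner_smul_left]
  match_scalars <;> field_simp

lemma norm_toTangentSphere_fst (hz : z.1 ≠ 0) : ‖(toTangentSphere z).1‖ = 1 := by
  rw [toTangentSphere, norm_smul, norm_inv, norm_norm, inv_mul_cancel₀ (norm_ne_zero_iff.2 hz)]

lemma inner_toTangentSphere (hz : z.1 ≠ 0) :
    ⟪(toTangentSphere z).1, (toTangentSphere z).2⟫ = 0 := by
  have hnorm : ‖‖z.1‖⁻¹ • z.1‖ = 1 := norm_toTangentSphere_fst hz
  simp only [toTangentSphere]
  rw [real_inner_smul_right, tangentialPart, inner_sub_right, real_inner_smul_right,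
    real_inner_self_eq_norm_sq, hnorm]
  ring

/-- The points whose Kepler orbit is non-singular, stays in the lower hemisphere and avoids the
second center, in homogeneous coordinates. -/
def IsRegularPoint (n : ℕ) (a m₁ : ℝ) (z : Ambient n × Ambient n) : Prop :=
  0 < axialMomentumSq (center₁ n a) z ∧
    ∀ φ, keplerCone (center₁ n a) (m₁ * √(1 + a ^ 2)) z φ ∈ regularCone n a

lemma smul_mem_regularCone_iff {c : ℝ} (hc : 0 < c) {X : Ambient n} :
    c • X ∈ regularCone n a ↔ X ∈ regularCone n a := by
  simp only [regularCone, Set.mem_ofPred_eq, real_inner_smul_right, axialInner_smul_left,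
    axialInner_smul_right, ← neg_pos (a := c * _), ← mul_neg, mul_pos_iff_of_pos_left hc, neg_pos]

lemma inner_northPole_center₂ (n : ℕ) (a : ℝ) :
    ⟪northPole n, center₂ n a⟫ = -(√(1 + a ^ 2))⁻¹ := by
  rw [real_inner_comm, center₂, inner_center₁]
  simp [northPole, yIdx_ne_zIdx n]

lemma mem_regularCone {q : Ambient n} (hq : q ∈ lowerHemisphere n) (h₂ : q ≠ center₂ n a) :
    q ∈ regularCone n a := by
  have hneg : ⟪northPole n, q⟫ < 0 := by rw [inner_northPole]; exact hq.2
  refine ⟨hneg, axialInner_self_pos_of_ne (norm_center₂ n a) hq.1 h₂ fun h => ?_⟩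
  rw [h, inner_neg_right, inner_northPole_center₂, neg_neg] at hneg
  exact hneg.not_ge (by positivity)

lemma isRegularPoint_of_mem_averagingRegion (hm₁ : 0 < m₁) (hz : z ∈ averagingRegion n a m₁) :
    IsRegularPoint n a m₁ z := by
  obtain ⟨γ, hγ, hlow, hne⟩ := hz
  have hZ := norm_center₁ n a
  have hmom := hγ.axialMomentumSq_pos hm₁
  obtain ⟨φ, hφ, rfl⟩ := hγ.exists_isOrbitAngle hm₁
  have hsurj : Function.Surjective φ :=
    surjective_of_le_hasDerivAt (axialMomentum_pos hmom) hφ.hasDerivAt fun t => by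
      rw [norm_keplerCone_sq hZ _ hmom]
      exact le_mul_of_one_le_right (axialMomentum_pos hmom).le
        (le_add_of_nonneg_right (sq_nonneg _))
  refine ⟨hmom, fun ψ => ?_⟩
  obtain ⟨t, rfl⟩ := hsurj ψ
  exact (smul_mem_regularCone_iff (inv_pos.2 (norm_keplerCone_pos hZ _ hmom _))).1
    (mem_regularCone (hlow t) (hne t))

/-- The averaged energy in homogeneous coordinates. -/
def reducedEnergy (n : ℕ) (a m₁ m₂ f : ℝ) (z : Ambient n × Ambient n) : ℝ :=
  axialEnergy (center₁ n a) (m₁ * √(1 + a ^ 2)) z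
    + orbitIntegral (center₁ n a) (m₁ * √(1 + a ^ 2)) (perturbingPotential a m₂ f) z
      / orbitIntegral (center₁ n a) (m₁ * √(1 + a ^ 2)) (fun _ => 1) z

namespace IsRegularPoint

variable (hz : IsRegularPoint n a m₁ z)

include hz

lemma eventually : ∀ᶠ w in nhds z, IsRegularPoint n a m₁ w :=
  eventually_keplerCone_mem (norm_center₁ n a) hz.1 isOpen_regularCone hz.2

lemma axialInner_pos : 0 < axialInner (center₁ n a) z.1 z.1 :=
  axialInner_self_pos_of_momentum (norm_center₁ n a) hz.1

lemma inner_northPole_fst_neg : ⟪northPole n, z.1⟫ < 0 := by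
  have hcone := hz.2 0
  rw [keplerCone_zero, conePosition,
    smul_mem_regularCone_iff (inv_pos.2 (axialRadius_pos hz.axialInner_pos))] at hcone
  exact hcone.1

lemma fst_ne_zero : z.1 ≠ 0 := fun h => by
  simpa only [h, inner_zero_right, lt_self_iff_false] using hz.inner_northPole_fst_neg

lemma map_rescale {c : ℝ} (hc : 0 < c) (d : ℝ) : IsRegularPoint n a m₁ (rescale c d z) :=
  ⟨by rw [axialMomentumSq_rescale hc.ne']; exact hz.1, fun φ => by
    rw [keplerCone_rescale (norm_center₁ n a) hc hz.axialInner_pos]; exact hz.2 φ⟩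

lemma map_toTangentSphere : IsRegularPoint n a m₁ (toTangentSphere z) := by
  rw [toTangentSphere_eq_rescale hz.fst_ne_zero]
  exact hz.map_rescale (norm_pos_iff.2 hz.fst_ne_zero) _

lemma reducedEnergy_rescale {c : ℝ} (hc : 0 < c) (d : ℝ) :
    reducedEnergy n a m₁ m₂ f (rescale c d z) = reducedEnergy n a m₁ m₂ f z := by
  have hZ := norm_center₁ n a
  rw [reducedEnergy, axialEnergy_rescale hc, orbitIntegral_rescale hZ hc hz.axialInner_pos,
    orbitIntegral_rescale hZ hc hz.axialInner_pos, reducedEnergy]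

lemma averagedEnergy_eq_reducedEnergy (hm₁ : 0 < m₁) (hnorm : ‖z.1‖ = 1) (horth : ⟪z.1, z.2⟫ = 0) :
    averagedEnergy a m₁ m₂ f z = reducedEnergy n a m₁ m₂ f z := by
  obtain ⟨γ, T, hγ⟩ := exists_isClosedKeplerMotion (m₁ := m₁) hnorm horth hz.1
  have hex : ∃ p : (ℝ → Ambient n) × ℝ, IsClosedKeplerMotion a m₁ z p.1 p.2 := ⟨(γ, T), hγ⟩
  have hcont : Continuous fun φ => perturbingPotential a m₂ f
      (keplerCone (center₁ n a) (m₁ * √(1 + a ^ 2)) z φ) :=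
    continuous_iff_continuousAt.2 fun φ => ContinuousAt.comp
      (contDiffAt_perturbingPotential (hz.2 φ)).continuousAt
      (contDiff_keplerCone (m := 0) _ _ z).continuous.continuousAt
  rw [averagedEnergy, reducedEnergy, orbitAverage, dif_pos hex,
    hex.choose_spec.average_eq hm₁ (fun _ q hc => perturbingPotential_smul hc q) hcont,
    keplerEnergy, firstPotential_eq, axialEnergy, horth, real_inner_self_eq_norm_sq,
    real_inner_self_eq_norm_sq, hnorm]
  ring

lemma averagedEnergy_toTangentSphere (hm₁ : 0 < m₁) :
    averagedEnergy a m₁ m₂ f (toTangentSphere z) = reducedEnergy n a m₁ m₂ f z := by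
  have hfst := hz.fst_ne_zero
  rw [hz.map_toTangentSphere.averagedEnergy_eq_reducedEnergy hm₁ (norm_toTangentSphere_fst hfst)
    (inner_toTangentSphere hfst), toTangentSphere_eq_rescale hfst,
    hz.reducedEnergy_rescale (norm_pos_iff.2 hfst)]

lemma functionD_toTangentSphere :
    functionD a m₁ (toTangentSphere z) = axialIntegral (axisVector n a) (center₁ n a) (northPole n)
      (a / √(1 + a ^ 2)) m₁ z := by
  have hfst := hz.fst_ne_zero
  have hreg := hz.map_toTangentSphere
  rw [← Prod.mk.eta (p := toTangentSphere z), functionD_eq_axialIntegral m₁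
    (norm_toTangentSphere_fst hfst) hreg.inner_northPole_fst_neg hreg.axialInner_pos, Prod.mk.eta,
    toTangentSphere_eq_rescale hfst, axialIntegral_rescale (norm_pos_iff.2 hfst)]

lemma differentiableAt_orbitIntegral : DifferentiableAt ℝ
    (orbitIntegral (center₁ n a) (m₁ * √(1 + a ^ 2)) (perturbingPotential a m₂ f)) z :=
  (hasFDerivAt_orbitIntegral (norm_center₁ n a) hz.1 fun φ =>
    contDiffAt_perturbingPotential (hz.2 φ)).differentiableAt

lemma differentiableAt_orbitIntegral_one :
    DifferentiableAt ℝ (orbitIntegral (center₁ n a) (m₁ * √(1 + a ^ 2)) fun _ => 1) z :=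
  (hasFDerivAt_orbitIntegral (norm_center₁ n a) hz.1 fun _ => contDiffAt_const).differentiableAt

lemma orbitIntegral_one_ne_zero :
    orbitIntegral (center₁ n a) (m₁ * √(1 + a ^ 2)) (fun _ => 1) z ≠ 0 :=
  (orbitIntegral_one_pos (norm_center₁ n a) hz.1).ne'

lemma differentiableAt_reducedEnergy : DifferentiableAt ℝ (reducedEnergy n a m₁ m₂ f) z := by
  unfold reducedEnergy
  simp only [div_eq_mul_inv]
  exact (differentiableAt_axialEnergy hz.axialInner_pos).add
    (hz.differentiableAt_orbitIntegral.mul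
      (hz.differentiableAt_orbitIntegral_one.inv hz.orbitIntegral_one_ne_zero))

end IsRegularPoint

lemma fderiv_reducedEnergy_flowField {x e : Ambient n} {ℓ : ℝ}
    (hxe : IsAxialOrthonormal (center₁ n a) x e) (hℓ : 0 < ℓ)
    (hz : IsRegularPoint n a m₁ (x, ℓ • e)) :
    fderiv ℝ (reducedEnergy n a m₁ m₂ f) (x, ℓ • e) (flowField (axisVector n a) (center₁ n a)
      (northPole n) (a / √(1 + a ^ 2)) m₁ (x, ℓ • e)) = 0 := by
  have hF := isCenterFrame n a
  have hm : m₁ = m₁ * √(1 + a ^ 2) * (√(1 + a ^ 2))⁻¹ := by field_simp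
  set z : Ambient n × Ambient n := (x, ℓ • e)
  set δ := flowField (axisVector n a) (center₁ n a) (northPole n) (a / √(1 + a ^ 2)) m₁ z
  have hE : HasLineDerivAt ℝ (axialEnergy (center₁ n a) (m₁ * √(1 + a ^ 2))) 0 z δ :=
    hF.hasLineDerivAt_axialEnergy hxe hm
  have hV : fderiv ℝ (orbitIntegral (center₁ n a) (m₁ * √(1 + a ^ 2))
      (perturbingPotential a m₂ f)) z δ = 0 :=
    hF.fderiv_orbitIntegral_flowField (W := integralCorrection n a m₂ f) hxe hm hℓ
      (fun φ => contDiffAt_perturbingPotential (hz.2 φ))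
      (fun φ => differentiableAt_integralCorrection (hz.2 φ))
      (fun φ => fderiv_perturbingPotential_self (hz.2 φ)) fun φ y hy =>
        fderiv_perturbingPotential_flowPosition (hz.2 φ)
          (isAxialOrthonormal_keplerCone (norm_center₁ n a) _ hz.1 φ).self_left hy
  have hperiod : fderiv ℝ (orbitIntegral (center₁ n a) (m₁ * √(1 + a ^ 2)) fun _ => 1) z δ = 0 :=
    hF.fderiv_orbitIntegral_flowField (W := fun _ => 0) hxe hm hℓ (fun _ => contDiffAt_const)
      (fun _ => differentiableAt_const _) (fun _ => by simp) fun _ _ _ => by simp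
  have hV_line := (hz.differentiableAt_orbitIntegral (m₂ := m₂) (f := f)).hasFDerivAt
    |>.hasLineDerivAt δ
  have hperiod_line := hz.differentiableAt_orbitIntegral_one.hasFDerivAt.hasLineDerivAt δ
  have hline : HasLineDerivAt ℝ (reducedEnergy n a m₁ m₂ f) _ z δ := HasDerivAt.add hE
    (HasDerivAt.div hV_line hperiod_line
      (by rw [zero_smul, add_zero]; exact hz.orbitIntegral_one_ne_zero))
  rw [← hz.differentiableAt_reducedEnergy.lineDeriv_eq_fderiv, hline.lineDeriv, hV, hperiod]
  simp only [zero_mul, mul_zero, sub_zero, zero_div, add_zero]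

lemma IsRegularPoint.canonicalBracket_eq_zero (hz : IsRegularPoint n a m₁ z) :
    canonicalBracket (reducedEnergy n a m₁ m₂ f) (axialIntegral (axisVector n a) (center₁ n a)
      (northPole n) (a / √(1 + a ^ 2)) m₁) z = 0 := by
  have hZ := norm_center₁ n a
  have hℓ := axialMomentum_pos hz.1
  have hxe := isAxialOrthonormal_cone hZ hz.1
  have hxy := axialInner_conePosition_coneVelocity hZ hz.axialInner_pos
  obtain ⟨c, d, hc, hcd⟩ := exists_rescale_eq hz.axialInner_pos
  have hreg := hz.map_rescale hc d
  rw [canonicalBracket_rescale hc.ne' hreg.differentiableAt_reducedEnergy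
    (differentiableAt_axialIntegral hreg.axialInner_pos)
    (hz.eventually.mono fun w hw => hw.reducedEnergy_rescale hc d)
    (Filter.Eventually.of_forall fun w => axialIntegral_rescale hc w)
    (fderiv_axialIntegral (by rw [hcd]; exact hxe.self_left) (by rw [hcd]; exact hxy)), neg_neg]
  rw [hcd, ← smul_inv_smul₀ hℓ.ne' (coneVelocity (center₁ n a) z)] at hreg ⊢
  exact fderiv_reducedEnergy_flowField hxe hℓ hreg

end RegularPoints

end HemisphericalLagrange

end

open HemisphericalLagrange in
theorem proposition4 (n : ℕ) (a m₁ m₂ f : ℝ) (hm₁ : 0 < m₁)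
    (z : Ambient n × Ambient n) (hz : z ∈ averagingRegion n a m₁) :
    (∃ (γ : ℝ → Ambient n) (T : ℝ), IsClosedKeplerMotion a m₁ z γ T) ∧
      DifferentiableAt ℝ (averagedEnergy a m₁ m₂ f ∘ toTangentSphere) z ∧
      DifferentiableAt ℝ (functionD a m₁ ∘ toTangentSphere) z ∧
      spherePoisson (averagedEnergy a m₁ m₂ f) (functionD a m₁) z = 0 := by
  have hreg := isRegularPoint_of_mem_averagingRegion hm₁ hz
  have hF : averagedEnergy a m₁ m₂ f ∘ toTangentSphere =ᶠ[nhds z] reducedEnergy n a m₁ m₂ f :=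
    hreg.eventually.mono fun _ hw => hw.averagedEnergy_toTangentSphere hm₁
  have hG : functionD a m₁ ∘ toTangentSphere =ᶠ[nhds z] axialIntegral (axisVector n a)
      (center₁ n a) (northPole n) (a / √(1 + a ^ 2)) m₁ :=
    hreg.eventually.mono fun _ hw => hw.functionD_toTangentSphere
  obtain ⟨γ, hγ, -⟩ := hz
  refine ⟨exists_isClosedKeplerMotion hγ.norm_fst hγ.inner_eq_zero hreg.1,
    hreg.differentiableAt_reducedEnergy.congr_of_eventuallyEq hF,
    (differentiableAt_axialIntegral hreg.axialInner_pos).congr_of_eventuallyEq hG, ?_⟩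
  rw [spherePoisson, canonicalBracket, hF.fderiv_eq, hG.fderiv_eq, ← canonicalBracket]
  exact hreg.canonicalBracket_eq_zero
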